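/- Let $k$ be a non-archimedean field, that is, a field which is complete with respect to a multiplicative non-archimedean absolute value (the trivial absolute value is allowed), and let $K$ and $L$ be non-archimedean extensions of $k$: extension fields equipped with multiplicative non-archimedean absolute values that extend the one on $k$ and with respect to which they are complete. Let $G=\mathbb{R}_{>0}^{\times}$. For a commutative non-archimedean normed ring $A$ with spectral seminorm $\rho_A(a)=\lim_{n}\|a^n\|^{1/n}$, let $$\widetilde{A}=\bigoplus_{r\in G}\{a\in A:\rho_A(a)\le r\}/\{a\in A:\rho_A(a)<r\}$$ be its $G$-graded reduction; if $A$ is a field with multiplicative norm $|\cdot|$, then $\rho_A=|\cdot|$. For a $G$-graded commutative ring $B$, let $\operatorname{Spec}_G(B)$ be the set of homogeneous prime ideals of $B$. Let $\mathcal{M}(A)$ be the Berkovich spectrum, i.e. the set of bounded multiplicative seminorms on $A$. For $x\in\mathcal{M}(A)$ let $\mathcal{H}(x)$ be the completed residue field of $x$ (the completion of the fraction field of $A/\{a : |a|_x=0\}$). The character $A\to\mathcal{H}(x)$ induces a graded homomorphism $\widetilde{A}\to\widetilde{\mathcal{H}(x)}$, and the reduction map $\mathcal{M}(A)\to\operatorname{Spec}_G(\widetilde{A})$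 sends $x$ to its kernel. Let $K\widehat{\otimes}_k L$ be the completion of $K\otimes_k L$ with respect to the tensor product seminorm $\|z\|=\inf\max_i|a_i||b_i|$, the infimum being taken over all presentations $z=\sum_i a_i\otimes b_i$, and let $\widetilde{K}\otimes_{\widetilde{k}}\widetilde{L}$ carry the grading in which $a\otimes b$ has degree $rs$ if $a$ and $b$ are homogeneous of degrees $r$ and $s$. Let $$\psi\colon\mathcal{M}(K\widehat{\otimes}_kL)\longrightarrow\operatorname{Spec}_G(\widetilde{K}\otimes_{\widetilde{k}}\widetilde{L})$$ be the composition of the reduction map $\mathcal{M}(K\widehat{\otimes}_kL)\to\operatorname{Spec}_G\bigl(\widetilde{K\widehat{\otimes}_kL}\bigr)$ with the pullback of homogeneous prime ideals along the natural graded homomorphism $\widetilde{K}\otimes_{\widetilde{k}}\widetilde{L}\to\widetilde{K\widehat{\otimes}_kL}$. Then $\psi$ is surjective. -/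

import Mathlib

noncomputable section

namespace BerkovichReduction
open scoped DirectSum TensorProduct

/-- The grading group `G = ℝ_{>0}` (under multiplication), written additively. -/
def Grade : Type := Additive {r : ℝ // 0 < r}

instance : AddCommGroup Grade := inferInstanceAs (AddCommGroup (Additive {r : ℝ // 0 < r}))
instance : LinearOrder Grade := inferInstanceAs (LinearOrder (Additive {r : ℝ // 0 < r}))
instance : IsOrderedCancelAddMonoid Grade :=
  inferInstanceAs (IsOrderedCancelAddMonoid (Additive {r : ℝ // 0 < r}))

/-- The underlying positive real number. -/
def Grade.val (r : Grade) : ℝ := (Additive.toMul r).1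

theorem Grade.val_pos (r : Grade) : 0 < r.val := (Additive.toMul r).2
theorem Grade.val_add (r s : Grade) : (r + s).val = r.val * s.val := rfl
theorem Grade.val_zero : (0 : Grade).val = 1 := rfl

/-- A submultiplicative nonarchimedean seminorm with `p 1 ≤ 1`. -/
structure NonarchRingSeminorm (R : Type*) [CommRing R] extends RingSeminorm R where
  map_one_le_one' : toFun 1 ≤ 1
  nonarch' : IsNonarchimedean toFun

namespace NonarchRingSeminorm
variable {R : Type*} [CommRing R] (p : NonarchRingSeminorm R)

instance : CoeFun (NonarchRingSeminorm R) (fun _ => R → ℝ) := ⟨fun p => p.toFun⟩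

theorem map_zero : p 0 = 0 := p.map_zero'
theorem map_neg (a : R) : p (-a) = p a := p.neg' a
theorem add_le_max (a b : R) : p (a + b) ≤ max (p a) (p b) := p.nonarch' a b
theorem mul_le (a b : R) : p (a * b) ≤ p a * p b := p.mul_le' a b
theorem nonneg (a : R) : 0 ≤ p a := apply_nonneg p.toRingSeminorm a

def ballLE (r : Grade) : AddSubgroup R where
  carrier := {a | p a ≤ r.val}
  zero_mem' := by simpa [p.map_zero] using r.val_pos.le
  add_mem' {a b} ha hb := (p.add_le_max a b).trans (max_le ha hb)
  neg_mem' {a} ha := by simpa [p.map_neg] using ha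

def ballLT (r : Grade) : AddSubgroup R where
  carrier := {a | p a < r.val}
  zero_mem' := by simpa [p.map_zero] using r.val_pos
  add_mem' {a b} ha hb := (p.add_le_max a b).trans_lt (max_lt ha hb)
  neg_mem' {a} ha := by simpa [p.map_neg] using ha

/-- `{p ≤ r} / {p < r}`. -/
def Piece (r : Grade) : Type _ := p.ballLE r ⧸ (p.ballLT r).addSubgroupOf (p.ballLE r)

instance (r : Grade) : AddCommGroup (p.Piece r) :=
  inferInstanceAs (AddCommGroup (p.ballLE r ⧸ (p.ballLT r).addSubgroupOf (p.ballLE r)))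

def pieceMk (r : Grade) : p.ballLE r →+ p.Piece r := QuotientAddGroup.mk' _

theorem pieceMk_surjective (r : Grade) : Function.Surjective (p.pieceMk r) :=
  QuotientAddGroup.mk'_surjective _

theorem pieceMk_eq_iff {r : Grade} (a b : p.ballLE r) :
    p.pieceMk r a = p.pieceMk r b ↔ p ((b : R) - a) < r.val := by
  refine (QuotientAddGroup.eq).trans ?_
  rw [AddSubgroup.mem_addSubgroupOf, neg_add_eq_sub]
  rfl

theorem mul_mem_ballLE {r s : Grade} (a : p.ballLE r) (b : p.ballLE s) :
    (a : R) * b ∈ p.ballLE (r + s) :=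
  (p.mul_le _ _).trans (mul_le_mul a.2 b.2 (p.nonneg _) r.val_pos.le)

/-- Multiplication of classes, `[a] [b] = [a b]`. -/
def pieceMul {r s : Grade} : p.Piece r → p.Piece s → p.Piece (r + s) :=
  Quotient.map₂ (fun a b => ⟨(a : R) * b, p.mul_mem_ballLE a b⟩) (by
    intro a a' haa b b' hbb
    have ha : p ((a' : R) - a) < r.val := (p.pieceMk_eq_iff a a').1 (Quotient.sound haa)
    have hb : p ((b' : R) - b) < s.val := (p.pieceMk_eq_iff b b').1 (Quotient.sound hbb)
    refine Quotient.exact ((p.pieceMk_eq_iff (r := r + s) _ _).2 ?_)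
    show p ((a' : R) * b' - a * b) < r.val * s.val
    have h : (a' : R) * b' - a * b = (a' - a) * b' + a * (b' - b) := by ring
    rw [h]
    refine (p.add_le_max _ _).trans_lt (max_lt ?_ ?_)
    · exact (p.mul_le _ _).trans_lt (mul_lt_mul_of_lt_of_le_of_nonneg_of_pos ha b'.2 (p.nonneg _) s.val_pos)
    · exact (p.mul_le _ _).trans_lt (mul_lt_mul_of_le_of_lt_of_nonneg_of_pos a.2 hb (p.nonneg _) r.val_pos))

theorem pieceMul_mk {r s : Grade} (a : p.ballLE r) (b : p.ballLE s) :
    p.pieceMul (p.pieceMk r a) (p.pieceMk s b) =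
      p.pieceMk (r + s) ⟨(a : R) * b, p.mul_mem_ballLE a b⟩ := rfl

instance : GradedMonoid.GMul p.Piece := ⟨p.pieceMul⟩
instance : GradedMonoid.GOne p.Piece := ⟨p.pieceMk 0 ⟨1, p.map_one_le_one'⟩⟩

theorem gradedMk_eq {r s : Grade} (h : r = s) (a : p.ballLE r) (b : p.ballLE s)
    (hab : (a : R) = b) :
    GradedMonoid.mk (A := p.Piece) r (p.pieceMk r a) = GradedMonoid.mk s (p.pieceMk s b) := by
  subst h
  obtain rfl : a = b := Subtype.ext hab
  rfl

instance : DirectSum.GCommRing p.Piece where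
  mul_zero {r s} a := by
    obtain ⟨a, rfl⟩ := p.pieceMk_surjective r a
    exact congrArg (p.pieceMk (r + s)) (Subtype.ext (mul_zero (a : R)))
  zero_mul {r s} b := by
    obtain ⟨b, rfl⟩ := p.pieceMk_surjective s b
    exact congrArg (p.pieceMk (r + s)) (Subtype.ext (zero_mul (b : R)))
  mul_add {r s} a b c := by
    obtain ⟨a, rfl⟩ := p.pieceMk_surjective r a
    obtain ⟨b, rfl⟩ := p.pieceMk_surjective s b
    obtain ⟨c, rfl⟩ := p.pieceMk_surjective s c
    exact congrArg (p.pieceMk (r + s)) (Subtype.ext (mul_add (a : R) b c))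
  add_mul {r s} a b c := by
    obtain ⟨a, rfl⟩ := p.pieceMk_surjective r a
    obtain ⟨b, rfl⟩ := p.pieceMk_surjective r b
    obtain ⟨c, rfl⟩ := p.pieceMk_surjective s c
    exact congrArg (p.pieceMk (r + s)) (Subtype.ext (add_mul (a : R) b c))
  one_mul a := by
    obtain ⟨r, a⟩ := a
    obtain ⟨a, rfl⟩ := p.pieceMk_surjective r a
    exact p.gradedMk_eq (zero_add r) _ _ (one_mul (a : R))
  mul_one a := by
    obtain ⟨r, a⟩ := a
    obtain ⟨a, rfl⟩ := p.pieceMk_surjective r a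
    exact p.gradedMk_eq (add_zero r) _ _ (mul_one (a : R))
  mul_assoc a b c := by
    obtain ⟨r, a⟩ := a
    obtain ⟨s, b⟩ := b
    obtain ⟨t, c⟩ := c
    obtain ⟨a, rfl⟩ := p.pieceMk_surjective r a
    obtain ⟨b, rfl⟩ := p.pieceMk_surjective s b
    obtain ⟨c, rfl⟩ := p.pieceMk_surjective t c
    exact p.gradedMk_eq (add_assoc r s t) _ _ (mul_assoc (a : R) b c)
  mul_comm a b := by
    obtain ⟨r, a⟩ := a
    obtain ⟨s, b⟩ := b
    obtain ⟨a, rfl⟩ := p.pieceMk_surjective r a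
    obtain ⟨b, rfl⟩ := p.pieceMk_surjective s b
    exact p.gradedMk_eq (add_comm r s) _ _ (mul_comm (a : R) b)
  natCast n := n • p.pieceMk 0 ⟨1, p.map_one_le_one'⟩
  natCast_zero := zero_smul _ _
  natCast_succ n := succ_nsmul _ _
  intCast n := n • p.pieceMk 0 ⟨1, p.map_one_le_one'⟩
  intCast_ofNat n := natCast_zsmul _ _
  intCast_negSucc_ofNat n := negSucc_zsmul _ _

/-- The graded ring `⨁_r {p ≤ r} / {p < r}`. -/
def Reduction : Type _ := ⨁ r : Grade, p.Piece r

instance : CommRing p.Reduction := inferInstanceAs (CommRing (⨁ r : Grade, p.Piece r))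

/-- The homogeneous component of degree `r` of the graded reduction. -/
def grading (r : Grade) : AddSubgroup p.Reduction :=
  (DirectSum.of p.Piece r).range

theorem of_mem_grading {r : Grade} (a : p.Piece r) :
    (DirectSum.of p.Piece r a : p.Reduction) ∈ p.grading r := ⟨a, rfl⟩

instance : SetLike.GradedMonoid p.grading where
  one_mem := ⟨GradedMonoid.GOne.one, rfl⟩
  mul_mem := by
    rintro r s _ _ ⟨a, rfl⟩ ⟨b, rfl⟩
    exact ⟨GradedMonoid.GMul.mul a b, (DirectSum.of_mul_of a b).symm⟩

def decomposeHom : p.Reduction →+ ⨁ r, p.grading r :=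
  DirectSum.toAddMonoid fun r =>
    (DirectSum.of (fun r => p.grading r) r).comp (DirectSum.of p.Piece r).rangeRestrict

theorem decomposeHom_of {r : Grade} (a : p.Piece r) :
    p.decomposeHom (DirectSum.of p.Piece r a) =
      DirectSum.of (fun r => p.grading r) r ⟨_, p.of_mem_grading a⟩ :=
  DirectSum.toAddMonoid_of _ _ _

instance : GradedRing p.grading where
  toDecomposition := DirectSum.Decomposition.ofAddHom p.grading p.decomposeHom
    (by
      refine DirectSum.addHom_ext' fun r => AddMonoidHom.ext fun a => ?_
      show DirectSum.coeAddMonoidHom p.grading (p.decomposeHom (DirectSum.of p.Piece r a)) = _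
      rw [decomposeHom_of, DirectSum.coeAddMonoidHom_of]
      rfl)
    (by
      refine DirectSum.addHom_ext' fun r => AddMonoidHom.ext ?_
      rintro ⟨_, a, rfl⟩
      show p.decomposeHom (DirectSum.coeAddMonoidHom p.grading (DirectSum.of _ r _)) = _
      rw [DirectSum.coeAddMonoidHom_of]
      exact p.decomposeHom_of a)

section Functoriality

variable {S T : Type*} [CommRing S] [CommRing T]
variable {p} {q : NonarchRingSeminorm S} {t : NonarchRingSeminorm T}

def pieceMap (f : R →+* S) (h : ∀ a, q (f a) ≤ p a) (r : Grade) : p.Piece r →+ q.Piece r :=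
  QuotientAddGroup.lift _
    ((q.pieceMk r).comp
      { toFun := fun a : p.ballLE r => (⟨f a, (h a).trans a.2⟩ : q.ballLE r)
        map_zero' := Subtype.ext (by simp)
        map_add' := fun a b => Subtype.ext (by simp) })
    (by
      intro a ha
      refine Eq.trans ?_ (_root_.map_zero (q.pieceMk r))
      refine ((q.pieceMk_eq_iff 0 _).2 ?_).symm
      simpa using (h a).trans_lt ha)

theorem pieceMap_mk (f : R →+* S) (h : ∀ a, q (f a) ≤ p a) (r : Grade) (a : p.ballLE r) :
    pieceMap f h r (p.pieceMk r a) = q.pieceMk r ⟨f a, (h a).trans a.2⟩ := rfl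

/-- A ring homomorphism that does not increase the seminorms induces a homomorphism of graded
reductions. -/
def mapRingHom (f : R →+* S) (h : ∀ a, q (f a) ≤ p a) : p.Reduction →+* q.Reduction :=
  DirectSum.toSemiring (fun r => (DirectSum.of q.Piece r).comp (pieceMap f h r))
    (by
      refine congrArg (DirectSum.of q.Piece 0) ?_
      exact congrArg (q.pieceMk 0) (Subtype.ext (map_one f)))
    (by
      intro r s a b
      obtain ⟨a, rfl⟩ := p.pieceMk_surjective r a
      obtain ⟨b, rfl⟩ := p.pieceMk_surjective s b
      refine Eq.trans ?_ (DirectSum.of_mul_of _ _).symm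
      exact congrArg (DirectSum.of q.Piece (r + s))
        (congrArg (q.pieceMk (r + s)) (Subtype.ext (map_mul f (a : R) b))))

theorem mapRingHom_of (f : R →+* S) (h : ∀ a, q (f a) ≤ p a) (r : Grade) (a : p.Piece r) :
    mapRingHom f h (DirectSum.of p.Piece r a) = DirectSum.of q.Piece r (pieceMap f h r a) :=
  DirectSum.toSemiring_of _ _ _ _ _

def map (f : R →+* S) (h : ∀ a, q (f a) ≤ p a) : p.grading →+*ᵍ q.grading where
  __ := mapRingHom f h
  map_mem := by
    rintro r _ ⟨a, rfl⟩
    exact ⟨pieceMap f h r a, (mapRingHom_of f h r a).symm⟩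

theorem mapRingHom_comp (f : R →+* S) (h : ∀ a, q (f a) ≤ p a)
    (g : S →+* T) (h' : ∀ a, t (g a) ≤ q a) :
    (mapRingHom g h').comp (mapRingHom f h) =
      mapRingHom (p := p) (q := t) (g.comp f) fun a => (h' (f a)).trans (h a) := by
  refine DirectSum.ringHom_ext fun r a => ?_
  obtain ⟨a, rfl⟩ := p.pieceMk_surjective r a
  exact ((congrArg (mapRingHom g h') (mapRingHom_of f h r _)).trans
    (mapRingHom_of g h' r _)).trans
    (mapRingHom_of (p := p) (q := t) (g.comp f) (fun a => (h' (f a)).trans (h a)) r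
      (p.pieceMk r a)).symm

end Functoriality

/-- The spectral seminorm `a ↦ inf_{n ≥ 1} p (a ^ n) ^ (1 / n) = lim_n p (a ^ n) ^ (1 / n)`. -/
def spectral : NonarchRingSeminorm R where
  __ := smoothingSeminorm p.toRingSeminorm p.map_one_le_one' p.nonarch'
  map_one_le_one' := smoothingSeminorm_map_one_le_one _ p.map_one_le_one' p.nonarch'
  nonarch' := isNonarchimedean_smoothingFun _ p.map_one_le_one' p.nonarch'

theorem spectral_apply (a : R) : p.spectral a = smoothingFun p.toRingSeminorm a := rfl

theorem spectral_mono {S : Type*} [CommRing S] (q : NonarchRingSeminorm S) (f : R →+* S)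
    (h : ∀ a, q (f a) ≤ p a) (a : R) : q.spectral (f a) ≤ p.spectral a := by
  refine le_of_tendsto_of_tendsto'
    (tendsto_smoothingFun_of_map_one_le_one q.toRingSeminorm q.map_one_le_one' (f a))
    (tendsto_smoothingFun_of_map_one_le_one p.toRingSeminorm p.map_one_le_one' a) fun n => ?_
  refine Real.rpow_le_rpow (q.nonneg _) ?_ (by positivity)
  rw [← map_pow]
  exact h (a ^ n)

theorem spectral_of_mul (h : ∀ a b, p (a * b) = p a * p b) (a : R) : p.spectral a = p a :=
  smoothingFun_apply_of_map_mul_eq_mul p.toRingSeminorm p.map_one_le_one' (h a)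

end NonarchRingSeminorm

section GradedReduction

/-- The norm of a nonarchimedean commutative normed ring with `‖1‖ ≤ 1`. -/
def nonarchNorm (A : Type*) [SeminormedCommRing A] [IsUltrametricDist A]
    [Fact (‖(1 : A)‖ ≤ 1)] : NonarchRingSeminorm A where
  toFun := norm
  map_zero' := norm_zero
  add_le' := norm_add_le
  neg' := norm_neg
  mul_le' := norm_mul_le
  map_one_le_one' := Fact.out
  nonarch' := IsUltrametricDist.isNonarchimedean_norm

instance (A : Type*) [SeminormedCommRing A] [NormOneClass A] : Fact (‖(1 : A)‖ ≤ 1) :=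
  ⟨norm_one.le⟩

variable (A B C : Type*)
variable [SeminormedCommRing A] [IsUltrametricDist A] [Fact (‖(1 : A)‖ ≤ 1)]
variable [SeminormedCommRing B] [IsUltrametricDist B] [Fact (‖(1 : B)‖ ≤ 1)]
variable [SeminormedCommRing C] [IsUltrametricDist C] [Fact (‖(1 : C)‖ ≤ 1)]

/-- The graded reduction `Ã = ⨁_r {ρ ≤ r} / {ρ < r}`, where `ρ` is the spectral seminorm of `A`
(for a field with multiplicative norm, `ρ` is the norm itself). -/
def GradedReduction : Type _ := (nonarchNorm A).spectral.Reduction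

instance : CommRing (GradedReduction A) :=
  inferInstanceAs (CommRing (nonarchNorm A).spectral.Reduction)

namespace GradedReduction

def grading : Grade → AddSubgroup (GradedReduction A) := (nonarchNorm A).spectral.grading

instance : GradedRing (grading A) :=
  inferInstanceAs (GradedRing (nonarchNorm A).spectral.grading)

variable {A B C}

/-- Functoriality for contractive ring homomorphisms: `[a] ↦ [f a]`. -/
def map (f : A →+* B) (h : ∀ a, ‖f a‖ ≤ ‖a‖) : grading A →+*ᵍ grading B :=
  NonarchRingSeminorm.map f ((nonarchNorm A).spectral_mono (nonarchNorm B) f h)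

theorem map_map (f : A →+* B) (h : ∀ a, ‖f a‖ ≤ ‖a‖) (g : B →+* C) (h' : ∀ a, ‖g a‖ ≤ ‖a‖)
    (z : GradedReduction A) :
    map g h' (map f h z) = map (g.comp f) (fun a => (h' (f a)).trans (h a)) z :=
  DFunLike.congr_fun (NonarchRingSeminorm.mapRingHom_comp
    (p := (nonarchNorm A).spectral) (q := (nonarchNorm B).spectral)
    (t := (nonarchNorm C).spectral) f _ g _) z

end GradedReduction

end GradedReduction

section HomogeneousSpectrum

/-- The homogeneous spectrum `Spec_G(A)`: the set of homogeneous prime ideals. -/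
def HomogeneousSpectrum {A : Type*} [CommRing A] (𝒜 : Grade → AddSubgroup A) [GradedRing 𝒜] :
    Type _ := {I : HomogeneousIdeal 𝒜 // I.toIdeal.IsPrime}

/-- `I ↦ f⁻¹(I)`. -/
def HomogeneousSpectrum.comap {A B : Type*} [CommRing A] [CommRing B]
    {𝒜 : Grade → AddSubgroup A} [GradedRing 𝒜] {ℬ : Grade → AddSubgroup B} [GradedRing ℬ]
    (f : 𝒜 →+*ᵍ ℬ) (I : HomogeneousSpectrum ℬ) : HomogeneousSpectrum 𝒜 :=
  ⟨I.1.comap f, have := I.2; Ideal.comap_isPrime (f : A →+* B) I.1.toIdeal⟩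

/-- In a nonzero graded ring in which products of nonzero homogeneous elements are nonzero, the zero
ideal is a point of the homogeneous spectrum. -/
def HomogeneousSpectrum.zero {A : Type*} [CommRing A] [Nontrivial A]
    (𝒜 : Grade → AddSubgroup A) [GradedRing 𝒜]
    (h : ∀ r s, ∀ a ∈ 𝒜 r, ∀ b ∈ 𝒜 s, a * b = 0 → a = 0 ∨ b = 0) : HomogeneousSpectrum 𝒜 :=
  ⟨⊥, (HomogeneousIdeal.isHomogeneous (⊥ : HomogeneousIdeal 𝒜)).isPrime_of_homogeneous_mem_or_mem
    (by simp)
    (by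
      rintro a b ⟨r, ha⟩ ⟨s, hb⟩ hab
      simpa using h r s a ha b hb (by simpa using hab))⟩

end HomogeneousSpectrum

section GradedTensor

variable {C A B : Type*} [CommRing C] [CommRing A] [CommRing B] [Algebra C A] [Algebra C B]
variable (𝒞 : Grade → AddSubgroup C) (𝒜 : Grade → AddSubgroup A) (ℬ : Grade → AddSubgroup B)

/-- The degree `g` part of `A ⊗ B`: the subgroup generated by the `a ⊗ b` with `a` and `b`
homogeneous of degrees `r` and `s`, `r s = g`. -/
def tensorGrading (g : Grade) : AddSubgroup (A ⊗[C] B) :=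
  AddSubgroup.closure {z | ∃ r s, r + s = g ∧ ∃ a ∈ 𝒜 r, ∃ b ∈ ℬ s, z = a ⊗ₜ[C] b}

variable {𝒜 ℬ}

theorem tmul_mem_tensorGrading {r s : Grade} {a : A} {b : B} (ha : a ∈ 𝒜 r) (hb : b ∈ ℬ s) :
    a ⊗ₜ[C] b ∈ tensorGrading (C := C) 𝒜 ℬ (r + s) :=
  AddSubgroup.subset_closure ⟨r, s, rfl, a, ha, b, hb, rfl⟩

variable [GradedRing 𝒞] [GradedRing 𝒜] [GradedRing ℬ]

instance : SetLike.GradedMonoid (tensorGrading (C := C) 𝒜 ℬ) where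
  one_mem := AddSubgroup.subset_closure
    ⟨0, 0, add_zero 0, 1, SetLike.one_mem_graded 𝒜, 1, SetLike.one_mem_graded ℬ, rfl⟩
  mul_mem := by
    intro g h x y hx hy
    induction hx using AddSubgroup.closure_induction with
    | zero => rw [zero_mul]; exact zero_mem _
    | add _ _ _ _ h₁ h₂ => rw [add_mul]; exact add_mem h₁ h₂
    | neg _ _ h₁ => rw [neg_mul]; exact neg_mem h₁
    | mem x hx =>
      obtain ⟨r, s, rfl, a, ha, b, hb, rfl⟩ := hx
      induction hy using AddSubgroup.closure_induction with
      | zero => rw [mul_zero]; exact zero_mem _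
      | add _ _ _ _ h₁ h₂ => rw [mul_add]; exact add_mem h₁ h₂
      | neg _ _ h₁ => rw [mul_neg]; exact neg_mem h₁
      | mem y hy =>
        obtain ⟨r', s', rfl, a', ha', b', hb', rfl⟩ := hy
        rw [Algebra.TensorProduct.tmul_mul_tmul, add_add_add_comm]
        exact tmul_mem_tensorGrading (SetLike.mul_mem_graded ha ha') (SetLike.mul_mem_graded hb hb')

variable (C 𝒜 ℬ) in
def tensorInclLeft : 𝒜 →+*ᵍ tensorGrading (C := C) 𝒜 ℬ where
  __ := (Algebra.TensorProduct.includeLeftRingHom : A →+* A ⊗[C] B)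
  map_mem {r a} ha := by
    have h := tmul_mem_tensorGrading (C := C) ha (SetLike.one_mem_graded ℬ)
    rwa [add_zero] at h

variable (C 𝒜 ℬ) in
def tensorInclRight : ℬ →+*ᵍ tensorGrading (C := C) 𝒜 ℬ where
  __ := ((Algebra.TensorProduct.includeRight : B →ₐ[C] A ⊗[C] B) : B →+* A ⊗[C] B)
  map_mem {r b} hb := by
    have h := tmul_mem_tensorGrading (C := C) (SetLike.one_mem_graded 𝒜) hb
    rwa [zero_add] at h

/-- A multiplicative map into a (not yet known to be direct) family of subgroups, followed by
the decomposition into homogeneous components. -/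
def componentsHomAux {R S : Type*} [CommRing R] [CommRing S] {ℛ : Grade → AddSubgroup R}
    {𝒮 : Grade → AddSubgroup S} [GradedRing ℛ] [SetLike.GradedMonoid 𝒮] (f : ℛ →+*ᵍ 𝒮) :
    (⨁ g, ℛ g) →+* ⨁ g, 𝒮 g :=
  DirectSum.toSemiring
    (fun r => (DirectSum.of (fun g => 𝒮 g) r).comp
      { toFun := fun a : ℛ r => (⟨f a, f.map_mem a.2⟩ : 𝒮 r)
        map_zero' := Subtype.ext (map_zero f)
        map_add' := fun a b => Subtype.ext (map_add f (a : R) b) })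
    (congrArg (DirectSum.of (fun g => 𝒮 g) 0) (Subtype.ext (map_one f)))
    (fun a b => (congrArg (DirectSum.of (fun g => 𝒮 g) _)
      (Subtype.ext (map_mul f (a : R) b))).trans (DirectSum.of_mul_of _ _).symm)

theorem componentsHomAux_of {R S : Type*} [CommRing R] [CommRing S] {ℛ : Grade → AddSubgroup R}
    {𝒮 : Grade → AddSubgroup S} [GradedRing ℛ] [SetLike.GradedMonoid 𝒮] (f : ℛ →+*ᵍ 𝒮)
    {r : Grade} (a : ℛ r) :
    componentsHomAux f (DirectSum.of (fun g => ℛ g) r a) =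
      DirectSum.of (fun g => 𝒮 g) r ⟨f a, f.map_mem a.2⟩ :=
  DirectSum.toSemiring_of _ _ _ _ _

def componentsHom {R S : Type*} [CommRing R] [CommRing S] {ℛ : Grade → AddSubgroup R}
    {𝒮 : Grade → AddSubgroup S} [GradedRing ℛ] [SetLike.GradedMonoid 𝒮] (f : ℛ →+*ᵍ 𝒮) :
    R →+* ⨁ g, 𝒮 g :=
  (componentsHomAux f).comp (DirectSum.decomposeRingEquiv ℛ).toRingHom

theorem componentsHom_of_mem {R S : Type*} [CommRing R] [CommRing S] {ℛ : Grade → AddSubgroup R}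
    {𝒮 : Grade → AddSubgroup S} [GradedRing ℛ] [SetLike.GradedMonoid 𝒮] (f : ℛ →+*ᵍ 𝒮)
    {r : Grade} {a : R} (ha : a ∈ ℛ r) :
    componentsHom f a = DirectSum.of (fun g => 𝒮 g) r ⟨f a, f.map_mem ha⟩ := by
  show componentsHomAux f (DirectSum.decompose ℛ a) = _
  rw [DirectSum.decompose_of_mem ℛ ha, componentsHomAux_of]

theorem coe_componentsHom {R S : Type*} [CommRing R] [CommRing S] {ℛ : Grade → AddSubgroup R}
    {𝒮 : Grade → AddSubgroup S} [GradedRing ℛ] [SetLike.GradedMonoid 𝒮] (f : ℛ →+*ᵍ 𝒮) (a : R) :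
    DirectSum.coeAddMonoidHom 𝒮 (componentsHom f a) = f a := by
  induction a using DirectSum.Decomposition.inductionOn ℛ with
  | zero => simp
  | homogeneous m => rw [componentsHom_of_mem f m.2, DirectSum.coeAddMonoidHom_of]
  | add a b ha hb => rw [map_add, map_add, ha, hb, map_add]

/-- Decomposition of an element of the tensor product into homogeneous components. -/
def tensorComponents (hA : ∀ r, ∀ c ∈ 𝒞 r, algebraMap C A c ∈ 𝒜 r)
    (hB : ∀ r, ∀ c ∈ 𝒞 r, algebraMap C B c ∈ ℬ r) :
    A ⊗[C] B →+ ⨁ g, tensorGrading (C := C) 𝒜 ℬ g :=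
  TensorProduct.liftAddHom
    ((AddMonoidHom.mul.comp (componentsHom (tensorInclLeft C 𝒜 ℬ)).toAddMonoidHom).compl₂
      (componentsHom (tensorInclRight C 𝒜 ℬ)).toAddMonoidHom)
    (by
      intro c a b
      have key : componentsHom (tensorInclLeft C 𝒜 ℬ) (algebraMap C A c) =
          componentsHom (tensorInclRight C 𝒜 ℬ) (algebraMap C B c) := by
        induction c using DirectSum.Decomposition.inductionOn 𝒞 with
        | zero => simp only [map_zero]
        | homogeneous c =>
          rw [componentsHom_of_mem _ (hA _ _ c.2), componentsHom_of_mem _ (hB _ _ c.2)]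
          refine congrArg _ (Subtype.ext ?_)
          exact Algebra.TensorProduct.tmul_one_eq_one_tmul _
        | add c d hc hd => simp only [map_add, hc, hd]
      show componentsHom (tensorInclLeft C 𝒜 ℬ) (c • a) * componentsHom (tensorInclRight C 𝒜 ℬ) b
        = componentsHom (tensorInclLeft C 𝒜 ℬ) a * componentsHom (tensorInclRight C 𝒜 ℬ) (c • b)
      rw [Algebra.smul_def, Algebra.smul_def, map_mul, map_mul, key]
      ring)

theorem tensorComponents_tmul (hA : ∀ r, ∀ c ∈ 𝒞 r, algebraMap C A c ∈ 𝒜 r)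
    (hB : ∀ r, ∀ c ∈ 𝒞 r, algebraMap C B c ∈ ℬ r) (a : A) (b : B) :
    tensorComponents 𝒞 hA hB (a ⊗ₜ b) =
      componentsHom (tensorInclLeft C 𝒜 ℬ) a * componentsHom (tensorInclRight C 𝒜 ℬ) b := rfl

theorem tensorComponents_of_mem (hA : ∀ r, ∀ c ∈ 𝒞 r, algebraMap C A c ∈ 𝒜 r)
    (hB : ∀ r, ∀ c ∈ 𝒞 r, algebraMap C B c ∈ ℬ r) {g : Grade} {z : A ⊗[C] B}
    (hz : z ∈ tensorGrading (C := C) 𝒜 ℬ g) :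
    tensorComponents 𝒞 hA hB z =
      DirectSum.of (fun g => tensorGrading (C := C) 𝒜 ℬ g) g ⟨z, hz⟩ := by
  induction hz using AddSubgroup.closure_induction with
  | zero =>
    rw [map_zero]
    exact (map_zero (DirectSum.of (fun g => tensorGrading (C := C) 𝒜 ℬ g) g)).symm
  | add x y hx hy h₁ h₂ =>
    rw [map_add, h₁, h₂]
    exact (map_add (DirectSum.of (fun g => tensorGrading (C := C) 𝒜 ℬ g) g) ⟨x, hx⟩ ⟨y, hy⟩).symm
  | neg x hx h₁ =>
    rw [map_neg, h₁]
    exact (map_neg (DirectSum.of (fun g => tensorGrading (C := C) 𝒜 ℬ g) g) ⟨x, hx⟩).symm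
  | mem z hz =>
    obtain ⟨r, s, rfl, a, ha, b, hb, rfl⟩ := hz
    rw [tensorComponents_tmul, componentsHom_of_mem _ ha, componentsHom_of_mem _ hb,
      DirectSum.of_mul_of]
    refine congrArg _ (Subtype.ext ?_)
    show (a ⊗ₜ[C] (1 : B)) * ((1 : A) ⊗ₜ[C] b) = a ⊗ₜ[C] b
    simp

/-- The tensor product of graded algebras over a graded ring is a graded ring. -/
@[reducible]
def tensorGradedRing (hA : ∀ r, ∀ c ∈ 𝒞 r, algebraMap C A c ∈ 𝒜 r)
    (hB : ∀ r, ∀ c ∈ 𝒞 r, algebraMap C B c ∈ ℬ r) :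
    GradedRing (tensorGrading (C := C) 𝒜 ℬ) where
  toDecomposition := DirectSum.Decomposition.ofAddHom _ (tensorComponents 𝒞 hA hB)
    (by
      refine AddMonoidHom.ext fun z => ?_
      induction z using TensorProduct.induction_on with
      | zero => simp only [map_zero]
      | add x y hx hy => simp only [map_add, hx, hy]
      | tmul a b =>
        show DirectSum.coeRingHom (tensorGrading (C := C) 𝒜 ℬ)
          (componentsHom (tensorInclLeft C 𝒜 ℬ) a * componentsHom (tensorInclRight C 𝒜 ℬ) b) = _
        rw [map_mul]
        refine (congrArg₂ (· * ·) (coe_componentsHom (tensorInclLeft C 𝒜 ℬ) a)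
          (coe_componentsHom (tensorInclRight C 𝒜 ℬ) b)).trans ?_
        show (a ⊗ₜ[C] (1 : B)) * ((1 : A) ⊗ₜ[C] b) = a ⊗ₜ[C] b
        simp)
    (by
      refine DirectSum.addHom_ext' fun g => AddMonoidHom.ext fun z => ?_
      show tensorComponents 𝒞 hA hB (DirectSum.coeAddMonoidHom _ (DirectSum.of _ g z)) = _
      rw [DirectSum.coeAddMonoidHom_of]
      exact tensorComponents_of_mem 𝒞 hA hB z.2)

end GradedTensor

section BerkovichSpectrum

/-- The points of the Berkovich spectrum `ℳ(A)`: the bounded multiplicative seminorms on `A`. -/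
structure BerkovichSpectrum (A : Type*) [SeminormedCommRing A] extends MulRingSeminorm A where
  bounded' : ∃ c : ℝ, ∀ a, toFun a ≤ c * ‖a‖

namespace BerkovichSpectrum

variable {A : Type*} [SeminormedCommRing A] (x : BerkovichSpectrum A)

instance : CoeFun (BerkovichSpectrum A) (fun _ => A → ℝ) := ⟨fun x => x.toMulRingSeminorm⟩

theorem le_norm (a : A) : x a ≤ ‖a‖ := by
  obtain ⟨c, hc⟩ := x.bounded'
  by_contra! h
  have hx : 0 < x a := (norm_nonneg a).trans_lt h
  have key : ∀ n : ℕ, 0 < n → 1 ≤ c * (‖a‖ / x a) ^ n := by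
    intro n hn
    have h1 : x a ^ n ≤ c * ‖a ^ n‖ := by
      rw [← map_pow x.toMulRingSeminorm]; exact hc _
    have hc0 : 0 ≤ c := by
      have h2 := hc 1
      have h3 : x.toFun 1 = 1 := x.map_one'
      have h4 := norm_nonneg (1 : A)
      by_contra! h5
      nlinarith
    have h6 : x a ^ n ≤ c * ‖a‖ ^ n :=
      h1.trans (mul_le_mul_of_nonneg_left (norm_pow_le' a hn) hc0)
    rw [div_pow, ← mul_div_assoc, one_le_div (pow_pos hx n)]
    exact h6
  have hlim : Filter.Tendsto (fun n : ℕ => c * (‖a‖ / x a) ^ n) Filter.atTop (nhds (c * 0)) :=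
    (tendsto_pow_atTop_nhds_zero_of_lt_one (div_nonneg (norm_nonneg a) hx.le)
      ((div_lt_one hx).2 h)).const_mul c
  have := ge_of_tendsto hlim (Filter.eventually_atTop.2 ⟨1, fun n hn => key n hn⟩)
  norm_num at this

/-- The kernel of a point, a prime ideal. -/
def ker : Ideal A where
  carrier := {a | x a = 0}
  zero_mem' := map_zero x.toMulRingSeminorm
  add_mem' {a b} ha hb := le_antisymm
    ((map_add_le_add x.toMulRingSeminorm a b).trans (by rw [ha, hb, add_zero]))
    (apply_nonneg x.toMulRingSeminorm _)
  smul_mem' a b hb := by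
    show x.toMulRingSeminorm (a * b) = 0
    rw [map_mul, hb, mul_zero]

theorem mem_ker {a : A} : a ∈ x.ker ↔ x a = 0 := Iff.rfl

instance : x.ker.IsPrime where
  ne_top' h := by
    have h1 : x 1 = 0 := x.mem_ker.1 (h ▸ Submodule.mem_top)
    exact one_ne_zero ((map_one x.toMulRingSeminorm).symm.trans h1)
  mem_or_mem' {a b} h := by
    have h1 : x.toMulRingSeminorm (a * b) = 0 := h
    rw [map_mul] at h1
    exact mul_eq_zero.1 h1

/-- The absolute value induced on `A ⧸ ker x`. -/
def quotientAbs : A ⧸ x.ker →*₀ ℝ where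
  toFun := Quotient.lift (fun a => x a) (by
    intro a b hab
    have h : x.toMulRingSeminorm (a - b) = 0 := (Submodule.quotientRel_def _).1 hab
    have h' : x.toMulRingSeminorm (b - a) = 0 := by
      rw [← neg_sub, map_neg_eq_map]; exact h
    refine le_antisymm ?_ ?_
    · have := map_add_le_add x.toMulRingSeminorm (a - b) b
      rwa [sub_add_cancel, h, zero_add] at this
    · have := map_add_le_add x.toMulRingSeminorm (b - a) a
      rwa [sub_add_cancel, h', zero_add] at this)
  map_zero' := map_zero x.toMulRingSeminorm
  map_one' := map_one x.toMulRingSeminorm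
  map_mul' := by
    rintro ⟨a⟩ ⟨b⟩
    exact map_mul x.toMulRingSeminorm a b

theorem quotientAbs_mk (a : A) : x.quotientAbs (Ideal.Quotient.mk x.ker a) = x a := rfl

theorem quotientAbs_eq_zero {a : A ⧸ x.ker} (h : x.quotientAbs a = 0) : a = 0 := by
  obtain ⟨a, rfl⟩ := Ideal.Quotient.mk_surjective a
  exact Ideal.Quotient.eq_zero_iff_mem.2 h

theorem quotientAbs_isUnit (a : nonZeroDivisors (A ⧸ x.ker)) : IsUnit (x.quotientAbs a) :=
  isUnit_iff_ne_zero.2 fun h => nonZeroDivisors.ne_zero a.2 (x.quotientAbs_eq_zero h)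

def residueHom : FractionRing (A ⧸ x.ker) →*₀ ℝ :=
  (IsLocalization.toLocalizationMap (nonZeroDivisors (A ⧸ x.ker))
    (FractionRing (A ⧸ x.ker))).lift₀ x.quotientAbs x.quotientAbs_isUnit

theorem residueHom_algebraMap (a : A ⧸ x.ker) :
    x.residueHom (algebraMap _ (FractionRing (A ⧸ x.ker)) a) = x.quotientAbs a :=
  Submonoid.LocalizationMap.lift_eq _ _ a

/-- The absolute value `|a / b| = x a / x b` on the fraction field of `A ⧸ ker x`. -/
def residueAbs : AbsoluteValue (FractionRing (A ⧸ x.ker)) ℝ where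
  toFun := x.residueHom
  map_mul' := map_mul x.residueHom
  nonneg' z := by
    obtain ⟨a, b, -, rfl⟩ := IsFractionRing.div_surjective (A := A ⧸ x.ker) z
    rw [map_div₀, residueHom_algebraMap, residueHom_algebraMap]
    obtain ⟨a, rfl⟩ := Ideal.Quotient.mk_surjective a
    obtain ⟨b, rfl⟩ := Ideal.Quotient.mk_surjective b
    exact div_nonneg (apply_nonneg x.toMulRingSeminorm a) (apply_nonneg x.toMulRingSeminorm b)
  eq_zero' z := map_eq_zero x.residueHom
  add_le' z w := by
    obtain ⟨a, b, hb, rfl⟩ := IsFractionRing.div_surjective (A := A ⧸ x.ker) z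
    obtain ⟨c, d, hd, rfl⟩ := IsFractionRing.div_surjective (A := A ⧸ x.ker) w
    have hb' := IsFractionRing.to_map_ne_zero_of_mem_nonZeroDivisors
      (K := FractionRing (A ⧸ x.ker)) hb
    have hd' := IsFractionRing.to_map_ne_zero_of_mem_nonZeroDivisors
      (K := FractionRing (A ⧸ x.ker)) hd
    have hb'' := (map_ne_zero x.residueHom).2 hb'
    have hd'' := (map_ne_zero x.residueHom).2 hd'
    rw [div_add_div _ _ hb' hd', ← map_mul, ← map_mul, ← map_mul, ← map_add, map_div₀, map_div₀,
      map_div₀, map_mul (algebraMap _ _) b d, map_mul x.residueHom, div_add_div _ _ hb'' hd'']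
    simp only [residueHom_algebraMap] at hb'' hd'' ⊢
    obtain ⟨a, rfl⟩ := Ideal.Quotient.mk_surjective a
    obtain ⟨b, rfl⟩ := Ideal.Quotient.mk_surjective b
    obtain ⟨c, rfl⟩ := Ideal.Quotient.mk_surjective c
    obtain ⟨d, rfl⟩ := Ideal.Quotient.mk_surjective d
    refine div_le_div_of_nonneg_right ?_ (mul_nonneg (apply_nonneg x.toMulRingSeminorm b)
      (apply_nonneg x.toMulRingSeminorm d))
    have := map_add_le_add x.toMulRingSeminorm (a * d) (b * c)
    rwa [map_mul, map_mul] at this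

/-- The completed residue field `ℋ(x)`. -/
abbrev CompletedResidueField : Type _ := x.residueAbs.Completion

/-- The character `A → ℋ(x)`. -/
def character : A →+* x.CompletedResidueField :=
  (UniformSpace.Completion.coeRingHom).comp
    ((WithAbs.equiv x.residueAbs).symm.toRingHom.comp
      ((algebraMap (A ⧸ x.ker) (FractionRing (A ⧸ x.ker))).comp (Ideal.Quotient.mk x.ker)))

theorem norm_character (a : A) : ‖x.character a‖ = x a := by
  refine (UniformSpace.Completion.norm_coe _).trans ?_
  exact x.residueHom_algebraMap (Ideal.Quotient.mk x.ker a)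

theorem norm_character_le (a : A) : ‖x.character a‖ ≤ ‖a‖ :=
  (x.norm_character a).trans_le (x.le_norm a)

variable [IsUltrametricDist A] [Fact (‖(1 : A)‖ ≤ 1)]

instance : IsUltrametricDist x.CompletedResidueField :=
  IsUltrametricDist.isUltrametricDist_of_forall_norm_natCast_le_one fun n => by
    rw [← map_natCast x.character n]
    refine (x.norm_character_le _).trans ?_
    induction n with
    | zero => simp
    | succ n ih =>
      rw [Nat.cast_succ]
      exact (IsUltrametricDist.norm_add_le_max _ _).trans (max_le ih Fact.out)

end BerkovichSpectrum

end BerkovichSpectrum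

section ReductionMap

theorem NonarchRingSeminorm.of_pieceMk_eq_zero_iff {R : Type*} [CommRing R]
    (p : NonarchRingSeminorm R) {r : Grade} (a : p.ballLE r) :
    DirectSum.of p.Piece r (p.pieceMk r a) = 0 ↔ p a < r.val := by
  rw [← _root_.map_zero (DirectSum.of p.Piece r), (DirectSum.of_injective r).eq_iff,
    ← _root_.map_zero (p.pieceMk r), eq_comm, p.pieceMk_eq_iff]
  simp

theorem nonarchNorm_spectral_eq_norm (F : Type*) [NormedField F] [IsUltrametricDist F] (a : F) :
    (nonarchNorm F).spectral a = ‖a‖ :=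
  (nonarchNorm F).spectral_of_mul norm_mul a

theorem GradedReduction.eq_zero_or_eq_zero (F : Type*) [NormedField F] [IsUltrametricDist F]
    (r s : Grade) (a : GradedReduction F) (ha : a ∈ grading F r) (b : GradedReduction F)
    (hb : b ∈ grading F s) (hab : a * b = 0) : a = 0 ∨ b = 0 := by
  set p := (nonarchNorm F).spectral with hp
  obtain ⟨a, rfl⟩ := ha
  obtain ⟨b, rfl⟩ := hb
  obtain ⟨a, rfl⟩ := p.pieceMk_surjective r a
  obtain ⟨b, rfl⟩ := p.pieceMk_surjective s b
  have hab' := (DirectSum.of_mul_of (A := p.Piece) (p.pieceMk r a) (p.pieceMk s b)).symm.trans hab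
  have h := (p.of_pieceMk_eq_zero_iff (r := r + s) ⟨(a : F) * b, p.mul_mem_ballLE a b⟩).1 hab'
  by_contra! hne
  have h1 : r.val ≤ p a := not_lt.1 fun h => hne.1 ((p.of_pieceMk_eq_zero_iff a).2 h)
  have h2 : s.val ≤ p b := not_lt.1 fun h => hne.2 ((p.of_pieceMk_eq_zero_iff b).2 h)
  have hn : ∀ c, p c = ‖c‖ := nonarchNorm_spectral_eq_norm F
  simp only [hn] at h h1 h2
  rw [norm_mul, Grade.val_add] at h
  exact absurd h (not_lt.2 (mul_le_mul h1 h2 s.val_pos.le (norm_nonneg _)))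

instance (F : Type*) [NormedField F] [IsUltrametricDist F] : Nontrivial (GradedReduction F) := by
  refine ⟨1, 0, fun h => ?_⟩
  have h1 := ((nonarchNorm F).spectral.of_pieceMk_eq_zero_iff (r := 0)
    ⟨1, (nonarchNorm F).spectral.map_one_le_one'⟩).1 h
  rw [nonarchNorm_spectral_eq_norm, norm_one] at h1
  exact lt_irrefl _ h1

/-- The reduction map `ℳ(A) → Spec_G(Ã)`. It sends `x` to the kernel of the homomorphism from `Ã` to
the graded reduction of `ℋ(x)` induced by the character `A → ℋ(x)`. -/
def reductionMap (A : Type*) [SeminormedCommRing A] [IsUltrametricDist A] [Fact (‖(1 : A)‖ ≤ 1)]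
    (x : BerkovichSpectrum A) : HomogeneousSpectrum (GradedReduction.grading A) :=
  (HomogeneousSpectrum.zero (GradedReduction.grading x.CompletedResidueField)
    (GradedReduction.eq_zero_or_eq_zero _)).comap
      (GradedReduction.map x.character x.norm_character_le)

end ReductionMap

section CompletedTensorProduct

variable (k K L : Type*) [NormedField k] [NormedField K] [NormedField L]
variable [NormedAlgebra k K] [NormedAlgebra k L]

/-- A copy of `K ⊗[k] L`, to be equipped with the tensor product seminorm. -/
def NormedTensor : Type _ := K ⊗[k] L

namespace NormedTensor

instance : CommRing (NormedTensor k K L) := inferInstanceAs (CommRing (K ⊗[k] L))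

variable {K L}

/-- The elementary tensor `a ⊗ b`. -/
def tmul (a : K) (b : L) : NormedTensor k K L := a ⊗ₜ[k] b

variable {k}

/-- `∑ aᵢ ⊗ bᵢ` for a list of pairs `(aᵢ, bᵢ)`. -/
def ofList (l : List (K × L)) : NormedTensor k K L :=
  (l.map fun p => tmul k p.1 p.2).sum

/-- Upper bounds for `maxᵢ ‖aᵢ‖ ‖bᵢ‖` over the presentations `z = ∑ aᵢ ⊗ bᵢ`. -/
def bounds (z : NormedTensor k K L) : Set ℝ :=
  {c | 0 ≤ c ∧ ∃ l : List (K × L), ofList l = z ∧ ∀ p ∈ l, ‖p.1‖ * ‖p.2‖ ≤ c}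

/-- The tensor product seminorm: the infimum of `maxᵢ ‖aᵢ‖ ‖bᵢ‖` over all presentations
`z = ∑ aᵢ ⊗ bᵢ`. -/
def tensorNorm (z : NormedTensor k K L) : ℝ := sInf (bounds z)

theorem bounds_bddBelow (z : NormedTensor k K L) : BddBelow (bounds z) := ⟨0, fun _ h => h.1⟩

theorem tensorNorm_nonneg (z : NormedTensor k K L) : 0 ≤ tensorNorm z :=
  Real.sInf_nonneg fun _ h => h.1

theorem ofList_nil : ofList ([] : List (K × L)) = (0 : NormedTensor k K L) := rfl

theorem ofList_cons (p : K × L) (l : List (K × L)) :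
    ofList (p :: l) = tmul k p.1 p.2 + ofList l := by
  simp only [ofList, List.map_cons, List.sum_cons]

theorem ofList_append (l m : List (K × L)) :
    ofList (l ++ m) = (ofList l + ofList m : NormedTensor k K L) := by
  simp only [ofList, List.map_append, List.sum_append]

theorem tmul_mul_tmul (a c : K) (b d : L) :
    tmul k a b * tmul k c d = tmul k (a * c) (b * d) :=
  Algebra.TensorProduct.tmul_mul_tmul a c b d

theorem ofList_singleton (a : K) (b : L) : ofList [(a, b)] = tmul k a b := by simp [ofList]

theorem bounds_nonempty (z : NormedTensor k K L) : (bounds z).Nonempty := by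
  induction z using TensorProduct.induction_on with
  | zero => exact ⟨0, le_rfl, [], ofList_nil, by simp⟩
  | tmul a b =>
    exact ⟨‖a‖ * ‖b‖, by positivity, [(a, b)], ofList_singleton a b, by simp⟩
  | add x y hx hy =>
    obtain ⟨c, hc, l, rfl, hl⟩ := hx
    obtain ⟨d, hd, m, rfl, hm⟩ := hy
    refine ⟨max c d, le_max_of_le_left hc, l ++ m, ofList_append l m, fun p hp => ?_⟩
    rcases List.mem_append.1 hp with h | h
    · exact (hl p h).trans (le_max_left _ _)
    · exact (hm p h).trans (le_max_right _ _)

theorem tensorNorm_le {z : NormedTensor k K L} {c : ℝ} (h : c ∈ bounds z) : tensorNorm z ≤ c :=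
  csInf_le (bounds_bddBelow z) h

theorem exists_mem_bounds_lt {z : NormedTensor k K L} {c : ℝ} (h : tensorNorm z < c) :
    ∃ d ∈ bounds z, d < c := exists_lt_of_csInf_lt (bounds_nonempty z) h

theorem tensorNorm_add_le_max (y z : NormedTensor k K L) :
    tensorNorm (y + z) ≤ max (tensorNorm y) (tensorNorm z) := by
  refine le_of_forall_gt_imp_ge_of_dense fun c hc => ?_
  obtain ⟨d, ⟨hd, l, rfl, hl⟩, hdc⟩ := exists_mem_bounds_lt ((le_max_left _ _).trans_lt hc)
  obtain ⟨e, ⟨he, m, rfl, hm⟩, hec⟩ := exists_mem_bounds_lt ((le_max_right _ _).trans_lt hc)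
  refine tensorNorm_le ⟨hd.trans hdc.le, l ++ m, ofList_append l m, fun p hp => ?_⟩
  rcases List.mem_append.1 hp with h | h
  · exact (hl p h).trans hdc.le
  · exact (hm p h).trans hec.le

theorem ofList_map_mul (a : K) (b : L) (m : List (K × L)) :
    ofList (m.map fun q => (a * q.1, b * q.2)) =
      tmul k a b * ofList m := by
  induction m with
  | nil => rw [List.map_nil, ofList_nil, mul_zero]
  | cons q m ih => rw [List.map_cons, ofList_cons, ofList_cons, ih, mul_add, tmul_mul_tmul]

theorem exists_ofList_mul (l m : List (K × L)) :
    ∃ n : List (K × L), ofList n = (ofList l * ofList m : NormedTensor k K L) ∧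
      ∀ p ∈ n, ∃ q ∈ l, ∃ q' ∈ m, p = (q.1 * q'.1, q.2 * q'.2) := by
  induction l with
  | nil => exact ⟨[], by rw [ofList_nil, zero_mul], by simp⟩
  | cons q l ih =>
    obtain ⟨n, hn, hn'⟩ := ih
    refine ⟨m.map (fun q' => (q.1 * q'.1, q.2 * q'.2)) ++ n, ?_, fun p hp => ?_⟩
    · rw [ofList_append, ofList_map_mul, hn, ofList_cons, add_mul]
    · rcases List.mem_append.1 hp with h | h
      · obtain ⟨q', hq', rfl⟩ := List.mem_map.1 h
        exact ⟨q, List.mem_cons_self, q', hq', rfl⟩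
      · obtain ⟨r, hr, q', hq', rfl⟩ := hn' p h
        exact ⟨r, List.mem_cons_of_mem _ hr, q', hq', rfl⟩

theorem tensorNorm_mul_le (y z : NormedTensor k K L) :
    tensorNorm (y * z) ≤ tensorNorm y * tensorNorm z := by
  have key : ∀ c > tensorNorm y, ∀ d > tensorNorm z, tensorNorm (y * z) ≤ c * d := by
    intro c hc d hd
    obtain ⟨c', ⟨hc0, l, rfl, hl⟩, hcc⟩ := exists_mem_bounds_lt hc
    obtain ⟨d', ⟨hd0, m, rfl, hm⟩, hdd⟩ := exists_mem_bounds_lt hd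
    obtain ⟨n, hn, hn'⟩ := exists_ofList_mul (k := k) l m
    refine tensorNorm_le
      ⟨mul_nonneg (hc0.trans hcc.le) (hd0.trans hdd.le), n, hn, fun p hp => ?_⟩
    obtain ⟨q, hq, q', hq', rfl⟩ := hn' p hp
    rw [norm_mul, norm_mul, mul_mul_mul_comm]
    exact mul_le_mul ((hl q hq).trans hcc.le) ((hm q' hq').trans hdd.le) (by positivity)
      (hc0.trans hcc.le)
  have hlim : Filter.Tendsto (fun ε : ℝ => (tensorNorm y + ε) * (tensorNorm z + ε))
      (nhdsWithin 0 (Set.Ioi 0)) (nhds ((tensorNorm y + 0) * (tensorNorm z + 0))) :=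
    (Continuous.tendsto (by fun_prop) 0).mono_left nhdsWithin_le_nhds
  rw [add_zero, add_zero] at hlim
  refine ge_of_tendsto hlim (eventually_nhdsWithin_of_forall fun ε hε => ?_)
  exact key _ (lt_add_of_pos_right _ hε) _ (lt_add_of_pos_right _ hε)

theorem tensorNorm_tmul_le (a : K) (b : L) :
    tensorNorm (tmul k a b) ≤ ‖a‖ * ‖b‖ :=
  tensorNorm_le ⟨by positivity, [(a, b)], ofList_singleton a b, by simp⟩

theorem tensorNorm_neg (z : NormedTensor k K L) : tensorNorm (-z) = tensorNorm z := by
  have key : ∀ z : NormedTensor k K L, tensorNorm (-z) ≤ tensorNorm z := by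
    intro z
    have h0 : tmul k (-1 : K) (1 : L) = -1 := TensorProduct.neg_tmul _ _
    have h1 : -z = tmul k (-1 : K) (1 : L) * z := by rw [h0, neg_one_mul]
    rw [h1]
    refine (tensorNorm_mul_le _ _).trans ?_
    refine mul_le_of_le_one_left (tensorNorm_nonneg z) ((tensorNorm_tmul_le _ _).trans ?_)
    simp
  exact le_antisymm (key z) (by simpa using key (-z))

variable (k K L) in
/-- The tensor product seminorm as a ring seminorm. -/
def ringSeminorm : RingSeminorm (NormedTensor k K L) where
  toFun := tensorNorm
  map_zero' := le_antisymm (tensorNorm_le ⟨le_rfl, [], ofList_nil, by simp⟩) (tensorNorm_nonneg 0)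
  add_le' y z := (tensorNorm_add_le_max y z).trans
    (max_le_add_of_nonneg (tensorNorm_nonneg y) (tensorNorm_nonneg z))
  neg' := tensorNorm_neg
  mul_le' := tensorNorm_mul_le

instance : SeminormedCommRing (NormedTensor k K L) where
  __ := (ringSeminorm k K L).toSeminormedRing
  mul_comm := mul_comm

theorem norm_def (z : NormedTensor k K L) : ‖z‖ = tensorNorm z := rfl

instance : IsUltrametricDist (NormedTensor k K L) :=
  IsUltrametricDist.isUltrametricDist_of_forall_norm_add_le_max_norm tensorNorm_add_le_max

instance : Fact (‖(1 : NormedTensor k K L)‖ ≤ 1) :=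
  ⟨(tensorNorm_tmul_le (1 : K) (1 : L)).trans (by simp)⟩

end NormedTensor

instance (A : Type*) [SeminormedCommRing A] [IsUltrametricDist A] :
    IsUltrametricDist (UniformSpace.Completion A) :=
  IsUltrametricDist.isUltrametricDist_of_forall_norm_add_le_max_norm fun x y => by
    induction x, y using UniformSpace.Completion.induction_on₂ with
    | hp => exact isClosed_le (by fun_prop) (by fun_prop)
    | ih a b =>
      rw [← UniformSpace.Completion.coe_add]
      simpa only [UniformSpace.Completion.norm_coe] using IsUltrametricDist.norm_add_le_max a b

instance (A : Type*) [SeminormedCommRing A] [h : Fact (‖(1 : A)‖ ≤ 1)] :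
    Fact (‖(1 : UniformSpace.Completion A)‖ ≤ 1) :=
  ⟨(UniformSpace.Completion.norm_coe (1 : A)).trans_le h.out⟩

/-- The completed tensor product `K ⊗̂ L` over `k`. -/
abbrev CompletedTensor : Type _ := UniformSpace.Completion (NormedTensor k K L)

namespace CompletedTensor

def inclLeft : K →+* CompletedTensor k K L :=
  (UniformSpace.Completion.coeRingHom (α := NormedTensor k K L)).comp
    (Algebra.TensorProduct.includeLeftRingHom : K →+* K ⊗[k] L)

def inclRight : L →+* CompletedTensor k K L :=
  (UniformSpace.Completion.coeRingHom (α := NormedTensor k K L)).comp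
    ((Algebra.TensorProduct.includeRight : L →ₐ[k] K ⊗[k] L) : L →+* K ⊗[k] L)

theorem norm_inclLeft_le (a : K) : ‖inclLeft k K L a‖ ≤ ‖a‖ :=
  (UniformSpace.Completion.norm_coe _).trans_le
    ((NormedTensor.tensorNorm_tmul_le a (1 : L)).trans (by simp))

theorem norm_inclRight_le (b : L) : ‖inclRight k K L b‖ ≤ ‖b‖ :=
  (UniformSpace.Completion.norm_coe _).trans_le
    ((NormedTensor.tensorNorm_tmul_le (1 : K) b).trans (by simp))

theorem inclLeft_comp_algebraMap :
    (inclLeft k K L).comp (algebraMap k K) = (inclRight k K L).comp (algebraMap k L) :=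
  RingHom.ext fun c => congrArg (UniformSpace.Completion.coeRingHom (α := NormedTensor k K L))
    (Algebra.TensorProduct.tmul_one_eq_one_tmul c)

end CompletedTensor

end CompletedTensorProduct

section Main

variable (k K L : Type*) [NormedField k] [NormedField K] [NormedField L]
variable [NormedAlgebra k K] [NormedAlgebra k L]
variable [IsUltrametricDist k] [IsUltrametricDist K] [IsUltrametricDist L]

/-- The algebra structure induced by `k → K`. -/
instance : Algebra (GradedReduction k) (GradedReduction K) :=
  RingHom.toAlgebra (GradedReduction.map (algebraMap k K)
    fun a => (norm_algebraMap' K a).le : GradedReduction k →+* GradedReduction K)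

theorem algebraMap_gradedReduction_mem (r : Grade) (c : GradedReduction k)
    (hc : c ∈ GradedReduction.grading k r) :
    algebraMap (GradedReduction k) (GradedReduction K) c ∈ GradedReduction.grading K r :=
  (GradedReduction.map (algebraMap k K) fun a => (norm_algebraMap' K a).le).map_mem hc

/-- `K̃ ⊗ L̃` over `k̃`. -/
abbrev ReductionTensor : Type _ := GradedReduction K ⊗[GradedReduction k] GradedReduction L

abbrev ReductionTensor.grading : Grade → AddSubgroup (ReductionTensor k K L) :=
  tensorGrading (GradedReduction.grading K) (GradedReduction.grading L)

instance : GradedRing (ReductionTensor.grading k K L) :=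
  tensorGradedRing (GradedReduction.grading k) (algebraMap_gradedReduction_mem k K)
    (algebraMap_gradedReduction_mem k L)

theorem reductionTensor_compatible (c : GradedReduction k) :
    GradedReduction.map (CompletedTensor.inclLeft k K L) (CompletedTensor.norm_inclLeft_le k K L)
      (algebraMap (GradedReduction k) (GradedReduction K) c) =
    GradedReduction.map (CompletedTensor.inclRight k K L) (CompletedTensor.norm_inclRight_le k K L)
      (algebraMap (GradedReduction k) (GradedReduction L) c) := by
  refine (GradedReduction.map_map (algebraMap k K) (fun a => (norm_algebraMap' K a).le)
    (CompletedTensor.inclLeft k K L) (CompletedTensor.norm_inclLeft_le k K L) c).trans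
    (Eq.trans ?_ (GradedReduction.map_map (algebraMap k L) (fun a => (norm_algebraMap' L a).le)
    (CompletedTensor.inclRight k K L) (CompletedTensor.norm_inclRight_le k K L) c).symm)
  congr 2
  exact CompletedTensor.inclLeft_comp_algebraMap k K L

/-- The ring homomorphism from `K̃ ⊗ L̃` to the graded reduction of `K ⊗̂ L`, with
`[a] ⊗ [b] ↦ [a ⊗ 1] [1 ⊗ b]`. -/
def reductionTensorRingHom : ReductionTensor k K L →+* GradedReduction (CompletedTensor k K L) :=
  let f : GradedReduction K →+* GradedReduction (CompletedTensor k K L) :=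
    GradedReduction.map (CompletedTensor.inclLeft k K L) (CompletedTensor.norm_inclLeft_le k K L)
  let g : GradedReduction L →+* GradedReduction (CompletedTensor k K L) :=
    GradedReduction.map (CompletedTensor.inclRight k K L) (CompletedTensor.norm_inclRight_le k K L)
  letI : Algebra (GradedReduction k) (GradedReduction (CompletedTensor k K L)) :=
    (f.comp (algebraMap (GradedReduction k) (GradedReduction K))).toAlgebra
  (Algebra.TensorProduct.productMap (R := GradedReduction k)
    { f with commutes' := fun _ => rfl }
    { g with commutes' := fun c => (reductionTensor_compatible k K L c).symm }).toRingHom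

theorem reductionTensorRingHom_tmul (a : GradedReduction K) (b : GradedReduction L) :
    reductionTensorRingHom k K L (a ⊗ₜ b) =
      GradedReduction.map (CompletedTensor.inclLeft k K L)
        (CompletedTensor.norm_inclLeft_le k K L) a *
      GradedReduction.map (CompletedTensor.inclRight k K L)
        (CompletedTensor.norm_inclRight_le k K L) b := rfl

/-- `reductionTensorRingHom` as a homomorphism of graded rings. -/
def reductionTensorHom :
    ReductionTensor.grading k K L →+*ᵍ GradedReduction.grading (CompletedTensor k K L) where
  __ := reductionTensorRingHom k K L
  map_mem {g z} hz := by
    show reductionTensorRingHom k K L z ∈ _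
    induction hz using AddSubgroup.closure_induction with
    | zero => rw [map_zero]; exact zero_mem _
    | add _ _ _ _ h₁ h₂ => rw [map_add]; exact add_mem h₁ h₂
    | neg _ _ h₁ => rw [map_neg]; exact neg_mem h₁
    | mem z hz =>
      obtain ⟨r, s, rfl, a, ha, b, hb, rfl⟩ := hz
      rw [reductionTensorRingHom_tmul]
      exact SetLike.mul_mem_graded (GradedRingHom.map_mem _ ha) (GradedRingHom.map_mem _ hb)

/-- The map `ℳ(K ⊗̂ L) → Spec_G(K̃ ⊗ L̃)` induced by reduction. -/
def tensorReductionMap (x : BerkovichSpectrum (CompletedTensor k K L)) :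
    HomogeneousSpectrum (ReductionTensor.grading k K L) :=
  (reductionMap (CompletedTensor k K L) x).comap (reductionTensorHom k K L)

end Main

end BerkovichReduction

end

/-! The argument has two halves: a point whose reduction is contained in `P`, then a change of base
that turns containment into equality.

First half. The classes of elementary tensors embed `K̃ ⊗ L̃` into the graded ring of the tensor
seminorm (`eq_zero_of_norm_lt`), so a lift of a nonzero element of degree `r` has norm exactly `r`.
As `P` is prime, the norm is therefore multiplicative on the lifts of the homogeneous elements
outside `P`. By Zorn's lemma there is a minimal seminorm below the norm with the same values on
these lifts, and minimality forces it to be multiplicative (`exists_mulRingSeminorm_le`). It is a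
point whose reduction lies inside `P` (`exists_tensorReductionMap_le`). If `L̃` is integral over
`k̃`, then `K̃ ⊗ L̃` is integral over `K̃`, all homogeneous primes lie over the zero ideal of the
graded field `K̃`, and incomparability gives equality
(`tensorReductionMap_surjective_of_isIntegral`).

Second half. In general the inclusion may be strict, and the aim is to reduce to the integral case
over a larger base. Let `x` be a point with reduction inside `P`, and `M` an algebraically closed
extension of `ℋ(x)`. Homogeneous elements of `L̃` that form a transcendence basis of `(K̃ ⊗ L̃)/P`
over `K̃` stay independent in `M̃`, because the kernel of `K̃ ⊗ L̃ → M̃` lies in `P`. Hence `M̃` and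
`(K̃ ⊗ L̃)/P` can be mapped to a common field `Ω` compatibly. Since `M̃` is algebraically closed in
the graded sense (`exists_res_of_eval₂_eq_zero`), its image contains that of `L̃`.

Now lift a homogeneous transcendence basis of `L̃` over `k̃` both to `L` and, through `Ω`, to `M`.
Both lifts carry the Gauss norm, so they generate isometric extensions of `k`; call this common
field `E` (`gauss_transfer`). Then `L̃` is integral over `Ẽ`, and the kernel of `M̃ ⊗ L̃ → Ω`, the
tensor product being over `Ẽ`, provides a homogeneous prime to which the integral case applies. The
resulting point of `ℳ(M ⊗̂ L)`, completed over `E`, restricts to a point of `ℳ(K ⊗̂ L)` with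
reduction `P` (`exists_tensorReductionMap_eq`). -/

noncomputable section

namespace BerkovichReduction
open scoped DirectSum TensorProduct

/-! ### Minimal seminorms and multiplicativity -/

namespace NonarchRingSeminorm

variable {R : Type*} [CommRing R]

/-- The pointwise infimum of a family of functions that jointly satisfy the seminorm inequalities. -/
def iInfSeminorm {ι : Type*} [Nonempty ι] (F : ι → R → ℝ) (hnn : ∀ i a, 0 ≤ F i a)
    (hzero : ∀ i, F i 0 = 0) (hneg : ∀ i a, F i (-a) = F i a) (hone : ∃ i, F i 1 ≤ 1)
    (hadd : ∀ i j a b, ∃ l, F l (a + b) ≤ max (F i a) (F j b))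
    (hmul : ∀ i j a b, ∃ l, F l (a * b) ≤ F i a * F j b) : NonarchRingSeminorm R :=
  have hbdd : ∀ a, BddBelow (Set.range fun i => F i a) := fun a =>
    ⟨0, Set.forall_mem_range.2 fun i => hnn i a⟩
  have hmax : ∀ a b, ⨅ i, F i (a + b) ≤ max (⨅ i, F i a) (⨅ i, F i b) := by
    intro a b
    by_contra! h
    obtain ⟨ha, hb⟩ := max_lt_iff.1 h
    obtain ⟨i, hi⟩ := exists_lt_of_ciInf_lt ha
    obtain ⟨j, hj⟩ := exists_lt_of_ciInf_lt hb
    obtain ⟨l, hl⟩ := hadd i j a b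
    exact absurd (ciInf_le (hbdd (a + b)) l) (not_le.2 (hl.trans_lt (max_lt hi hj)))
  { toFun := fun a => ⨅ i, F i a
    map_zero' := by simp [hzero]
    add_le' := fun a b => (hmax a b).trans
      (max_le_add_of_nonneg (Real.iInf_nonneg fun i => hnn i a) (Real.iInf_nonneg fun i => hnn i b))
    neg' := fun a => by simp [hneg]
    mul_le' := fun a b => by
      rw [Real.iInf_mul_of_nonneg (Real.iInf_nonneg fun i => hnn i b)]
      refine le_ciInf fun i => ?_
      rw [Real.mul_iInf_of_nonneg (hnn i a)]
      refine le_ciInf fun j => ?_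
      obtain ⟨l, hl⟩ := hmul i j a b
      exact (ciInf_le (hbdd (a * b)) l).trans hl
    map_one_le_one' := by
      obtain ⟨i, hi⟩ := hone
      exact (ciInf_le (hbdd 1) i).trans hi
    nonarch' := hmax }

theorem iInfSeminorm_le {ι : Type*} [Nonempty ι] {F : ι → R → ℝ} (hnn : ∀ i a, 0 ≤ F i a)
    (hzero : ∀ i, F i 0 = 0) (hneg : ∀ i a, F i (-a) = F i a) (hone : ∃ i, F i 1 ≤ 1)
    (hadd : ∀ i j a b, ∃ l, F l (a + b) ≤ max (F i a) (F j b))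
    (hmul : ∀ i j a b, ∃ l, F l (a * b) ≤ F i a * F j b) (i : ι) (a : R) :
    iInfSeminorm F hnn hzero hneg hone hadd hmul a ≤ F i a :=
  ciInf_le ⟨0, Set.forall_mem_range.2 fun i => hnn i a⟩ i

theorem le_iInfSeminorm {ι : Type*} [Nonempty ι] {F : ι → R → ℝ} (hnn : ∀ i a, 0 ≤ F i a)
    (hzero : ∀ i, F i 0 = 0) (hneg : ∀ i a, F i (-a) = F i a) (hone : ∃ i, F i 1 ≤ 1)
    (hadd : ∀ i j a b, ∃ l, F l (a + b) ≤ max (F i a) (F j b))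
    (hmul : ∀ i j a b, ∃ l, F l (a * b) ≤ F i a * F j b) {a : R} {c : ℝ} (h : ∀ i, c ≤ F i a) :
    c ≤ iInfSeminorm F hnn hzero hneg hone hadd hmul a :=
  le_ciInf h

/-- The seminorms bounded by `p` and agreeing with `p` on `S`, as functions. -/
def dominatedBy (p : NonarchRingSeminorm R) (S : Submonoid R) : Set (R → ℝ) :=
  {f | ∃ q : NonarchRingSeminorm R, q.toFun = f ∧ (∀ a, q a ≤ p a) ∧ ∀ s ∈ S, q s = p s}

/-- Zorn's lemma for the reversed pointwise order. A chain is directed downwards, so its pointwise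
infimum is again a seminorm, and it keeps the common values on `S`. -/
theorem exists_minimal_dominatedBy (p : NonarchRingSeminorm R) (S : Submonoid R) :
    ∃ q : NonarchRingSeminorm R, (∀ a, q a ≤ p a) ∧ (∀ s ∈ S, q s = p s) ∧
      ∀ q' : NonarchRingSeminorm R, (∀ a, q' a ≤ q a) → (∀ s ∈ S, q' s = p s) →
        ∀ a, q' a = q a := by
  obtain ⟨m, -, hm⟩ := zorn_le_nonempty₀ (α := (R → ℝ)ᵒᵈ) (dominatedBy p S) (by
    intro C hC hchain y hy
    have : Nonempty C := ⟨⟨y, hy⟩⟩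
    choose Q hQ hQp hQS using fun i : C => hC i.2
    have hdir : ∀ i j : C, ∃ l : C, (∀ a, Q l a ≤ Q i a) ∧ ∀ a, Q l a ≤ Q j a := by
      intro i j
      rcases hchain.total i.2 j.2 with h | h
      · exact ⟨j, fun a => by rw [hQ, hQ]; exact h a, fun a => le_rfl⟩
      · exact ⟨i, fun a => le_rfl, fun a => by rw [hQ, hQ]; exact h a⟩
    have h1 : ∀ i a, 0 ≤ Q i a := fun i a => (Q i).nonneg a
    have h2 : ∀ i, Q i 0 = 0 := fun i => (Q i).map_zero
    have h3 : ∀ i a, Q i (-a) = Q i a := fun i a => (Q i).map_neg a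
    have h4 : ∃ i, Q i 1 ≤ 1 := ⟨⟨y, hy⟩, (Q _).map_one_le_one'⟩
    have h5 : ∀ i j a b, ∃ l, Q l (a + b) ≤ max (Q i a) (Q j b) := by
      intro i j a b
      obtain ⟨l, hl, hl'⟩ := hdir i j
      exact ⟨l, ((Q l).add_le_max a b).trans (max_le_max (hl a) (hl' b))⟩
    have h6 : ∀ i j a b, ∃ l, Q l (a * b) ≤ Q i a * Q j b := by
      intro i j a b
      obtain ⟨l, hl, hl'⟩ := hdir i j
      exact ⟨l, ((Q l).mul_le a b).trans
        (mul_le_mul (hl a) (hl' b) ((Q l).nonneg b) ((Q i).nonneg a))⟩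
    refine ⟨(iInfSeminorm (fun i => Q i) h1 h2 h3 h4 h5 h6).toFun, ⟨_, rfl, fun a => ?_,
      fun s hs => ?_⟩, fun z hz a => ?_⟩
    · exact (iInfSeminorm_le h1 h2 h3 h4 h5 h6 ⟨y, hy⟩ a).trans (hQp _ a)
    · refine le_antisymm ((iInfSeminorm_le h1 h2 h3 h4 h5 h6 ⟨y, hy⟩ s).trans (hQp _ s)) ?_
      exact le_iInfSeminorm h1 h2 h3 h4 h5 h6 fun i => (hQS i s hs).ge
    · refine (iInfSeminorm_le h1 h2 h3 h4 h5 h6 ⟨z, hz⟩ a).trans_eq ?_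
      exact congrFun (hQ ⟨z, hz⟩) a) p.toFun ⟨p, rfl, fun _ => le_rfl, fun _ _ => rfl⟩
  obtain ⟨⟨q, rfl, hqp, hqS⟩, hmin⟩ := hm
  refine ⟨q, hqp, hqS, fun q' hq' hq'S a => le_antisymm (hq' a) ?_⟩
  exact hmin (y := q'.toFun) ⟨q', rfl, fun a => (hq' a).trans (hqp a), hq'S⟩ hq' a

/-- A seminorm that is multiplicative and positive on a submonoid `S` dominates a multiplicative
seminorm with the same values on `S`. -/
theorem exists_mulRingSeminorm_le (p : NonarchRingSeminorm R) (S : Submonoid R)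
    (hpos : ∀ s ∈ S, 0 < p s) (hmul : ∀ s ∈ S, ∀ t ∈ S, p (s * t) = p s * p t) :
    ∃ x : MulRingSeminorm R, (∀ a, x a ≤ p a) ∧ ∀ s ∈ S, x s = p s := by
  obtain ⟨q, hqp, hqS, hmin⟩ := exists_minimal_dominatedBy p S
  have hp1 : p 1 = 1 := by
    have h := hmul 1 S.one_mem 1 S.one_mem
    rw [one_mul] at h
    have := hpos 1 S.one_mem
    nlinarith
  have hq1 : q 1 = 1 := (hqS 1 S.one_mem).trans hp1
  -- The functions `a ↦ q (a * s) / p s`, `s ∈ S`, have as infimum a seminorm below `q` (take `s =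
  -- 1`) with the same values on `S`. By minimality it is `q`, so `q a ≤ q (a * s) / p s`, the
  -- missing inequality.
  have hSmul : ∀ s ∈ S, ∀ a, q (s * a) = q s * q a := by
    let F : S → R → ℝ := fun s a => q (a * s) / p s
    have h1 : ∀ i a, 0 ≤ F i a := fun i a => div_nonneg (q.nonneg _) (p.nonneg _)
    have h2 : ∀ i, F i 0 = 0 := fun i => by simp [F]
    have h3 : ∀ i a, F i (-a) = F i a := fun i a => by simp [F]
    have hF : ∀ a, F 1 a = q a := fun a => by
      show q (a * 1) / p 1 = q a
      rw [mul_one, hp1, div_one]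
    have h4 : ∃ i, F i 1 ≤ 1 := ⟨1, (hF 1).trans_le hq1.le⟩
    have h5 : ∀ i j a b, ∃ l, F l (a + b) ≤ max (F i a) (F j b) := by
      intro i j a b
      have hi := hpos i i.2
      have hj := hpos j j.2
      refine ⟨i * j, ?_⟩
      show q ((a + b) * (i * j)) / p (i * j) ≤ _
      rw [hmul i i.2 j j.2, div_le_iff₀ (mul_pos hi hj), max_mul_of_nonneg _ _ (mul_pos hi hj).le]
      have e1 : F i a * (p i * p j) = q (a * i) * p j := by simp only [F]; field_simp
      have e2 : F j b * (p i * p j) = q (b * j) * p i := by simp only [F]; field_simp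
      have e3 : (a + b) * (i * j : R) = a * i * j + b * j * i := by ring
      rw [e1, e2, e3, ← hqS i i.2, ← hqS j j.2]
      exact (q.add_le_max _ _).trans (max_le_max (q.mul_le _ _) (q.mul_le _ _))
    have h6 : ∀ i j a b, ∃ l, F l (a * b) ≤ F i a * F j b := by
      intro i j a b
      have hi := hpos i i.2
      have hj := hpos j j.2
      refine ⟨i * j, ?_⟩
      show q (a * b * (i * j)) / p (i * j) ≤ q (a * i) / p i * (q (b * j) / p j)
      rw [hmul i i.2 j j.2, div_mul_div_comm]
      refine div_le_div_of_nonneg_right ?_ (mul_pos hi hj).le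
      rw [mul_mul_mul_comm]
      exact q.mul_le _ _
    have key := hmin (iInfSeminorm F h1 h2 h3 h4 h5 h6)
      (fun a => (iInfSeminorm_le h1 h2 h3 h4 h5 h6 1 a).trans_eq (hF a))
      (fun s hs => le_antisymm
        ((iInfSeminorm_le h1 h2 h3 h4 h5 h6 1 s).trans_eq ((hF s).trans (hqS s hs)))
        (le_iInfSeminorm h1 h2 h3 h4 h5 h6 fun i => by
          show p s ≤ q (s * i) / p i
          rw [hqS _ (S.mul_mem hs i.2), hmul s hs i i.2,
            mul_div_cancel_right₀ _ (hpos i i.2).ne']))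
    intro s hs a
    refine le_antisymm (q.mul_le _ _) ?_
    have h := (key a).ge.trans (iInfSeminorm_le h1 h2 h3 h4 h5 h6 ⟨s, hs⟩ a)
    have h' : q a ≤ q (a * s) / p s := h
    rwa [le_div_iff₀ (hpos s hs), mul_comm, mul_comm a, ← hqS s hs] at h'
  -- The spectral seminorm of `q` lies below `q` and, by `hSmul`, agrees with it on `S`; minimality
  -- makes it equal to `q`.
  have hpm : IsPowMul q.toRingSeminorm := by
    have key := hmin q.spectral (fun a => smoothingFun_le_self q.toRingSeminorm a) (fun s hs => by
      rw [← hqS s hs]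
      refine smoothingFun_apply_of_map_mul_eq_mul q.toRingSeminorm q.map_one_le_one' (hSmul s hs))
    have h := isPowMul_smoothingFun q.toRingSeminorm q.map_one_le_one'
    intro a n hn
    exact (key (a ^ n)).symm.trans ((h a hn).trans (congrArg (· ^ n) (key a)))
  -- For `q c ≠ 0` the same argument applies to `a ↦ lim q (a * c ^ n) / q c ^ n`, a seminorm for
  -- which `c` is multiplicative; power-multiplicativity of `q` is what makes this construction
  -- available.
  have hmulq : ∀ a b, q (a * b) = q a * q b := by
    intro c a
    by_cases hc : q c = 0
    · refine le_antisymm (q.mul_le c a) ?_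
      rw [hc, zero_mul]
      exact q.nonneg _
    · have hc' : q.toRingSeminorm c ≠ 0 := hc
      have hf1 : q.toRingSeminorm 1 ≤ 1 := q.map_one_le_one'
      let q' : NonarchRingSeminorm R :=
        { seminormFromConst hf1 hc' hpm with
          map_one_le_one' := seminormFromConst_one_le hf1 hc' hpm
          nonarch' := seminormFromConst_isNonarchimedean hf1 hc' hpm q.nonarch' }
      have key := hmin q' (fun a => seminormFromConst_le_seminorm hf1 hc' hpm a)
        (fun s hs => (seminormFromConst_apply_of_isMul hf1 hc' hpm (hSmul s hs)).trans (hqS s hs))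
      have h : q' (c * a) = q' c * q' a := seminormFromConst_const_mul hf1 hc' hpm a
      rwa [key, key, key] at h
  exact ⟨{ q.toRingSeminorm with map_one' := hq1, map_mul' := hmulq }, hqp, hqS⟩

end NonarchRingSeminorm

/-! ### Classes of elements in the graded reduction -/

namespace GradedReduction

section Res

variable (A : Type*) {B : Type*}
variable [SeminormedCommRing A] [IsUltrametricDist A] [Fact (‖(1 : A)‖ ≤ 1)]
variable [SeminormedCommRing B] [IsUltrametricDist B] [Fact (‖(1 : B)‖ ≤ 1)]

open Classical in
/-- The class of `a` in degree `r` of the graded reduction (zero if `a` is not in the ball of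
radius `r`). -/
def res (r : Grade) (a : A) : GradedReduction A :=
  if h : (nonarchNorm A).spectral a ≤ r.val then
    DirectSum.of (nonarchNorm A).spectral.Piece r ((nonarchNorm A).spectral.pieceMk r ⟨a, h⟩)
  else 0

variable {A}

theorem res_of_le {r : Grade} {a : A} (h : (nonarchNorm A).spectral a ≤ r.val) :
    res A r a = DirectSum.of (nonarchNorm A).spectral.Piece r
      ((nonarchNorm A).spectral.pieceMk r ⟨a, h⟩) := dif_pos h

theorem res_mem (r : Grade) (a : A) : res A r a ∈ grading A r := by
  by_cases h : (nonarchNorm A).spectral a ≤ r.val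
  · rw [res_of_le h]
    exact ⟨_, rfl⟩
  · rw [show res A r a = 0 from dif_neg h]
    exact zero_mem _

theorem exists_res_of_mem {r : Grade} {z : GradedReduction A} (hz : z ∈ grading A r) :
    ∃ a, (nonarchNorm A).spectral a ≤ r.val ∧ res A r a = z := by
  obtain ⟨c, rfl⟩ := hz
  obtain ⟨a, rfl⟩ := (nonarchNorm A).spectral.pieceMk_surjective r c
  exact ⟨a, a.2, res_of_le a.2⟩

theorem res_eq_zero_iff_spectral {r : Grade} {a : A} (h : (nonarchNorm A).spectral a ≤ r.val) :
    res A r a = 0 ↔ (nonarchNorm A).spectral a < r.val := by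
  rw [res_of_le h]
  exact (nonarchNorm A).spectral.of_pieceMk_eq_zero_iff _

theorem res_add_spectral {r : Grade} {a b : A} (ha : (nonarchNorm A).spectral a ≤ r.val)
    (hb : (nonarchNorm A).spectral b ≤ r.val) : res A r (a + b) = res A r a + res A r b := by
  rw [res_of_le ha, res_of_le hb,
    res_of_le (((nonarchNorm A).spectral.add_le_max a b).trans (max_le ha hb))]
  refine Eq.trans ?_ (map_add (DirectSum.of (nonarchNorm A).spectral.Piece r) _ _)
  exact congrArg _ (map_add ((nonarchNorm A).spectral.pieceMk r) ⟨a, ha⟩ ⟨b, hb⟩)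

theorem res_mul_spectral {r s : Grade} {a b : A} (ha : (nonarchNorm A).spectral a ≤ r.val)
    (hb : (nonarchNorm A).spectral b ≤ s.val) :
    res A (r + s) (a * b) = res A r a * res A s b := by
  rw [res_of_le ha, res_of_le hb,
    res_of_le (r := r + s) ((nonarchNorm A).spectral.mul_mem_ballLE ⟨a, ha⟩ ⟨b, hb⟩)]
  exact (DirectSum.of_mul_of (A := (nonarchNorm A).spectral.Piece)
    ((nonarchNorm A).spectral.pieceMk r ⟨a, ha⟩)
    ((nonarchNorm A).spectral.pieceMk s ⟨b, hb⟩)).symm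

theorem map_res_spectral (f : A →+* B) (h : ∀ a, ‖f a‖ ≤ ‖a‖) {r : Grade} {a : A}
    (ha : (nonarchNorm A).spectral a ≤ r.val) : map f h (res A r a) = res B r (f a) := by
  rw [res_of_le ha, res_of_le
    (((nonarchNorm A).spectral_mono (nonarchNorm B) f h a).trans ha)]
  exact NonarchRingSeminorm.mapRingHom_of f _ r _

theorem spectral_le_norm (a : A) : (nonarchNorm A).spectral a ≤ ‖a‖ :=
  smoothingFun_le_self (nonarchNorm A).toRingSeminorm a

end Res

section Field

variable {F E : Type*} [NormedField F] [IsUltrametricDist F] [NormedField E] [IsUltrametricDist E]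

theorem exists_res {r : Grade} {z : GradedReduction F} (hz : z ∈ grading F r) :
    ∃ a : F, ‖a‖ ≤ r.val ∧ res F r a = z := by
  obtain ⟨a, ha, h⟩ := exists_res_of_mem hz
  exact ⟨a, by rwa [nonarchNorm_spectral_eq_norm] at ha, h⟩

theorem res_eq_zero_iff {r : Grade} {a : F} (h : ‖a‖ ≤ r.val) :
    res F r a = 0 ↔ ‖a‖ < r.val := by
  rw [res_eq_zero_iff_spectral (by rwa [nonarchNorm_spectral_eq_norm]),
    nonarchNorm_spectral_eq_norm]

theorem res_zero (r : Grade) : res F r 0 = 0 :=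
  (res_eq_zero_iff (by simpa using r.val_pos.le)).2 (by simpa using r.val_pos)

theorem res_one : res F 0 1 = 1 :=
  res_of_le (by rw [nonarchNorm_spectral_eq_norm, norm_one]; exact le_rfl)

theorem res_add {r : Grade} {a b : F} (ha : ‖a‖ ≤ r.val) (hb : ‖b‖ ≤ r.val) :
    res F r (a + b) = res F r a + res F r b :=
  res_add_spectral (by rwa [nonarchNorm_spectral_eq_norm]) (by rwa [nonarchNorm_spectral_eq_norm])

theorem res_neg {r : Grade} {a : F} (ha : ‖a‖ ≤ r.val) : res F r (-a) = -res F r a := by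
  rw [eq_neg_iff_add_eq_zero, ← res_add (by rwa [norm_neg]) ha, neg_add_cancel, res_zero]

theorem res_mul {r s : Grade} {a b : F} (ha : ‖a‖ ≤ r.val) (hb : ‖b‖ ≤ s.val) :
    res F (r + s) (a * b) = res F r a * res F s b :=
  res_mul_spectral (by rwa [nonarchNorm_spectral_eq_norm]) (by rwa [nonarchNorm_spectral_eq_norm])

theorem norm_sum_le {ι : Type*} (s : Finset ι) (a : ι → F) {c : ℝ} (hc : 0 ≤ c)
    (h : ∀ i ∈ s, ‖a i‖ ≤ c) : ‖∑ i ∈ s, a i‖ ≤ c :=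
  IsUltrametricDist.norm_sum_le_of_forall_le_of_nonneg hc h

theorem res_sum {ι : Type*} (s : Finset ι) (a : ι → F) {r : Grade} (h : ∀ i ∈ s, ‖a i‖ ≤ r.val) :
    res F r (∑ i ∈ s, a i) = ∑ i ∈ s, res F r (a i) := by
  classical
  induction s using Finset.induction_on with
  | empty => simp [res_zero]
  | insert i s hi ih =>
    have h' : ∀ j ∈ s, ‖a j‖ ≤ r.val := fun j hj => h j (Finset.mem_insert_of_mem hj)
    rw [Finset.sum_insert hi, Finset.sum_insert hi,
      res_add (h i (Finset.mem_insert_self i s)) (norm_sum_le s a r.val_pos.le h'), ih h']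

theorem map_res {B : Type*} [SeminormedCommRing B] [IsUltrametricDist B] [Fact (‖(1 : B)‖ ≤ 1)]
    (f : F →+* B) (h : ∀ a, ‖f a‖ ≤ ‖a‖) {r : Grade} {a : F} (ha : ‖a‖ ≤ r.val) :
    map f h (res F r a) = res B r (f a) :=
  map_res_spectral f h (by rwa [nonarchNorm_spectral_eq_norm])

theorem algebraMap_res [NormedAlgebra F E] {r : Grade} {c : F} (hc : ‖c‖ ≤ r.val) :
    algebraMap (GradedReduction F) (GradedReduction E) (res F r c) = res E r (algebraMap F E c) :=
  map_res (algebraMap F E) (fun a => (norm_algebraMap' E a).le) hc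

theorem res_smul [NormedAlgebra F E] {r s : Grade} {c : F} {a : E} (hc : ‖c‖ ≤ r.val)
    (ha : ‖a‖ ≤ s.val) : res E (r + s) (c • a) = res F r c • res E s a := by
  rw [Algebra.smul_def, Algebra.smul_def, algebraMap_res hc,
    res_mul (by rwa [norm_algebraMap']) ha]

end Field

end GradedReduction

open GradedReduction

/-! ### The tensor seminorm and `K̃ ⊗ L̃` -/

section Lift

variable {k K L : Type*} [NormedField k] [NormedField K] [NormedField L]
variable [NormedAlgebra k K] [NormedAlgebra k L]

/-- A functional on `K` that is `1` at `a i` and `0` at the other `a j`, applied to the first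
factor, isolates `b i`. -/
theorem eq_zero_of_sum_tmul_eq_zero {ι : Type*} {s : Finset ι} {a : ι → K} {b : ι → L}
    (ha : LinearIndepOn k a (s : Set ι)) (h : ∑ i ∈ s, a i ⊗ₜ[k] b i = 0) : ∀ i ∈ s, b i = 0 := by
  classical
  intro i hi
  obtain ⟨φ, hφ⟩ : ∃ φ : K →ₗ[k] k, ∀ j ∈ s, φ (a j) = if j = i then 1 else 0 := by
    obtain ⟨φ, hφ⟩ := LinearMap.exists_extend (p := Submodule.span k (a '' s))
      ((Finsupp.lapply (⟨i, hi⟩ : (s : Set ι))).comp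
        ((LinearIndependent.repr ha).comp
          (LinearEquiv.ofEq _ _ (by rw [Set.image_eq_range])).toLinearMap))
    refine ⟨φ, fun j hj => ?_⟩
    have hmem : a j ∈ Submodule.span k (a '' s) := Submodule.subset_span ⟨j, hj, rfl⟩
    have h1 := LinearMap.congr_fun hφ ⟨a j, hmem⟩
    refine h1.trans ?_
    have h2 := ha.repr_eq_single (⟨j, hj⟩ : (s : Set ι)) ⟨a j, by rwa [Set.image_eq_range] at hmem⟩ rfl
    refine (DFunLike.congr_fun h2 (⟨i, hi⟩ : (s : Set ι))).trans ?_
    rw [Finsupp.single_apply]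
    simp
  have h1 := congrArg (TensorProduct.lift ((LinearMap.lsmul k L).comp φ)) h
  rw [map_sum, map_zero, Finset.sum_eq_single i] at h1
  · simpa [hφ i hi] using h1
  · intro j hj hji
    simp [hφ j hj, hji]
  · exact fun h => absurd hi h

variable [IsUltrametricDist k] [IsUltrametricDist K] [IsUltrametricDist L]

/-- A relation between elementary tensors reduces to a relation between their classes. -/
theorem sum_res_tmul_res_eq_zero {ι : Type*} (r : Grade) (a : ι → K) (ρ : ι → Grade)
    (s : Finset ι) (ha : ∀ i ∈ s, ‖a i‖ ≤ (ρ i).val) (b : ι → L)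
    (hb : ∀ i ∈ s, ‖b i‖ ≤ (r - ρ i).val) (h : ∑ i ∈ s, a i ⊗ₜ[k] b i = 0) :
    ∑ i ∈ s, res K (ρ i) (a i) ⊗ₜ[GradedReduction k] res L (r - ρ i) (b i) = 0 := by
  classical
  induction s using Finset.strongInduction generalizing b with
  | H s ih =>
  by_cases hli : LinearIndepOn k a (s : Set ι)
  · refine Finset.sum_eq_zero fun i hi => ?_
    rw [eq_zero_of_sum_tmul_eq_zero hli h i hi, res_zero, TensorProduct.tmul_zero]
  · rw [linearIndepOn_finset_iff] at hli
    push Not at hli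
    obtain ⟨d, hd, j, hj, hdj⟩ := hli
    -- The vector to eliminate is the one whose term in the relation has the largest weight. Then `a
    -- i = ∑ c j • a j` with `‖c j‖` at most the quotient of the radii of `a i` and `a j`, so the
    -- substitution respects all the degree bounds and can be performed on classes as well.
    obtain ⟨i, hi, hmax⟩ := s.exists_max_image (fun i => ‖d i‖ * (ρ i).val) ⟨j, hj⟩
    have hdi : d i ≠ 0 := by
      intro h0
      have := hmax j hj
      rw [h0, norm_zero, zero_mul] at this
      exact absurd this (not_le.2 (mul_pos (norm_pos_iff.2 hdj) (ρ j).val_pos))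
    set c : ι → k := fun j => -(d j / d i) with hc
    have hcn : ∀ j ∈ s, ‖c j‖ ≤ (ρ i - ρ j).val := by
      intro j hj
      have h1 : (ρ i - ρ j).val * (ρ j).val = (ρ i).val := by
        rw [← Grade.val_add, sub_add_cancel]
      rw [hc, norm_neg, norm_div, div_le_iff₀ (norm_pos_iff.2 hdi),
        ← mul_le_mul_iff_left₀ (ρ j).val_pos, mul_right_comm, h1, mul_comm]
      rw [mul_comm]
      exact (hmax j hj).trans_eq (mul_comm _ _)
    have hai : a i = ∑ j ∈ s.erase i, c j • a j := by
      rw [← Finset.add_sum_erase s _ hi] at hd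
      have h1 : ∀ j, c j • a j = (-(d i)⁻¹) • (d j • a j) := by
        intro j
        rw [smul_smul, hc]
        congr 1
        ring
      rw [Finset.sum_congr rfl fun j _ => h1 j, ← Finset.smul_sum, ← neg_eq_of_add_eq_zero_right hd,
        smul_neg, neg_smul, neg_neg, smul_smul, inv_mul_cancel₀ hdi, one_smul]
    have hcb : ∀ j ∈ s.erase i, ‖c j • b i‖ ≤ (r - ρ j).val := by
      intro j hj
      rw [norm_smul, show r - ρ j = (ρ i - ρ j) + (r - ρ i) by abel, Grade.val_add]
      exact mul_le_mul (hcn j (Finset.mem_of_mem_erase hj)) (hb i hi) (norm_nonneg _)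
        (Grade.val_pos _).le
    have hca : ∀ j ∈ s.erase i, ‖c j • a j‖ ≤ (ρ i).val := by
      intro j hj
      rw [norm_smul, show ρ i = (ρ i - ρ j) + ρ j by abel, Grade.val_add]
      exact mul_le_mul (hcn j (Finset.mem_of_mem_erase hj)) (ha j (Finset.mem_of_mem_erase hj))
        (norm_nonneg _) (Grade.val_pos _).le
    -- Substituting for `a i` and moving the scalars to the right factor leaves a shorter relation
    -- in which `b j` has become `b j + c j • b i`.
    have key := ih (s.erase i) (Finset.erase_ssubset hi)
      (fun j hj => ha j (Finset.mem_of_mem_erase hj)) (fun j => b j + c j • b i)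
      (fun j hj => (IsUltrametricDist.norm_add_le_max _ _).trans
        (max_le (hb j (Finset.mem_of_mem_erase hj)) (hcb j hj)))
      (by
        rw [← h, ← Finset.add_sum_erase s _ hi, add_comm]
        simp only [TensorProduct.tmul_add, Finset.sum_add_distrib]
        congr 1
        rw [hai, TensorProduct.sum_tmul]
        exact Finset.sum_congr rfl fun j _ => by rw [TensorProduct.tmul_smul, TensorProduct.smul_tmul'])
    rw [← key, ← Finset.add_sum_erase s _ hi, add_comm, hai, res_sum _ _ hca,
      TensorProduct.sum_tmul, ← Finset.sum_add_distrib]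
    refine Finset.sum_congr rfl fun j hj => ?_
    have hj' := Finset.mem_of_mem_erase hj
    have e1 : res K (ρ i) (c j • a j) = res k (ρ i - ρ j) (c j) • res K (ρ j) (a j) := by
      rw [← res_smul (hcn j hj') (ha j hj'), sub_add_cancel]
    have e2 : res L (r - ρ j) (c j • b i) = res k (ρ i - ρ j) (c j) • res L (r - ρ i) (b i) := by
      rw [← res_smul (hcn j hj') (hb i hi), show (ρ i - ρ j) + (r - ρ i) = r - ρ j by abel]
    rw [res_add (hb j hj') (hcb j hj), TensorProduct.tmul_add, e1, e2, TensorProduct.smul_tmul]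

variable (k K L) in
/-- The pairs of an element of `K ⊗ L` and an element of degree `r` of `K̃ ⊗ L̃` with a common
presentation `∑ aᵢ ⊗ bᵢ`, `∑ [aᵢ] ⊗ [bᵢ]`. -/
def liftGroup (r : Grade) : AddSubgroup (NormedTensor k K L × ReductionTensor k K L) :=
  AddSubgroup.closure {p | ∃ s t a b, s + t = r ∧ ‖a‖ ≤ s.val ∧ ‖b‖ ≤ t.val ∧
    p = (NormedTensor.tmul k a b, res K s a ⊗ₜ[GradedReduction k] res L t b)}

theorem tmul_mem_liftGroup {s t : Grade} {a : K} {b : L} (ha : ‖a‖ ≤ s.val) (hb : ‖b‖ ≤ t.val) :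
    (NormedTensor.tmul k a b, res K s a ⊗ₜ[GradedReduction k] res L t b) ∈
      liftGroup k K L (s + t) :=
  AddSubgroup.subset_closure ⟨s, t, a, b, rfl, ha, hb, rfl⟩

theorem one_mem_liftGroup : (1, 1) ∈ liftGroup k K L 0 := by
  have h := tmul_mem_liftGroup (k := k) (s := 0) (t := 0) (a := (1 : K)) (b := (1 : L))
    (by rw [norm_one]; exact le_rfl) (by rw [norm_one]; exact le_rfl)
  rwa [res_one, res_one, add_zero] at h

theorem mul_mem_liftGroup {r s : Grade} {p q : NormedTensor k K L × ReductionTensor k K L}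
    (hp : p ∈ liftGroup k K L r) (hq : q ∈ liftGroup k K L s) :
    p * q ∈ liftGroup k K L (r + s) := by
  induction hp using AddSubgroup.closure_induction with
  | zero => rw [zero_mul]; exact zero_mem _
  | add _ _ _ _ h₁ h₂ => rw [add_mul]; exact add_mem h₁ h₂
  | neg _ _ h₁ => rw [neg_mul]; exact neg_mem h₁
  | mem p hp =>
    obtain ⟨r₁, r₂, a, b, rfl, ha, hb, rfl⟩ := hp
    induction hq using AddSubgroup.closure_induction with
    | zero => rw [mul_zero]; exact zero_mem _
    | add _ _ _ _ h₁ h₂ => rw [mul_add]; exact add_mem h₁ h₂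
    | neg _ _ h₁ => rw [mul_neg]; exact neg_mem h₁
    | mem q hq =>
      obtain ⟨s₁, s₂, c, d, rfl, hc, hd, rfl⟩ := hq
      rw [Prod.mk_mul_mk, NormedTensor.tmul_mul_tmul, Algebra.TensorProduct.tmul_mul_tmul,
        ← res_mul ha hc, ← res_mul hb hd, add_add_add_comm]
      refine tmul_mem_liftGroup ?_ ?_ <;> rw [norm_mul, Grade.val_add] <;>
        exact mul_le_mul (by assumption) (by assumption) (norm_nonneg _) (Grade.val_pos _).le

theorem norm_le_of_mem_liftGroup {r : Grade} {p : NormedTensor k K L × ReductionTensor k K L}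
    (hp : p ∈ liftGroup k K L r) : ‖p.1‖ ≤ r.val := by
  induction hp using AddSubgroup.closure_induction with
  | zero => simpa using r.val_pos.le
  | add p q _ _ h₁ h₂ => exact (IsUltrametricDist.norm_add_le_max _ _).trans (max_le h₁ h₂)
  | neg p _ h₁ => simpa using h₁
  | mem p hp =>
    obtain ⟨s, t, a, b, rfl, ha, hb, rfl⟩ := hp
    exact (NormedTensor.tensorNorm_tmul_le a b).trans
      (mul_le_mul ha hb (norm_nonneg _) s.val_pos.le)

theorem mem_grading_of_mem_liftGroup {r : Grade} {p : NormedTensor k K L × ReductionTensor k K L}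
    (hp : p ∈ liftGroup k K L r) : p.2 ∈ ReductionTensor.grading k K L r := by
  induction hp using AddSubgroup.closure_induction with
  | zero => exact zero_mem _
  | add p q _ _ h₁ h₂ => exact add_mem h₁ h₂
  | neg p _ h₁ => exact neg_mem h₁
  | mem p hp =>
    obtain ⟨s, t, a, b, rfl, -, -, rfl⟩ := hp
    exact tmul_mem_tensorGrading (res_mem s a) (res_mem t b)

theorem exists_mem_liftGroup {r : Grade} {z : ReductionTensor k K L}
    (hz : z ∈ ReductionTensor.grading k K L r) : ∃ f, (f, z) ∈ liftGroup k K L r := by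
  induction hz using AddSubgroup.closure_induction with
  | zero => exact ⟨0, zero_mem _⟩
  | add y z _ _ h₁ h₂ =>
    obtain ⟨f, hf⟩ := h₁
    obtain ⟨g, hg⟩ := h₂
    exact ⟨f + g, add_mem hf hg⟩
  | neg z _ h₁ =>
    obtain ⟨f, hf⟩ := h₁
    exact ⟨-f, neg_mem hf⟩
  | mem z hz =>
    obtain ⟨s, t, rfl, a, ha, b, hb, rfl⟩ := hz
    obtain ⟨a, ha', rfl⟩ := exists_res ha
    obtain ⟨b, hb', rfl⟩ := exists_res hb
    exact ⟨_, tmul_mem_liftGroup ha' hb'⟩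

/-- Brings membership in the generated group to the shape of `sum_res_tmul_res_eq_zero`: signs are
absorbed into `a i`, and the degree of the right factor is determined by that of the left one. -/
theorem exists_presentation {r : Grade} {p : NormedTensor k K L × ReductionTensor k K L}
    (hp : p ∈ liftGroup k K L r) : ∃ (ι : Type) (_ : Fintype ι) (a : ι → K) (b : ι → L)
      (ρ : ι → Grade), (∀ i, ‖a i‖ ≤ (ρ i).val) ∧ (∀ i, ‖b i‖ ≤ (r - ρ i).val) ∧
      p.1 = ∑ i, NormedTensor.tmul k (a i) (b i) ∧
      p.2 = ∑ i, res K (ρ i) (a i) ⊗ₜ[GradedReduction k] res L (r - ρ i) (b i) := by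
  induction hp using AddSubgroup.closure_induction with
  | zero => exact ⟨Empty, inferInstance, Empty.elim, Empty.elim, Empty.elim, by simp, by simp,
      by simp, by simp⟩
  | add p q _ _ h₁ h₂ =>
    obtain ⟨ι, _, a, b, ρ, ha, hb, h, h'⟩ := h₁
    obtain ⟨κ, _, c, d, σ, hc, hd, g, g'⟩ := h₂
    refine ⟨ι ⊕ κ, inferInstance, Sum.elim a c, Sum.elim b d, Sum.elim ρ σ,
      Sum.forall.2 ⟨ha, hc⟩, Sum.forall.2 ⟨hb, hd⟩, ?_, ?_⟩
    · simp [h, g]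
    · simp [h', g']
  | neg p _ h₁ =>
    obtain ⟨ι, _, a, b, ρ, ha, hb, h, h'⟩ := h₁
    refine ⟨ι, inferInstance, fun i => -a i, b, ρ, by simpa using ha, hb, ?_, ?_⟩
    · rw [Prod.fst_neg, h, ← Finset.sum_neg_distrib]
      exact Finset.sum_congr rfl fun i _ => (TensorProduct.neg_tmul _ _).symm
    · rw [Prod.snd_neg, h', ← Finset.sum_neg_distrib]
      exact Finset.sum_congr rfl fun i _ => by rw [res_neg (ha i), TensorProduct.neg_tmul]
  | mem p hp =>
    obtain ⟨s, t, a, b, rfl, ha, hb, rfl⟩ := hp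
    exact ⟨Unit, inferInstance, fun _ => a, fun _ => b, fun _ => s, fun _ => ha,
      fun _ => by simpa using hb, by simp, by simp⟩

/-- The graded ring `K̃ ⊗ L̃` injects into the graded ring associated with the tensor norm. -/
theorem eq_zero_of_norm_lt {r : Grade} {f : NormedTensor k K L} {z : ReductionTensor k K L}
    (h : (f, z) ∈ liftGroup k K L r) (hf : ‖f‖ < r.val) : z = 0 := by
  -- The small norm gives a second presentation of `f`, all of whose terms satisfy `‖a‖ * ‖b‖ ≤ c <
  -- r.val`; it pairs `f` with `0`.
  obtain ⟨c, ⟨hc0, l, rfl, hl⟩, hc⟩ := NormedTensor.exists_mem_bounds_lt hf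
  obtain ⟨c', hcc', hc'⟩ := exists_between hc
  have hsmall : ∀ a : K, ∀ b : L, ‖a‖ * ‖b‖ ≤ c →
      (NormedTensor.tmul k a b, 0) ∈ liftGroup k K L r := by
    intro a b hab
    by_cases ha : a = 0
    · rw [ha, show NormedTensor.tmul k (0 : K) b = 0 from TensorProduct.zero_tmul _ _]
      exact zero_mem _
    -- With the whole norm of `a` as its degree, `b` falls strictly below the complementary degree
    -- `r - s`, so its class there is zero.
    · let s : Grade := Additive.ofMul ⟨‖a‖, norm_pos_iff.2 ha⟩
      have hs : s.val = ‖a‖ := rfl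
      have hb : ‖b‖ < (r - s).val := by
        have h1 : s.val * (r - s).val = r.val := by rw [← Grade.val_add, add_sub_cancel]
        refine lt_of_mul_lt_mul_left ?_ s.val_pos.le
        rw [h1, hs]
        exact hab.trans_lt hc
      have h2 := tmul_mem_liftGroup (k := k) (s := s) hs.ge hb.le
      rwa [(res_eq_zero_iff hb.le).2 hb, TensorProduct.tmul_zero, add_sub_cancel] at h2
  have hl0 : (NormedTensor.ofList l, (0 : ReductionTensor k K L)) ∈ liftGroup k K L r := by
    clear h hf
    induction l with
    | nil => exact zero_mem _
    | cons q l ih =>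
      rw [NormedTensor.ofList_cons]
      have := add_mem (hsmall q.1 q.2 (hl q List.mem_cons_self))
        (ih fun p hp => hl p (List.mem_cons_of_mem _ hp))
      rwa [Prod.mk_add_mk, zero_add] at this
  -- The difference of the two presentations is a relation between elementary tensors in which every
  -- term has the prescribed degrees, and its reduction is `z`.
  have h0 := sub_mem h hl0
  rw [Prod.mk_sub_mk, sub_self, sub_zero] at h0
  obtain ⟨ι, _, a, b, ρ, ha, hb, h1, h2⟩ := exists_presentation h0
  exact h2.trans (sum_res_tmul_res_eq_zero r a ρ Finset.univ (fun i _ => ha i) b (fun i _ => hb i)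
    h1.symm)

theorem norm_eq_of_mem_liftGroup {r : Grade} {f : NormedTensor k K L} {z : ReductionTensor k K L}
    (h : (f, z) ∈ liftGroup k K L r) (hz : z ≠ 0) : ‖f‖ = r.val :=
  (norm_le_of_mem_liftGroup h).antisymm (not_lt.1 fun hf => hz (eq_zero_of_norm_lt h hf))

end Lift

open GradedReduction

/-! ### Reductions of fields are graded fields -/

section GradedField

variable {F : Type*} [NormedField F] [IsUltrametricDist F]

instance : IsDomain (GradedReduction F) :=
  have : (⊥ : Ideal (GradedReduction F)).IsPrime :=
    (HomogeneousSpectrum.zero (grading F) (GradedReduction.eq_zero_or_eq_zero F)).2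
  IsDomain.of_bot_isPrime (GradedReduction F)

theorem GradedReduction.exists_mul_eq_one {r : Grade} {c : GradedReduction F}
    (hc : c ∈ grading F r) (hc0 : c ≠ 0) : ∃ d ∈ grading F (-r), c * d = 1 := by
  obtain ⟨a, ha, rfl⟩ := exists_res hc
  have han : ‖a‖ = r.val := ha.antisymm (not_lt.1 fun h => hc0 ((res_eq_zero_iff ha).2 h))
  have hinv : ‖a⁻¹‖ ≤ (-r).val := by
    rw [norm_inv, han]
    exact le_rfl
  have ha0 : a ≠ 0 := norm_pos_iff.1 (han ▸ r.val_pos)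
  refine ⟨res F (-r) a⁻¹, res_mem _ _, ?_⟩
  rw [← res_mul ha hinv, mul_inv_cancel₀ ha0, add_neg_cancel, res_one]

theorem GradedReduction.isUnit_of_mem {r : Grade} {c : GradedReduction F}
    (hc : c ∈ grading F r) (hc0 : c ≠ 0) : IsUnit c := by
  obtain ⟨d, -, hd⟩ := exists_mul_eq_one hc hc0
  exact IsUnit.of_mul_eq_one d hd

/-- A nonzero element of `I` would have a nonzero homogeneous component; it lies in `I` and is a
unit. -/
theorem GradedReduction.homogeneousIdeal_eq_bot (I : HomogeneousIdeal (grading F))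
    (hI : I.toIdeal ≠ ⊤) : I.toIdeal = ⊥ := by
  classical
  rw [eq_bot_iff]
  intro a ha
  rw [Ideal.mem_bot, ← DirectSum.sum_support_decompose (grading F) a]
  refine Finset.sum_eq_zero fun r _ => ?_
  by_contra h0
  exact hI (Ideal.eq_top_of_isUnit_mem _ (I.isHomogeneous r ha)
    (isUnit_of_mem (DirectSum.decompose (grading F) a r).2 h0))

/-- A homomorphism of graded rings out of the reduction of a field is injective. -/
theorem GradedReduction.gradedHom_injective {A : Type*} [CommRing A] [Nontrivial A]
    {𝒜 : Grade → AddSubgroup A} [GradedRing 𝒜] (f : grading F →+*ᵍ 𝒜) :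
    Function.Injective (f : GradedReduction F →+* A) := by
  rw [RingHom.injective_iff_ker_eq_bot]
  refine homogeneousIdeal_eq_bot ((⊥ : HomogeneousIdeal 𝒜).comap f) ?_
  rw [Ideal.ne_top_iff_one]
  intro h
  have h1 : f 1 = 0 := h
  rw [map_one] at h1
  exact one_ne_zero h1

end GradedField

/-! ### Reduction of points, containment in `P`, and the integral case -/

section

variable {k K L : Type*} [NormedField k] [NormedField K] [NormedField L]
variable [NormedAlgebra k K] [NormedAlgebra k L]
variable [IsUltrametricDist k] [IsUltrametricDist K] [IsUltrametricDist L]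

theorem map_mul_map_res {A B : Type*} [SeminormedCommRing A] [IsUltrametricDist A]
    [Fact (‖(1 : A)‖ ≤ 1)] [SeminormedCommRing B] [IsUltrametricDist B] [Fact (‖(1 : B)‖ ≤ 1)]
    (f : K →+* A) (hf : ∀ a, ‖f a‖ ≤ ‖a‖) (g : L →+* A) (hg : ∀ a, ‖g a‖ ≤ ‖a‖) (χ : A →+* B)
    (hχ : ∀ a, ‖χ a‖ ≤ ‖a‖) {s t : Grade} {a : K} {b : L} (ha : ‖a‖ ≤ s.val) (hb : ‖b‖ ≤ t.val) :
    GradedReduction.map χ hχ (GradedReduction.map f hf (res K s a) *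
      GradedReduction.map g hg (res L t b)) = res B (s + t) (χ (f a * g b)) := by
  have ha' := (spectral_le_norm (f a)).trans ((hf a).trans ha)
  have hb' := (spectral_le_norm (g b)).trans ((hg b).trans hb)
  rw [map_res f hf ha, map_res g hg hb, ← res_mul_spectral ha' hb', map_res_spectral]
  exact ((nonarchNorm A).spectral.mul_le _ _).trans
    (mul_le_mul ha' hb' ((nonarchNorm A).spectral.nonneg _) s.val_pos.le)

/-- Holds on elementary tensors by multiplicativity of classes, and extends to sums because all
elements involved stay in the ball of radius `r`. -/
theorem map_character_reductionTensorRingHom (x : BerkovichSpectrum (CompletedTensor k K L))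
    {r : Grade} {p : NormedTensor k K L × ReductionTensor k K L} (hp : p ∈ liftGroup k K L r) :
    GradedReduction.map x.character x.norm_character_le (reductionTensorRingHom k K L p.2) =
      res x.CompletedResidueField r (x.character (p.1 : CompletedTensor k K L)) := by
  have hle : ∀ {p : NormedTensor k K L × ReductionTensor k K L}, p ∈ liftGroup k K L r →
      ‖x.character (p.1 : CompletedTensor k K L)‖ ≤ r.val := fun {p} hp =>
    (x.norm_character_le _).trans
      ((UniformSpace.Completion.norm_coe p.1).trans_le (norm_le_of_mem_liftGroup hp))
  induction hp using AddSubgroup.closure_induction with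
  | zero =>
    rw [Prod.fst_zero, Prod.snd_zero, map_zero, map_zero, UniformSpace.Completion.coe_zero,
      map_zero, res_zero]
  | add p q hp hq h₁ h₂ =>
    rw [Prod.fst_add, Prod.snd_add, map_add, map_add, UniformSpace.Completion.coe_add, map_add,
      res_add (hle hp) (hle hq), h₁, h₂]
  | neg p hp h₁ =>
    rw [Prod.fst_neg, Prod.snd_neg, map_neg, map_neg, UniformSpace.Completion.coe_neg, map_neg,
      res_neg (hle hp), h₁]
  | mem p hp =>
    obtain ⟨s, t, a, b, rfl, ha, hb, rfl⟩ := hp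
    have hab : CompletedTensor.inclLeft k K L a * CompletedTensor.inclRight k K L b =
        (NormedTensor.tmul k a b : NormedTensor k K L) := by
      refine (UniformSpace.Completion.coe_mul (NormedTensor.tmul k a (1 : L))
        (NormedTensor.tmul k (1 : K) b)).symm.trans ?_
      rw [NormedTensor.tmul_mul_tmul, mul_one, one_mul]
    refine (congrArg (GradedReduction.map x.character x.norm_character_le)
      (reductionTensorRingHom_tmul k K L (res K s a) (res L t b))).trans ?_
    refine (map_mul_map_res _ (CompletedTensor.norm_inclLeft_le k K L) _
      (CompletedTensor.norm_inclRight_le k K L) _ x.norm_character_le ha hb).trans ?_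
    exact congrArg (fun c => res x.CompletedResidueField (s + t) (x.character c)) hab

/-- The working description of the map: the reduction of `x` is read off from the values of `x` on
lifts, since the class of an element of `ℋ(x)` in degree `r` vanishes exactly when its norm is below
`r`. -/
theorem mem_tensorReductionMap_iff (x : BerkovichSpectrum (CompletedTensor k K L))
    {r : Grade} {f : NormedTensor k K L} {z : ReductionTensor k K L}
    (h : (f, z) ∈ liftGroup k K L r) :
    z ∈ (tensorReductionMap k K L x).1.toIdeal ↔ x (f : CompletedTensor k K L) < r.val := by
  have h1 : z ∈ (tensorReductionMap k K L x).1.toIdeal ↔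
      GradedReduction.map x.character x.norm_character_le (reductionTensorRingHom k K L z) = 0 :=
    Iff.rfl
  rw [h1, map_character_reductionTensorRingHom x h, res_eq_zero_iff, x.norm_character]
  exact (x.norm_character_le _).trans
      ((UniformSpace.Completion.norm_coe f).trans_le (norm_le_of_mem_liftGroup h))

/-- Every homogeneous prime ideal contains the reduction of some point. -/
theorem exists_tensorReductionMap_le
    (P : HomogeneousSpectrum (ReductionTensor.grading k K L)) :
    ∃ x : BerkovichSpectrum (CompletedTensor k K L),
      (tensorReductionMap k K L x).1 ≤ P.1 := by
  have hP := P.2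
  -- The lifts of homogeneous elements outside `P`. They reduce to nonzero elements, so their norm
  -- equals their degree (`hnorm`) and is multiplicative on `S`.
  let S : Submonoid (CompletedTensor k K L) :=
    { carrier := {g | ∃ f z r, (f, z) ∈ liftGroup k K L r ∧ z ∉ P.1.toIdeal ∧
        g = (f : CompletedTensor k K L)}
      one_mem' := ⟨1, 1, 0, one_mem_liftGroup, (Ideal.ne_top_iff_one _).1 hP.ne_top,
        UniformSpace.Completion.coe_one _⟩
      mul_mem' := by
        rintro _ _ ⟨f, z, r, h, hz, rfl⟩ ⟨f', z', r', h', hz', rfl⟩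
        exact ⟨f * f', z * z', r + r', mul_mem_liftGroup h h',
          fun hzz => (hP.mem_or_mem hzz).elim hz hz', (UniformSpace.Completion.coe_mul f f').symm⟩ }
  have hnorm : ∀ {f z r}, (f, z) ∈ liftGroup k K L r → z ∉ P.1.toIdeal →
      nonarchNorm (CompletedTensor k K L) (f : CompletedTensor k K L) = r.val := fun h hz =>
    (UniformSpace.Completion.norm_coe _).trans
      (norm_eq_of_mem_liftGroup h fun h0 => hz (h0 ▸ zero_mem _))
  obtain ⟨x, hx, hxS⟩ := (nonarchNorm (CompletedTensor k K L)).exists_mulRingSeminorm_le S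
    (by
      rintro _ ⟨f, z, r, h, hz, rfl⟩
      rw [hnorm h hz]
      exact r.val_pos)
    (by
      rintro _ ⟨f, z, r, h, hz, rfl⟩ _ ⟨f', z', r', h', hz', rfl⟩
      rw [hnorm h hz, hnorm h' hz', ← UniformSpace.Completion.coe_mul,
        hnorm (mul_mem_liftGroup h h') (fun hzz => (hP.mem_or_mem hzz).elim hz hz'), Grade.val_add])
  let y : BerkovichSpectrum (CompletedTensor k K L) :=
    { x with bounded' := ⟨1, fun a => (hx a).trans_eq (one_mul _).symm⟩ }
  refine ⟨y, ?_⟩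
  -- A homogeneous `z` outside `P` has a lift in `S`, where the point still takes the value `r`, so
  -- `z` is not in its reduction.
  have key : ∀ r, ∀ z ∈ ReductionTensor.grading k K L r,
      z ∈ (tensorReductionMap k K L y).1.toIdeal → z ∈ P.1.toIdeal := by
    intro r z hz hzy
    obtain ⟨f, h⟩ := exists_mem_liftGroup hz
    by_contra hzP
    have h1 := (mem_tensorReductionMap_iff y h).1 hzy
    have h2 : y (f : CompletedTensor k K L) = r.val :=
      (hxS _ ⟨f, z, r, h, hzP, rfl⟩).trans (hnorm h hzP)
    exact h1.ne h2
  classical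
  intro z hz
  rw [← DirectSum.sum_support_decompose (ReductionTensor.grading k K L) z]
  exact sum_mem fun r _ => key r _ (DirectSum.decompose (ReductionTensor.grading k K L) z r).2
    ((tensorReductionMap k K L y).1.isHomogeneous r hz)

/-- All homogeneous primes lie over one and the same prime of `K̃`, so incomparability in integral
extensions can be applied to them. -/
theorem comap_inclLeft_eq_bot (P : HomogeneousSpectrum (ReductionTensor.grading k K L)) :
    P.1.toIdeal.comap (algebraMap (GradedReduction K) (ReductionTensor k K L)) = ⊥ := by
  have hP := P.2
  refine GradedReduction.homogeneousIdeal_eq_bot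
    (P.1.comap (tensorInclLeft (GradedReduction k) (grading K) (grading L))) ?_
  exact Ideal.comap_ne_top _ hP.ne_top

/-- If `L̃` is integral over `k̃` then every homogeneous prime ideal is the reduction of a point. -/
theorem tensorReductionMap_surjective_of_isIntegral
    [Algebra.IsIntegral (GradedReduction k) (GradedReduction L)] :
    Function.Surjective (tensorReductionMap k K L) := by
  intro P
  obtain ⟨x, hx⟩ := exists_tensorReductionMap_le P
  refine ⟨x, Subtype.ext (HomogeneousIdeal.ext ?_)⟩
  by_contra hne
  have := (tensorReductionMap k K L x).2
  have hlt : (tensorReductionMap k K L x).1.toIdeal < P.1.toIdeal :=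
    lt_of_le_of_ne hx hne
  -- `K̃ ⊗ L̃` is integral over `K̃` by base change, so a strict inclusion of primes would remain
  -- strict after contraction to `K̃`.
  have h := Ideal.IsIntegral.comap_lt_comap (R := GradedReduction K) hlt
  rw [comap_inclLeft_eq_bot, comap_inclLeft_eq_bot] at h
  exact lt_irrefl _ h

end

/-! ### Algebraically closed nonarchimedean extensions -/

section AlgebraicallyClosedExtension

/-- A complete nonarchimedean field has an algebraically closed nonarchimedean extension. -/
theorem exists_isAlgClosed_extension.{u} (F : Type u) [NormedField F] [CompleteSpace F]
    [IsUltrametricDist F] : ∃ (M : Type u) (_ : NormedField M) (_ : IsUltrametricDist M)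
      (_ : IsAlgClosed M) (j : F →+* M), ∀ a, ‖j a‖ = ‖a‖ := by
  by_cases h : ∃ a : F, a ≠ 0 ∧ ‖a‖ ≠ 1
  -- Nontrivial norm: by completeness it extends to the algebraic closure as the spectral norm.
  · let _ : NontriviallyNormedField F := NontriviallyNormedField.ofNormNeOne h
    let _ : NormedField (AlgebraicClosure F) := spectralNorm.normedField F (AlgebraicClosure F)
    refine ⟨AlgebraicClosure F, inferInstance, ?_, inferInstance,
      algebraMap F (AlgebraicClosure F), fun a => spectralNorm_extends (L := AlgebraicClosure F) a⟩
    exact IsUltrametricDist.isUltrametricDist_of_forall_norm_add_le_max_norm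
      fun a b => isNonarchimedean_spectralNorm (K := F) (L := AlgebraicClosure F) a b
  -- Trivial norm: the algebraic closure with the trivial absolute value.
  · classical
    push Not at h
    let v : AbsoluteValue (AlgebraicClosure F) ℝ := AbsoluteValue.trivial
    have hv : ∀ a, a ≠ 0 → v a = 1 := fun a ha => AbsoluteValue.trivial_apply ha
    let _ : NormedField (AlgebraicClosure F) := v.toNormedField
    refine ⟨AlgebraicClosure F, inferInstance, ?_, inferInstance,
      algebraMap F (AlgebraicClosure F), fun a => ?_⟩
    · refine IsUltrametricDist.isUltrametricDist_of_forall_norm_add_le_max_norm fun a b => ?_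
      show v (a + b) ≤ max (v a) (v b)
      by_cases ha : a = 0
      · rw [ha, zero_add]
        exact le_max_right _ _
      · rw [hv a ha]
        by_cases hab : a + b = 0
        · rw [hab, map_zero]
          exact le_max_of_le_left zero_le_one
        · rw [hv _ hab]
          exact le_max_left _ _
    · show v _ = _
      by_cases ha : a = 0
      · rw [ha, map_zero, map_zero, norm_zero]
      · rw [h a ha]
        exact hv _ ((map_ne_zero (algebraMap F (AlgebraicClosure F))).2 ha)

end AlgebraicallyClosedExtension

theorem GradedReduction.res_sub {F : Type*} [NormedField F] [IsUltrametricDist F] {r : Grade}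
    {a b : F} (ha : ‖a‖ ≤ r.val) (hb : ‖b‖ ≤ r.val) :
    res F r (a - b) = res F r a - res F r b := by
  rw [sub_eq_add_neg, res_add ha (by rwa [norm_neg]), res_neg hb, ← sub_eq_add_neg]

/-! ### Lifting homogeneous roots to an algebraically closed field -/

section Roots

open Polynomial

variable {M : Type*} [NormedField M] [IsUltrametricDist M]
variable {Ω : Type*} [CommRing Ω] (φ : GradedReduction M →+* Ω) (ω : Ω) (r : Grade)

/-- The value at `ω` of the reduction of a polynomial `f` that is homogeneous of degree `d` when
the variable has degree `r`; the sum is over the terms of degree at most `N`. -/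
def evalReduction (d : Grade) (N : ℕ) (f : M[X]) : Ω :=
  ∑ n ∈ Finset.range (N + 1), φ (res M (d - n • r) (f.coeff n)) * ω ^ n

/-- The coefficient of index `n + 1` of the product is `f.coeff n - f.coeff (n + 1) * α`, and both
terms lie in the ball of degree `d - n • r`, so the class of the difference is the difference of the
classes. Summing gives the product formula. -/
theorem evalReduction_mul_X_sub_C {d : Grade} {N : ℕ} {f : M[X]} {α : M}
    (hf : ∀ n, ‖f.coeff n‖ ≤ (d - n • r).val) (hN : f.natDegree ≤ N) (hα : ‖α‖ ≤ r.val) :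
    evalReduction φ ω r (d + r) (N + 1) (f * (X - C α)) =
      evalReduction φ ω r d N f * (ω - φ (res M r α)) := by
  have hmul : ∀ n, ‖f.coeff n * α‖ ≤ (d - n • r + r).val := fun n => by
    rw [norm_mul, Grade.val_add]
    exact mul_le_mul (hf n) hα (norm_nonneg _) (Grade.val_pos _).le
  have h0 : φ (res M (d + r - 0 • r) ((f * (X - C α)).coeff 0)) * ω ^ 0 =
      -(φ (res M (d - 0 • r) (f.coeff 0)) * ω ^ 0 * φ (res M r α)) := by
    have e : (f * (X - C α)).coeff 0 = -(f.coeff 0 * α) := by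
      rw [mul_coeff_zero]
      simp
    rw [e, show d + r - 0 • r = d - 0 • r + r by abel, res_neg (hmul 0), res_mul (hf 0) hα,
      map_neg, map_mul]
    ring
  have hs : ∀ n, φ (res M (d + r - (n + 1) • r) ((f * (X - C α)).coeff (n + 1))) * ω ^ (n + 1) =
      φ (res M (d - n • r) (f.coeff n)) * ω ^ n * ω -
        φ (res M (d - (n + 1) • r) (f.coeff (n + 1))) * ω ^ (n + 1) * φ (res M r α) := by
    intro n
    have e1 : d + r - (n + 1) • r = d - n • r := by rw [succ_nsmul]; abel
    have e2 : d - n • r = d - (n + 1) • r + r := by rw [succ_nsmul]; abel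
    have h2 := hmul (n + 1)
    rw [← e2] at h2
    rw [coeff_mul_X_sub_C, e1, res_sub (hf n) h2, map_sub]
    conv_lhs => rw [e2, res_mul (hf (n + 1)) hα, ← e2]
    rw [map_mul]
    ring
  -- The shifted sum runs one index beyond `N`; the extra term is zero.
  have hlast : f.coeff (N + 1) = 0 := coeff_eq_zero_of_natDegree_lt (Nat.lt_succ_of_le hN)
  have hsum : evalReduction φ ω r d N f =
      ∑ n ∈ Finset.range (N + 1), φ (res M (d - (n + 1) • r) (f.coeff (n + 1))) * ω ^ (n + 1) +
        φ (res M (d - 0 • r) (f.coeff 0)) * ω ^ 0 := by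
    rw [← Finset.sum_range_succ' (fun n => φ (res M (d - n • r) (f.coeff n)) * ω ^ n),
      Finset.sum_range_succ, hlast, res_zero, map_zero, zero_mul, add_zero]
    rfl
  have hdef : ∑ n ∈ Finset.range (N + 1), φ (res M (d - n • r) (f.coeff n)) * ω ^ n =
    evalReduction φ ω r d N f := rfl
  have hL : evalReduction φ ω r (d + r) (N + 1) (f * (X - C α)) = _ := Finset.sum_range_succ' _ _
  rw [hL, h0, Finset.sum_congr rfl fun n _ => hs n, Finset.sum_sub_distrib, ← Finset.sum_mul,
    ← Finset.sum_mul, hdef, mul_sub (evalReduction φ ω r d N f)]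
  conv_rhs => enter [2]; rw [hsum]
  ring

/-- Each factor `X - α` raises the degree by `r`. The coefficient bounds are part of the induction
because `evalReduction_mul_X_sub_C` needs them for the partial product. -/
theorem evalReduction_prod {s : Grade} {c : M} (hc : ‖c‖ ≤ s.val) (m : Multiset M)
    (hm : ∀ α ∈ m, ‖α‖ ≤ r.val) :
    (∀ n, ‖(C c * (m.map (X - C ·)).prod).coeff n‖ ≤ (s + m.card • r - n • r).val) ∧
      evalReduction φ ω r (s + m.card • r) m.card (C c * (m.map (X - C ·)).prod) =
        φ (res M s c) * (m.map fun α => ω - φ (res M r α)).prod := by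
  induction m using Multiset.induction_on with
  | empty =>
    refine ⟨fun n => ?_, ?_⟩
    · rw [Multiset.map_zero, Multiset.prod_zero, mul_one, coeff_C]
      split_ifs with h
      · simpa [h] using hc
      · simpa using (Grade.val_pos _).le
    · simp [evalReduction]
  | cons α m ih =>
    obtain ⟨h1, h2⟩ := ih fun β hβ => hm β (Multiset.mem_cons_of_mem hβ)
    have hα := hm α (Multiset.mem_cons_self α m)
    have e : C c * ((α ::ₘ m).map (X - C ·)).prod = C c * (m.map (X - C ·)).prod * (X - C α) := by
      rw [Multiset.map_cons, Multiset.prod_cons]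
      ring
    have e' : s + (α ::ₘ m).card • r = s + m.card • r + r := by
      rw [Multiset.card_cons, succ_nsmul, add_assoc]
    have hdeg : (C c * (m.map (X - C ·)).prod).natDegree ≤ m.card :=
      (natDegree_C_mul_le _ _).trans (natDegree_multiset_prod_X_sub_C_eq_card m).le
    rw [e, e']
    refine ⟨fun n => ?_, ?_⟩
    · have hcα : ∀ n, ‖(C c * (m.map (X - C ·)).prod).coeff n * α‖ ≤
          (s + m.card • r + r - n • r).val := fun n => by
        rw [norm_mul, show s + m.card • r + r - n • r = s + m.card • r - n • r + r by abel,
          Grade.val_add]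
        exact mul_le_mul (h1 n) hα (norm_nonneg _) (Grade.val_pos _).le
      cases n with
      | zero =>
        rw [mul_coeff_zero, coeff_sub, coeff_X_zero, coeff_C_zero, zero_sub, mul_neg, norm_neg]
        exact hcα 0
      | succ n =>
        rw [coeff_mul_X_sub_C, sub_eq_add_neg]
        refine (IsUltrametricDist.norm_add_le_max _ _).trans (max_le ?_ ?_)
        · rw [show s + m.card • r + r - (n + 1) • r = s + m.card • r - n • r by
            rw [succ_nsmul]; abel]
          exact h1 n
        · rw [norm_neg]
          exact hcα (n + 1)
    · rw [Multiset.card_cons, evalReduction_mul_X_sub_C φ ω r h1 hdeg hα, h2, Multiset.map_cons,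
        Multiset.prod_cons]
      ring

/-- If `‖α‖` exceeded `r.val`, the leading term, whose coefficient attains its bound, would strictly
dominate all the others, and `f` could not vanish at `α`. -/
theorem norm_le_of_root {d : Grade} {f : M[X]} (hf : ∀ n, ‖f.coeff n‖ ≤ (d - n • r).val)
    (hlead : ‖f.leadingCoeff‖ = (d - f.natDegree • r).val) {α : M} (hα : f.eval α = 0) :
    ‖α‖ ≤ r.val := by
  by_contra! h
  have hα0 : 0 < ‖α‖ := r.val_pos.trans h
  have hval : ∀ n : ℕ, (d - n • r).val * r.val ^ n = d.val := by
    intro n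
    have : (n • r).val = r.val ^ n := by
      induction n with
      | zero => rw [zero_nsmul, pow_zero]; rfl
      | succ n ih => rw [succ_nsmul, Grade.val_add, ih, pow_succ]
    rw [← this, ← Grade.val_add, sub_add_cancel]
  have hlt : ∀ n ∈ Finset.range f.natDegree,
      ‖f.coeff n * α ^ n‖ < ‖f.leadingCoeff * α ^ f.natDegree‖ := by
    intro n hn
    have hn' := Finset.mem_range.1 hn
    rw [norm_mul, norm_mul, norm_pow, norm_pow, hlead]
    refine (mul_le_mul_of_nonneg_right (hf n) (pow_nonneg hα0.le n)).trans_lt ?_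
    have h1 : (d - n • r).val = (d - f.natDegree • r).val * r.val ^ (f.natDegree - n) := by
      refine mul_right_cancel₀ (pow_pos r.val_pos n).ne' ?_
      rw [hval, mul_assoc, ← pow_add, Nat.sub_add_cancel hn'.le, hval]
    rw [h1, mul_assoc]
    refine mul_lt_mul_of_pos_left ?_ (Grade.val_pos _)
    conv_rhs => rw [← Nat.sub_add_cancel hn'.le, pow_add]
    exact mul_lt_mul_of_pos_right (pow_lt_pow_left₀ h r.val_pos.le (Nat.sub_pos_of_lt hn').ne')
      (pow_pos hα0 n)
  have hpos : 0 < ‖f.leadingCoeff * α ^ f.natDegree‖ := by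
    rw [norm_mul, norm_pow, hlead]
    exact mul_pos (Grade.val_pos _) (pow_pos hα0 _)
  rw [eval_eq_sum_range, Finset.sum_range_succ] at hα
  have h2 : ‖∑ n ∈ Finset.range f.natDegree, f.coeff n * α ^ n‖ <
      ‖f.leadingCoeff * α ^ f.natDegree‖ := by
    obtain ⟨n, hn, hle⟩ := IsUltrametricDist.exists_norm_finsetSum_le
      (Finset.range f.natDegree) (fun n => f.coeff n * α ^ n)
    by_cases hne : (Finset.range f.natDegree).Nonempty
    · exact hle.trans_lt (hlt n (hn hne))
    · rw [Finset.not_nonempty_iff_eq_empty.1 hne, Finset.sum_empty, norm_zero]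
      exact hpos
  rw [eq_neg_of_add_eq_zero_left hα, norm_neg] at h2
  exact lt_irrefl _ h2

/-- The graded reduction of an algebraically closed field is algebraically closed in the graded
sense: homogeneous roots of homogeneous polynomials lift. -/
theorem exists_res_of_eval₂_eq_zero [IsAlgClosed M] [IsDomain Ω] {d : Grade}
    {G : (GradedReduction M)[X]} (hG0 : G ≠ 0) (hG : ∀ n, G.coeff n ∈ grading M (d - n • r))
    (h : G.eval₂ φ ω = 0) : ∃ m : M, ‖m‖ ≤ r.val ∧ φ (res M r m) = ω := by
  -- The polynomial is lifted coefficient by coefficient. The lift of the leading coefficient has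
  -- the maximal norm, since its class is nonzero.
  choose c hc hcG using fun n => exists_res (hG n)
  set N := G.natDegree with hN
  set g : M[X] := ∑ n ∈ Finset.range (N + 1), monomial n (c n) with hg
  have hcoeff : ∀ n, g.coeff n = if n ≤ N then c n else 0 := by
    intro n
    simp [hg, coeff_monomial]
  have hGN : G.coeff N ≠ 0 := by
    rw [hN]
    exact leadingCoeff_ne_zero.2 hG0
  have hcN : ‖c N‖ = (d - N • r).val := by
    refine (hc N).antisymm (not_lt.1 fun hlt => hGN ?_)
    rw [← hcG, (res_eq_zero_iff (hc N)).2 hlt]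
  have hcN0 : c N ≠ 0 := norm_pos_iff.1 (hcN ▸ Grade.val_pos _)
  have hgdeg : g.natDegree = N := by
    refine natDegree_eq_of_le_of_coeff_ne_zero ?_ (by rwa [hcoeff, if_pos le_rfl])
    exact natDegree_le_iff_coeff_eq_zero.2 fun n hn => by rw [hcoeff, if_neg (not_le.2 hn)]
  have hlead : g.leadingCoeff = c N := by rw [leadingCoeff, hgdeg, hcoeff, if_pos le_rfl]
  have hgc : ∀ n, ‖g.coeff n‖ ≤ (d - n • r).val := by
    intro n
    rw [hcoeff]
    split_ifs
    · exact hc n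
    · simpa using (Grade.val_pos _).le
  have hsplit := IsAlgClosed.splits g
  have hroots : ∀ α ∈ g.roots, ‖α‖ ≤ r.val := fun α hα =>
    norm_le_of_root r hgc (by rw [hlead, hgdeg, hcN]) (isRoot_of_mem_roots hα)
  have hcard : g.roots.card = N := by rw [← hsplit.natDegree_eq_card_roots, hgdeg]
  -- Over `M` the lift `g` splits with all roots in the ball of radius `r`, so its reduction at `ω`
  -- is a unit times the product of the `ω - φ (res M r α)`. This reduction is the value of `G` at
  -- `ω`, which is zero, so one factor vanishes.
  obtain ⟨-, hprod⟩ := evalReduction_prod φ ω r (hc N) g.roots hroots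
  have hfac : C (c N) * (g.roots.map (X - C ·)).prod = g := by
    rw [← hlead]
    exact hsplit.eq_prod_roots.symm
  rw [hfac, hcard, sub_add_cancel] at hprod
  have heval : evalReduction φ ω r d N g = 0 := by
    rw [← h, eval₂_eq_sum_range]
    refine Finset.sum_congr rfl fun n hn => ?_
    rw [hcoeff, if_pos (Nat.lt_succ_iff.1 (Finset.mem_range.1 hn)), hcG]
  rw [heval] at hprod
  have hunit : IsUnit (φ (res M (d - N • r) (c N))) := by
    rw [hcG]
    exact (isUnit_of_mem (hG N) hGN).map φ
  have h0 := (mul_eq_zero.1 hprod.symm).resolve_left hunit.ne_zero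
  obtain ⟨α, hα, hα0⟩ := Multiset.mem_map.1 (Multiset.prod_eq_zero_iff.1 h0)
  exact ⟨α, hroots α hα, (sub_eq_zero.1 hα0).symm⟩

end Roots

/-! ### Common extensions of two domains -/

section Compositum

/-- The tensor product of two field extensions is nonzero; any of its residue fields serves. -/
theorem exists_compositum_of_fields.{u, v, w} {F : Type u} {C : Type v} {D : Type w} [Field F]
    [Field C] [Field D] (f : F →+* C) (g : F →+* D) :
    ∃ (Ω : Type (max v w)) (_ : Field Ω) (u : C →+* Ω) (v : D →+* Ω), u.comp f = v.comp g := by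
  let _ : Algebra F C := f.toAlgebra
  let _ : Algebra F D := g.toAlgebra
  obtain ⟨m, hm⟩ := Ideal.exists_maximal (C ⊗[F] D)
  let _ : Field ((C ⊗[F] D) ⧸ m) := Ideal.Quotient.field m
  refine ⟨_, inferInstance, (Ideal.Quotient.mk m).comp Algebra.TensorProduct.includeLeftRingHom,
    (Ideal.Quotient.mk m).comp
      (Algebra.TensorProduct.includeRight : D →ₐ[F] C ⊗[F] D).toRingHom, RingHom.ext fun b => ?_⟩
  exact congrArg (Ideal.Quotient.mk m) (Algebra.TensorProduct.tmul_one_eq_one_tmul b)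

/-- Two injective homomorphisms from a ring into domains can be completed to a commutative square of
injective homomorphisms into a field. -/
theorem exists_compositum.{u, v, w} {B : Type u} {C : Type v} {D : Type w} [CommRing B] [CommRing C]
    [CommRing D] [IsDomain C] [IsDomain D] (f : B →+* C) (g : B →+* D)
    (hf : Function.Injective f) (hg : Function.Injective g) :
    ∃ (Ω : Type (max v w)) (_ : Field Ω) (u : C →+* Ω) (v : D →+* Ω),
      Function.Injective u ∧ Function.Injective v ∧ u.comp f = v.comp g := by
  have : IsDomain B := hf.isDomain f
  have hf' : Function.Injective ((algebraMap C (FractionRing C)).comp f) :=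
    (IsFractionRing.injective C (FractionRing C)).comp hf
  have hg' : Function.Injective ((algebraMap D (FractionRing D)).comp g) :=
    (IsFractionRing.injective D (FractionRing D)).comp hg
  obtain ⟨Ω, _, u, v, huv⟩ := exists_compositum_of_fields
    (IsFractionRing.lift (K := FractionRing B) hf') (IsFractionRing.lift (K := FractionRing B) hg')
  refine ⟨Ω, inferInstance, u.comp (algebraMap C (FractionRing C)),
    v.comp (algebraMap D (FractionRing D)), u.injective.comp (IsFractionRing.injective C _),
    v.injective.comp (IsFractionRing.injective D _), RingHom.ext fun b => ?_⟩
  have h := RingHom.congr_fun huv (algebraMap B (FractionRing B) b)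
  rwa [RingHom.comp_apply, RingHom.comp_apply, IsFractionRing.lift_algebraMap,
    IsFractionRing.lift_algebraMap] at h

end Compositum

/-! ### Homogeneous algebraic relations -/

section Homogenization

variable {C D T : Type*} [CommRing C] [CommRing D] [CommRing T]
variable {𝒞 : Grade → AddSubgroup C} {𝒟 : Grade → AddSubgroup D} {𝒯 : Grade → AddSubgroup T}
variable [GradedRing 𝒞] [GradedRing 𝒟] [GradedRing 𝒯]
variable {σ : Type*}

theorem prod_pow_mem_grading {y : σ → D} {w : σ → Grade} (hy : ∀ i, y i ∈ 𝒟 (w i)) (ν : σ →₀ ℕ) :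
    (ν.prod fun i n => y i ^ n) ∈ 𝒟 (Finsupp.weight w ν) := by
  rw [Finsupp.weight_apply]
  exact SetLike.prod_mem_graded 𝒟 (fun i => ν i • w i) (fun i => y i ^ ν i)
    fun i _ => SetLike.pow_mem_graded (ν i) (hy i)

/-- An algebraic relation between homogeneous elements, modulo a homogeneous ideal, can be replaced
by a homogeneous one. -/
theorem exists_homogeneous_relation (f : 𝒞 →+*ᵍ 𝒟) (P : HomogeneousIdeal 𝒟) {y : σ → D}
    {w : σ → Grade} (hy : ∀ i, y i ∈ 𝒟 (w i)) {G : MvPolynomial σ C} (hG0 : G ≠ 0)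
    (hG : MvPolynomial.eval₂ (f : C →+* D) y G ∈ P.toIdeal) :
    ∃ (d : Grade) (G' : MvPolynomial σ C), G' ≠ 0 ∧
      (∀ ν, G'.coeff ν ∈ 𝒞 (d - Finsupp.weight w ν)) ∧
      MvPolynomial.eval₂ (f : C →+* D) y G' ∈ P.toIdeal := by
  classical
  -- `H d` is the part of `G` of total degree `d`, where the variable `i` has degree `w i`. Its
  -- value at `y` is the degree `d` component of the value of `G`, so it stays in the homogeneous
  -- ideal `P`.
  let H : Grade → MvPolynomial σ C := fun d => ∑ ν ∈ G.support,
    MvPolynomial.monomial ν (DirectSum.decompose 𝒞 (G.coeff ν) (d - Finsupp.weight w ν) : C)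
  have hH : ∀ d ν, (H d).coeff ν =
      (DirectSum.decompose 𝒞 (G.coeff ν) (d - Finsupp.weight w ν) : C) := by
    intro d ν
    simp only [H, MvPolynomial.coeff_sum, MvPolynomial.coeff_monomial]
    rw [Finset.sum_ite_eq' G.support ν]
    split_ifs with h
    · rfl
    · rw [MvPolynomial.notMem_support_iff.1 h, DirectSum.decompose_zero]
      rfl
  -- The degree is chosen so that a nonzero component of some coefficient survives.
  obtain ⟨ν₀, hν₀⟩ := MvPolynomial.exists_coeff_ne_zero hG0
  obtain ⟨e, he⟩ : ∃ e, (DirectSum.decompose 𝒞 (G.coeff ν₀) e : C) ≠ 0 := by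
    by_contra! h
    apply hν₀
    rw [← DirectSum.sum_support_decompose 𝒞 (G.coeff ν₀)]
    exact Finset.sum_eq_zero fun e _ => h e
  refine ⟨e + Finsupp.weight w ν₀, H (e + Finsupp.weight w ν₀), fun h0 => he ?_, fun ν => ?_, ?_⟩
  · have := hH (e + Finsupp.weight w ν₀) ν₀
    rw [h0, MvPolynomial.coeff_zero, add_sub_cancel_right] at this
    exact this.symm
  · rw [hH]
    exact SetLike.coe_mem _
  · have key : ∀ d, MvPolynomial.eval₂ (f : C →+* D) y (H d) =
        GradedRing.proj 𝒟 d (MvPolynomial.eval₂ (f : C →+* D) y G) := by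
      intro d
      conv_rhs => rw [← MvPolynomial.support_sum_monomial_coeff G]
      simp only [H, MvPolynomial.eval₂_sum, map_sum, MvPolynomial.eval₂_monomial]
      refine Finset.sum_congr rfl fun ν _ => ?_
      have h1 := DirectSum.coe_decompose_mul_add_of_right_mem 𝒟 (i := d - Finsupp.weight w ν)
        (a := f (G.coeff ν)) (prod_pow_mem_grading hy ν)
      rw [sub_add_cancel] at h1
      refine Eq.trans ?_ h1.symm
      congr 1
      exact f.map_directSumDecompose
    rw [key]
    exact P.isHomogeneous _ hG

/-- If `l` satisfies an algebraic relation over `C[y]`, and the `y` correspond to algebraically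
independent elements `t` of `T`, then `l` is the root of a homogeneous polynomial over `T`. -/
theorem exists_homogeneous_polynomial (f : 𝒞 →+*ᵍ 𝒟) (g : 𝒞 →+*ᵍ 𝒯) (P : HomogeneousIdeal 𝒟)
    {y : σ → D} {w : σ → Grade} (hy : ∀ i, y i ∈ 𝒟 (w i)) {l : D} {r : Grade} (hl : l ∈ 𝒟 r)
    {G : MvPolynomial (Option σ) C} (hG0 : G ≠ 0)
    (hG : MvPolynomial.eval₂ (f : C →+* D) (fun o => o.elim l y) G ∈ P.toIdeal)
    {t : σ → T} (ht : ∀ i, t i ∈ 𝒯 (w i))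
    (hinj : Function.Injective (MvPolynomial.eval₂Hom (g : C →+* T) t))
    {Ω : Type*} [CommRing Ω] (u : T →+* Ω) (v : D →+* Ω) (huv : ∀ c, u (g c) = v (f c))
    (huvt : ∀ i, u (t i) = v (y i)) (hP : ∀ z ∈ P.toIdeal, v z = 0) :
    ∃ (d : Grade) (H : Polynomial T), H ≠ 0 ∧ (∀ n, H.coeff n ∈ 𝒯 (d - n • r)) ∧
      H.eval₂ u (v l) = 0 := by
  obtain ⟨d, G', hG'0, hG'd, hG'⟩ := exists_homogeneous_relation f P
    (w := fun o : Option σ => o.elim r w) (by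
      rintro (_ | i)
      · exact hl
      · exact hy i) hG0 hG
  -- The homogeneous relation is viewed as a polynomial in the variable `none`, and its coefficients
  -- are evaluated at `t`. Independence of the `t i` keeps the result nonzero.
  let ψ := MvPolynomial.eval₂Hom (g : C →+* T) t
  refine ⟨d, (MvPolynomial.optionEquivLeft C σ G').map ψ, ?_, fun n => ?_, ?_⟩
  · rw [Ne, Polynomial.map_eq_zero_iff hinj]
    exact fun h => hG'0 ((MvPolynomial.optionEquivLeft C σ).map_eq_zero_iff.1 h)
  · rw [Polynomial.coeff_map]
    set Q := (MvPolynomial.optionEquivLeft C σ G').coeff n with hQ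
    rw [← MvPolynomial.support_sum_monomial_coeff Q, map_sum]
    refine sum_mem fun μ _ => ?_
    have hw : Finsupp.weight (fun o : Option σ => o.elim r w) (μ.optionElim n) =
        n • r + Finsupp.weight w μ := by
      rw [Finsupp.weight_apply, Finsupp.weight_apply,
        Finsupp.sum_option_index _ (fun o c => c • o.elim r w) (fun _ => zero_nsmul _)
          (fun _ _ _ => add_nsmul _ _ _)]
      simp
    have h1 : g (Q.coeff μ) ∈ 𝒯 (d - (n • r + Finsupp.weight w μ)) := by
      rw [hQ, MvPolynomial.optionEquivLeft_coeff_coeff, ← hw]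
      exact g.map_mem (hG'd _)
    have h2 := SetLike.mul_mem_graded h1 (prod_pow_mem_grading ht μ)
    rw [show d - (n • r + Finsupp.weight w μ) + Finsupp.weight w μ = d - n • r by abel] at h2
    show MvPolynomial.eval₂ (g : C →+* T) t (MvPolynomial.monomial μ (Q.coeff μ)) ∈ _
    rw [MvPolynomial.eval₂_monomial]
    exact h2
  · have h : ((Polynomial.eval₂RingHom u (v l)).comp ((Polynomial.mapRingHom ψ).comp
        (MvPolynomial.optionEquivLeft C σ : MvPolynomial (Option σ) C →+* _))) =
        v.comp (MvPolynomial.eval₂Hom (f : C →+* D) (fun o => o.elim l y)) := by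
      refine MvPolynomial.ringHom_ext (fun c => ?_) ?_
      · simp [ψ, huv]
      · rintro (_ | i)
        · simp
        · simp [ψ, huvt]
    exact (RingHom.congr_fun h G').trans (hP _ hG')

end Homogenization

/-! ### Change of the base field -/

section BaseChange

variable {k K L E M : Type*} [NormedField k] [NormedField K] [NormedField L] [NormedField E]
variable [NormedField M] [NormedAlgebra k K] [NormedAlgebra k L] [NormedAlgebra E M]
variable [NormedAlgebra E L]

/-- The ring homomorphism `K ⊗[k] L → M ⊗[E] L` induced by `j : K → M` and `i : k → E`. -/
def NormedTensor.baseChange (i : k →+* E) (j : K →+* M)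
    (hM : ∀ c, algebraMap E M (i c) = j (algebraMap k K c))
    (hL : ∀ c, algebraMap E L (i c) = algebraMap k L c) :
    NormedTensor k K L →+* NormedTensor E M L :=
  letI : Algebra k (M ⊗[E] L) := ((algebraMap E (M ⊗[E] L)).comp i).toAlgebra
  (Algebra.TensorProduct.productMap (R := k)
    { (Algebra.TensorProduct.includeLeftRingHom : M →+* M ⊗[E] L).comp j with
      commutes' := fun c =>
        congrArg (Algebra.TensorProduct.includeLeftRingHom : M →+* M ⊗[E] L) (hM c).symm }
    { (Algebra.TensorProduct.includeRight : L →ₐ[E] M ⊗[E] L).toRingHom with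
      commutes' := fun c => (congrArg (Algebra.TensorProduct.includeRight : L →ₐ[E] M ⊗[E] L)
        (hL c).symm).trans (AlgHom.commutes _ _) }).toRingHom

theorem NormedTensor.baseChange_tmul (i : k →+* E) (j : K →+* M)
    (hM : ∀ c, algebraMap E M (i c) = j (algebraMap k K c))
    (hL : ∀ c, algebraMap E L (i c) = algebraMap k L c)
    (a : K) (b : L) :
    baseChange i j hM hL (tmul k a b) = tmul E (j a) b := by
  show (j a ⊗ₜ[E] (1 : L)) * ((1 : M) ⊗ₜ[E] b) = j a ⊗ₜ[E] b
  rw [Algebra.TensorProduct.tmul_mul_tmul, mul_one, one_mul]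

theorem NormedTensor.norm_baseChange_le (i : k →+* E) (j : K →+* M)
    (hM : ∀ c, algebraMap E M (i c) = j (algebraMap k K c))
    (hL : ∀ c, algebraMap E L (i c) = algebraMap k L c)
    (hj : ∀ a, ‖j a‖ ≤ ‖a‖) (z : NormedTensor k K L) :
    ‖baseChange i j hM hL z‖ ≤ ‖z‖ := by
  refine le_of_forall_gt_imp_ge_of_dense fun c hc => ?_
  obtain ⟨d, ⟨hd, l, rfl, hl⟩, hdc⟩ := exists_mem_bounds_lt hc
  refine (tensorNorm_le (c := d) ⟨hd, l.map fun p => (j p.1, p.2), ?_, ?_⟩).trans hdc.le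
  · clear hc hl
    induction l with
    | nil => exact (map_zero (baseChange i j hM hL)).symm
    | cons p l ih => rw [List.map_cons, ofList_cons, ofList_cons, map_add, baseChange_tmul, ih]
  · intro p hp
    obtain ⟨q, hq, rfl⟩ := List.mem_map.1 hp
    exact (mul_le_mul_of_nonneg_right (hj q.1) (norm_nonneg _)).trans (hl q hq)

/-- The restriction of a point of `ℳ(M ⊗̂[E] L)` to `K ⊗̂[k] L`. -/
theorem exists_comap_baseChange (i : k →+* E) (j : K →+* M)
    (hM : ∀ c, algebraMap E M (i c) = j (algebraMap k K c))
    (hL : ∀ c, algebraMap E L (i c) = algebraMap k L c)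
    (hj : ∀ a, ‖j a‖ ≤ ‖a‖)
    (x : BerkovichSpectrum (CompletedTensor E M L)) :
    ∃ y : BerkovichSpectrum (CompletedTensor k K L), ∀ f : NormedTensor k K L,
      y (f : CompletedTensor k K L) =
        x (NormedTensor.baseChange i j hM hL f : CompletedTensor E M L) := by
  have hbound := NormedTensor.norm_baseChange_le i j hM hL hj
  have hcont : Continuous (NormedTensor.baseChange i j hM hL) :=
    AddMonoidHomClass.continuous_of_bound _ 1 fun z => by simpa using hbound z
  let τ := UniformSpace.Completion.mapRingHom (NormedTensor.baseChange i j hM hL) hcont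
  have hτcoe : ∀ f : NormedTensor k K L, τ (f : CompletedTensor k K L) =
      (NormedTensor.baseChange i j hM hL f : CompletedTensor E M L) :=
    UniformSpace.Completion.mapRingHom_coe hcont
  have hτ : ∀ z, ‖τ z‖ ≤ ‖z‖ := by
    intro z
    induction z using UniformSpace.Completion.induction_on with
    | hp =>
      exact isClosed_le (continuous_norm.comp UniformSpace.Completion.continuous_map)
        continuous_norm
    | ih f =>
      rw [hτcoe, UniformSpace.Completion.norm_coe, UniformSpace.Completion.norm_coe]
      exact hbound f
  refine ⟨{ toFun := fun a => x (τ a)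
            map_zero' := by rw [map_zero]; exact map_zero x.toMulRingSeminorm
            map_one' := by rw [map_one]; exact map_one x.toMulRingSeminorm
            add_le' := fun a b => by rw [map_add]; exact map_add_le_add x.toMulRingSeminorm _ _
            neg' := fun a => by rw [map_neg]; exact map_neg_eq_map x.toMulRingSeminorm _
            map_mul' := fun a b => by rw [map_mul]; exact map_mul x.toMulRingSeminorm _ _
            bounded' := ⟨1, fun a => ?_⟩ }, fun f => ?_⟩
  · rw [one_mul]
    exact (x.le_norm _).trans (hτ a)
  · exact congrArg (fun z => x z) (hτcoe f)

variable [IsUltrametricDist k] [IsUltrametricDist K] [IsUltrametricDist L] [IsUltrametricDist E]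
variable [IsUltrametricDist M]

/-- A homogeneous prime ideal of `K̃ ⊗ L̃` that is cut out by homomorphisms to a domain factoring
through `M̃ ⊗ L̃` over `Ẽ`, where `L̃` is integral over `Ẽ`, is the reduction of a point. -/
theorem exists_tensorReductionMap_eq [Algebra.IsIntegral (GradedReduction E) (GradedReduction L)]
    (i : k →+* E) (j : K →+* M)
    (hM : ∀ c, algebraMap E M (i c) = j (algebraMap k K c))
    (hL : ∀ c, algebraMap E L (i c) = algebraMap k L c)
    (hj : ∀ a, ‖j a‖ ≤ ‖a‖) (P : HomogeneousSpectrum (ReductionTensor.grading k K L))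
    {Ω : Type*} [CommRing Ω] [IsDomain Ω] (φ : GradedReduction M →+* Ω)
    (θ : ReductionTensor k K L →+* Ω) (hθ : ∀ z, θ z = 0 ↔ z ∈ P.1.toIdeal)
    (hφK : ∀ c, φ (GradedReduction.map j hj c) = θ (c ⊗ₜ 1))
    (hφE : ∀ c : GradedReduction E, φ (algebraMap (GradedReduction E) (GradedReduction M) c) =
      θ (1 ⊗ₜ algebraMap (GradedReduction E) (GradedReduction L) c)) :
    ∃ x, tensorReductionMap k K L x = P := by
  let θL : GradedReduction L →+* Ω := θ.comp
    (Algebra.TensorProduct.includeRight : GradedReduction L →ₐ[GradedReduction k]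
      ReductionTensor k K L).toRingHom
  let _ : Algebra (GradedReduction E) Ω :=
    (φ.comp (algebraMap (GradedReduction E) (GradedReduction M))).toAlgebra
  let Θ : ReductionTensor E M L →+* Ω := (Algebra.TensorProduct.productMap (R := GradedReduction E)
    { φ with commutes' := fun _ => rfl }
    { θL with commutes' := fun c => (hφE c).symm }).toRingHom
  have hΘ : ∀ a b, Θ (a ⊗ₜ b) = φ a * θL b := fun a b => rfl
  have hprime : (RingHom.ker Θ).IsPrime := RingHom.ker_isPrime Θ
  -- `Ω` carries no grading, so the kernel of `Θ` need not be homogeneous; its homogeneous core is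
  -- prime and contains the same homogeneous elements.
  let Q : HomogeneousSpectrum (ReductionTensor.grading E M L) :=
    ⟨(RingHom.ker Θ).homogeneousCore _, hprime.homogeneousCore⟩
  obtain ⟨x, hx⟩ := tensorReductionMap_surjective_of_isIntegral Q
  obtain ⟨y, hy⟩ := exists_comap_baseChange i j hM hL hj x
  refine ⟨y, Subtype.ext (HomogeneousIdeal.ext' fun r z hz => ?_)⟩
  -- The base change of a lift `f` of `z` lifts some `z'` of the same degree with `Θ z' = θ z`.
  have key : ∀ p ∈ liftGroup k K L r, ∃ z', (NormedTensor.baseChange i j hM hL p.1, z') ∈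
      liftGroup E M L r ∧ Θ z' = θ p.2 := by
    intro p hp
    induction hp using AddSubgroup.closure_induction with
    | zero => exact ⟨0, by rw [Prod.fst_zero, map_zero]; exact zero_mem _, by simp⟩
    | add p q _ _ h₁ h₂ =>
      obtain ⟨z₁, hz₁, h₁⟩ := h₁
      obtain ⟨z₂, hz₂, h₂⟩ := h₂
      refine ⟨z₁ + z₂, ?_, by rw [map_add, h₁, h₂, Prod.snd_add, map_add]⟩
      rw [Prod.fst_add, map_add]
      exact add_mem hz₁ hz₂
    | neg p _ h₁ =>
      obtain ⟨z₁, hz₁, h₁⟩ := h₁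
      refine ⟨-z₁, ?_, by rw [map_neg, h₁, Prod.snd_neg, map_neg]⟩
      rw [Prod.fst_neg, map_neg]
      exact neg_mem hz₁
    | mem p hp =>
      obtain ⟨s, t, a, b, rfl, ha, hb, rfl⟩ := hp
      refine ⟨res M s (j a) ⊗ₜ res L t b, ?_, ?_⟩
      · rw [NormedTensor.baseChange_tmul]
        exact tmul_mem_liftGroup ((hj a).trans ha) hb
      · rw [hΘ, ← map_res j hj ha, hφK]
        show θ _ * θ (1 ⊗ₜ _) = θ _
        rw [← map_mul, Algebra.TensorProduct.tmul_mul_tmul, mul_one, one_mul]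
  obtain ⟨f, hf⟩ := exists_mem_liftGroup hz
  obtain ⟨z', hz', hzz'⟩ := key _ hf
  have hmem : z' ∈ ReductionTensor.grading E M L r := mem_grading_of_mem_liftGroup hz'
  have h1 : z' ∈ Q.1.toIdeal ↔ Θ z' = 0 :=
    ⟨fun h => Ideal.toIdeal_homogeneousCore_le _ (RingHom.ker Θ) h,
      fun h => Ideal.mem_homogeneousCore_of_homogeneous_of_mem ⟨r, hmem⟩ h⟩
  -- Since `y` is the restriction of `x`, membership of `z` in the reduction of `y` amounts to that
  -- of `z'` in `Q`, hence to `θ z = 0`, hence to `z ∈ P`.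
  have h2 := mem_tensorReductionMap_iff y hf
  rw [hy, ← mem_tensorReductionMap_iff x hz', hx, h1, hzz', hθ] at h2
  exact h2

end BaseChange

/-! ### Gauss norms and algebraically independent classes -/

section Gauss

variable {k F σ : Type*} [NormedField k] [IsUltrametricDist k] [NormedField F] [IsUltrametricDist F]

theorem Grade.exists_val_eq {x : ℝ} (hx : 0 < x) : ∃ r : Grade, r.val = x :=
  ⟨Additive.ofMul ⟨x, hx⟩, rfl⟩

theorem Grade.val_le_val {r s : Grade} : r.val ≤ s.val ↔ r ≤ s := Iff.rfl

theorem GradedReduction.res_prod_pow {z : σ → F} {w : σ → Grade} (hz : ∀ i, ‖z i‖ ≤ (w i).val)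
    (ν : σ →₀ ℕ) : ‖ν.prod fun i n => z i ^ n‖ ≤ (Finsupp.weight w ν).val ∧
      res F (Finsupp.weight w ν) (ν.prod fun i n => z i ^ n) =
        ν.prod fun i n => res F (w i) (z i) ^ n := by
  induction ν using Finsupp.induction_linear with
  | zero =>
    rw [Finsupp.prod_zero_index, Finsupp.prod_zero_index, map_zero, norm_one]
    exact ⟨le_rfl, res_one⟩
  | add f g hf hg =>
    rw [Finsupp.prod_add_index' (fun _ => pow_zero _) (fun _ _ _ => pow_add _ _ _),
      Finsupp.prod_add_index' (fun _ => pow_zero _) (fun _ _ _ => pow_add _ _ _), map_add,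
      res_mul hf.1 hg.1, hf.2, hg.2, norm_mul, Grade.val_add]
    exact ⟨mul_le_mul hf.1 hg.1 (norm_nonneg _) (Grade.val_pos _).le, rfl⟩
  | single i n =>
    rw [Finsupp.prod_single_index (h := fun i n => z i ^ n) (pow_zero _),
      Finsupp.prod_single_index (h := fun i n => res F (w i) (z i) ^ n) (pow_zero _),
      Finsupp.weight_single]
    induction n with
    | zero =>
      rw [pow_zero, pow_zero, zero_smul, norm_one]
      exact ⟨le_rfl, res_one⟩
    | succ n ih =>
      rw [pow_succ, pow_succ, succ_nsmul, res_mul ih.1 (hz i), ih.2, norm_mul, Grade.val_add]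
      exact ⟨mul_le_mul ih.1 (hz i) (norm_nonneg _) (Grade.val_pos _).le, rfl⟩

/-- The reduction of a polynomial in degree `d`, where the variable `i` has degree `w i`. -/
def polynomialRes (w : σ → Grade) (d : Grade) (f : MvPolynomial σ k) :
    MvPolynomial σ (GradedReduction k) :=
  ∑ ν ∈ f.support, MvPolynomial.monomial ν (res k (d - Finsupp.weight w ν) (f.coeff ν))

theorem coeff_polynomialRes (w : σ → Grade) (d : Grade) (f : MvPolynomial σ k) (ν : σ →₀ ℕ) :
    (polynomialRes w d f).coeff ν = res k (d - Finsupp.weight w ν) (f.coeff ν) := by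
  classical
  simp only [polynomialRes, MvPolynomial.coeff_sum, MvPolynomial.coeff_monomial]
  rw [Finset.sum_ite_eq' f.support ν]
  split_ifs with h
  · rfl
  · rw [MvPolynomial.notMem_support_iff.1 h, res_zero]

/-- A nonzero polynomial has a nonzero reduction in the degree of its Gauss norm. -/
theorem exists_polynomialRes_ne_zero (w : σ → Grade) {f : MvPolynomial σ k} (hf : f ≠ 0) :
    ∃ d : Grade, (∀ ν, ‖f.coeff ν‖ ≤ (d - Finsupp.weight w ν).val) ∧
      polynomialRes w d f ≠ 0 := by
  -- Norms of nonzero coefficients as degrees; the value outside the support is arbitrary. The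
  -- required `d` is the maximum of `g ν + Finsupp.weight w ν`, attained at `ν₀`, where the class is
  -- therefore nonzero.
  have hg : ∀ ν, ∃ r : Grade, ν ∈ f.support → r.val = ‖f.coeff ν‖ := fun ν => by
    by_cases h : ν ∈ f.support
    · obtain ⟨r, hr⟩ := Grade.exists_val_eq (norm_pos_iff.2 (MvPolynomial.mem_support_iff.1 h))
      exact ⟨r, fun _ => hr⟩
    · exact ⟨0, fun h' => absurd h' h⟩
  choose g hg using hg
  obtain ⟨ν₀, hν₀, hmax⟩ := Finset.exists_max_image f.support
    (fun ν => g ν + Finsupp.weight w ν) (MvPolynomial.support_nonempty.2 hf)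
  have hle : ∀ ν, ‖f.coeff ν‖ ≤ (g ν₀ + Finsupp.weight w ν₀ - Finsupp.weight w ν).val := by
    intro ν
    by_cases h : ν ∈ f.support
    · rw [← hg ν h, Grade.val_le_val]
      exact le_sub_iff_add_le.2 (hmax ν h)
    · rw [MvPolynomial.notMem_support_iff.1 h, norm_zero]
      exact (Grade.val_pos _).le
  refine ⟨g ν₀ + Finsupp.weight w ν₀, hle, fun h0 => ?_⟩
  have h1 := coeff_polynomialRes w (g ν₀ + Finsupp.weight w ν₀) f ν₀
  rw [h0, MvPolynomial.coeff_zero] at h1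
  have h2 := (res_eq_zero_iff (hle ν₀)).1 h1.symm
  rw [add_sub_cancel_right, hg ν₀ hν₀] at h2
  exact lt_irrefl _ h2

/-- Every monomial of `f` has norm at most `d.val` at `z`, so taking the class in degree `d`
commutes with the sum and then, factor by factor, with the products. -/
theorem res_eval₂ {ι : k →+* F} (hι : ∀ a, ‖ι a‖ ≤ ‖a‖) {z : σ → F} {w : σ → Grade}
    (hz : ∀ i, ‖z i‖ ≤ (w i).val) {f : MvPolynomial σ k} {d : Grade}
    (hf : ∀ ν, ‖f.coeff ν‖ ≤ (d - Finsupp.weight w ν).val) :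
    ‖f.eval₂ ι z‖ ≤ d.val ∧ res F d (f.eval₂ ι z) =
      (polynomialRes w d f).eval₂ (GradedReduction.map ι hι : GradedReduction k →+* _)
        fun i => res F (w i) (z i) := by
  have hterm : ∀ ν, ‖ι (f.coeff ν) * ν.prod fun i n => z i ^ n‖ ≤ d.val := fun ν => by
    have h := mul_le_mul ((hι _).trans (hf ν)) (res_prod_pow hz ν).1 (norm_nonneg _)
      (Grade.val_pos _).le
    rwa [← norm_mul, ← Grade.val_add, sub_add_cancel] at h
  have heq : f.eval₂ ι z = ∑ ν ∈ f.support, ι (f.coeff ν) * ν.prod fun i n => z i ^ n :=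
    MvPolynomial.eval₂_eq ..
  rw [heq]
  refine ⟨norm_sum_le _ _ d.val_pos.le fun ν _ => hterm ν, ?_⟩
  rw [res_sum _ _ fun ν _ => hterm ν, polynomialRes, MvPolynomial.eval₂_sum]
  refine Finset.sum_congr rfl fun ν _ => ?_
  have h := res_mul ((hι _).trans (hf ν)) (res_prod_pow hz ν).1
  rw [sub_add_cancel, (res_prod_pow hz ν).2] at h
  rw [MvPolynomial.eval₂_monomial, h]
  congr 1
  exact (map_res ι hι (hf ν)).symm

/-- Elements whose classes are algebraically independent are orthogonal: the norm of a polynomial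
in them is its Gauss norm. -/
theorem norm_eval₂_eq {ι : k →+* F} (hι : ∀ a, ‖ι a‖ ≤ ‖a‖) {z : σ → F} {w : σ → Grade}
    (hz : ∀ i, ‖z i‖ ≤ (w i).val)
    (hinj : Function.Injective (MvPolynomial.eval₂Hom
      (GradedReduction.map ι hι : GradedReduction k →+* _) fun i => res F (w i) (z i)))
    {f : MvPolynomial σ k} {d : Grade}
    (hf : ∀ ν, ‖f.coeff ν‖ ≤ (d - Finsupp.weight w ν).val) (hf0 : polynomialRes w d f ≠ 0) :
    ‖f.eval₂ ι z‖ = d.val := by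
  obtain ⟨h1, h2⟩ := res_eval₂ hι hz hf
  refine h1.antisymm (not_lt.1 fun h => hf0 (hinj ?_))
  rw [map_zero]
  exact h2.symm.trans ((res_eq_zero_iff h1).2 h)

theorem eval₂_ne_zero {ι : k →+* F} (hι : ∀ a, ‖ι a‖ ≤ ‖a‖) {z : σ → F} {w : σ → Grade}
    (hz : ∀ i, ‖z i‖ ≤ (w i).val)
    (hinj : Function.Injective (MvPolynomial.eval₂Hom
      (GradedReduction.map ι hι : GradedReduction k →+* _) fun i => res F (w i) (z i)))
    {f : MvPolynomial σ k} (hf : f ≠ 0) : f.eval₂ ι z ≠ 0 := by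
  obtain ⟨d, hd, hd0⟩ := exists_polynomialRes_ne_zero w hf
  rw [← norm_pos_iff, norm_eval₂_eq hι hz hinj hd hd0]
  exact d.val_pos

theorem GradedReduction.res_eq_zero_of_lt {r : Grade} {a : F} (h : ‖a‖ < r.val) : res F r a = 0 :=
  (res_eq_zero_iff h.le).2 h

variable {M : Type*} [NormedField M] [IsUltrametricDist M]

/-- Two systems of elements of `F` and `M` whose classes correspond to each other in a common ring,
and are algebraically independent, generate isometric rings with the same reduction. -/
theorem gauss_transfer {ι : k →+* F} (hι : ∀ a, ‖ι a‖ ≤ ‖a‖) {κ : k →+* M}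
    (hκ : ∀ a, ‖κ a‖ ≤ ‖a‖) {z : σ → F} {m : σ → M} {w : σ → Grade}
    (hz : ∀ i, ‖z i‖ ≤ (w i).val) (hm : ∀ i, ‖m i‖ ≤ (w i).val)
    (hinj : Function.Injective (MvPolynomial.eval₂Hom
      (GradedReduction.map ι hι : GradedReduction k →+* _) fun i => res F (w i) (z i)))
    {Ω : Type*} [CommRing Ω] (u : GradedReduction F →+* Ω) (hu : Function.Injective u)
    (φ : GradedReduction M →+* Ω)
    (huφ : ∀ c, u (GradedReduction.map ι hι c) = φ (GradedReduction.map κ hκ c))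
    (hzm : ∀ i, u (res F (w i) (z i)) = φ (res M (w i) (m i))) (f : MvPolynomial σ k) :
    ‖f.eval₂ ι z‖ = ‖f.eval₂ κ m‖ ∧ ∀ d : Grade, ‖f.eval₂ ι z‖ ≤ d.val →
      u (res F d (f.eval₂ ι z)) = φ (res M d (f.eval₂ κ m)) := by
  by_cases hf : f = 0
  · simp [hf, res_zero]
  have hcomm : ∀ p, u (MvPolynomial.eval₂Hom (GradedReduction.map ι hι : GradedReduction k →+* _)
      (fun i => res F (w i) (z i)) p) =
      φ (MvPolynomial.eval₂Hom (GradedReduction.map κ hκ : GradedReduction k →+* _)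
      (fun i => res M (w i) (m i)) p) := by
    refine RingHom.congr_fun (f := u.comp _) (g := φ.comp _)
      (MvPolynomial.ringHom_ext (fun c => ?_) fun i => ?_)
    · simpa using huφ c
    · simpa using hzm i
  -- Independence passes from the classes of `z` to those of `m`, because `u` is injective and both
  -- systems have the same images in `Ω`. Hence both norms equal the Gauss norm.
  have hinj' : Function.Injective (MvPolynomial.eval₂Hom
      (GradedReduction.map κ hκ : GradedReduction k →+* _) fun i => res M (w i) (m i)) :=
    fun p q h => hinj (hu ((hcomm p).trans ((congrArg φ h).trans (hcomm q).symm)))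
  obtain ⟨d₀, hd₀, hd₀'⟩ := exists_polynomialRes_ne_zero w hf
  have hF := norm_eval₂_eq hι hz hinj hd₀ hd₀'
  have hM := norm_eval₂_eq hκ hm hinj' hd₀ hd₀'
  refine ⟨hF.trans hM.symm, fun d hd => ?_⟩
  -- In degrees above the norm both classes are zero; in the degree of the norm both are values of
  -- the reduced polynomial.
  rcases hd.lt_or_eq with hlt | heq
  · rw [res_eq_zero_of_lt hlt, res_eq_zero_of_lt (by rwa [hM, ← hF]), map_zero, map_zero]
  · obtain rfl : d₀ = d := le_antisymm (Grade.val_le_val.1 (hF.symm.trans heq).le)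
      (Grade.val_le_val.1 (hF.symm.trans heq).ge)
    rw [(res_eval₂ hι hz hd₀).2, (res_eval₂ hκ hm hd₀).2]
    exact hcomm _

/-- `gauss_transfer` for the fields generated. -/
theorem gauss_transfer_div {k : Type*} [NormedField k] {ι : k →+* F} {κ : k →+* M} {z : σ → F} {m : σ → M}
    {Ω : Type*} [CommRing Ω] [IsDomain Ω] (u : GradedReduction F →+* Ω)
    (hu : Function.Injective u) (φ : GradedReduction M →+* Ω)
    (h : ∀ f : MvPolynomial σ k, ‖f.eval₂ ι z‖ = ‖f.eval₂ κ m‖ ∧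
      ∀ d : Grade, ‖f.eval₂ ι z‖ ≤ d.val →
        u (res F d (f.eval₂ ι z)) = φ (res M d (f.eval₂ κ m)))
    (f g : MvPolynomial σ k) (hg : g.eval₂ ι z ≠ 0) :
    ‖f.eval₂ ι z / g.eval₂ ι z‖ = ‖f.eval₂ κ m / g.eval₂ κ m‖ ∧
      ∀ d : Grade, ‖f.eval₂ ι z / g.eval₂ ι z‖ ≤ d.val →
        u (res F d (f.eval₂ ι z / g.eval₂ ι z)) = φ (res M d (f.eval₂ κ m / g.eval₂ κ m)) := by
  have hn : ‖f.eval₂ ι z / g.eval₂ ι z‖ = ‖f.eval₂ κ m / g.eval₂ κ m‖ := by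
    rw [norm_div, norm_div, (h f).1, (h g).1]
  refine ⟨hn, fun d hd => ?_⟩
  have hg' : g.eval₂ κ m ≠ 0 := by
    rwa [← norm_ne_zero_iff, ← (h g).1, norm_ne_zero_iff]
  -- In the degree of its own norm the denominator has a nonzero class. The comparison for
  -- numerators is the comparison for quotients multiplied by the image of this class, which can be
  -- cancelled in the domain `Ω`.
  obtain ⟨e, he⟩ := Grade.exists_val_eq (norm_pos_iff.2 hg)
  have h1 := res_mul hd he.ge
  have h2 := res_mul (hn.symm.trans_le hd) ((h g).1.symm.trans he.symm).le
  have h3 : ‖f.eval₂ ι z‖ ≤ (d + e).val := by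
    rw [norm_div, div_le_iff₀ (norm_pos_iff.2 hg), ← he] at hd
    exact hd
  rw [div_mul_cancel₀ _ hg] at h1
  rw [div_mul_cancel₀ _ hg'] at h2
  have h4 := (h f).2 _ h3
  rw [h1, h2, map_mul, map_mul, (h g).2 e he.ge] at h4
  refine mul_right_cancel₀ ?_ h4
  rw [← (h g).2 e he.ge, map_ne_zero_iff u hu, Ne, res_eq_zero_iff he.ge, not_lt]
  exact he.le

end Gauss

/-! ### Homogeneous transcendence bases and integrality -/

section Transcendence

theorem exists_isTranscendenceBasis_of_adjoin_eq_top {C A : Type*} [CommRing C] [Nontrivial C]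
    [CommRing A] [IsDomain A] [Algebra C A] (hinj : Function.Injective (algebraMap C A)) {s : Set A}
    (hs : ∀ a, a ∈ Algebra.adjoin C s) :
    ∃ t ⊆ s, IsTranscendenceBasis C (Subtype.val : t → A) := by
  have : FaithfulSMul C A := (faithfulSMul_iff_algebraMap_injective C A).2 hinj
  have : Algebra.IsAlgebraic (Algebra.adjoin C s) A :=
    ⟨fun a => isAlgebraic_algebraMap (⟨a, hs a⟩ : Algebra.adjoin C s)⟩
  exact exists_isTranscendenceBasis_subset s

/-- The element `a` is algebraic over the algebra generated by `x`, so the family `x` enlarged by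
`a` is no longer independent. -/
theorem IsTranscendenceBasis.exists_relation {ι C A : Type*} [CommRing C] [Nontrivial C]
    [CommRing A] [Algebra C A] {x : ι → A} (hx : IsTranscendenceBasis C x) (a : A) :
    ∃ G : MvPolynomial (Option ι) C, G ≠ 0 ∧
      MvPolynomial.aeval (fun o : Option ι => o.elim a x) G = 0 := by
  have halg := hx.isAlgebraic.isAlgebraic a
  have h : ¬ AlgebraicIndependent C fun o : Option ι => o.elim a x := fun h =>
    (hx.1.option_iff_transcendental a).1 h halg
  rw [algebraicIndependent_iff] at h
  push Not at h
  obtain ⟨G, h1, h2⟩ := h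
  exact ⟨G, h2, h1⟩

variable {k E L σ : Type*} [NormedField k] [IsUltrametricDist k] [NormedField E]
variable [IsUltrametricDist E] [NormedField L] [IsUltrametricDist L] [NormedAlgebra k L]
variable [NormedAlgebra E L]

/-- `L̃` is integral over the reduction of a field containing lifts of a homogeneous transcendence
basis. -/
theorem isIntegral_of_isTranscendenceBasis (i : k →+* E) (hi : ∀ c, ‖i c‖ ≤ ‖c‖)
    (hiL : ∀ c, algebraMap E L (i c) = algebraMap k L c) {t : σ → E} {w : σ → Grade}
    (ht : ∀ y, ‖t y‖ ≤ (w y).val)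
    (hb : IsTranscendenceBasis (GradedReduction k) fun y => res L (w y) (algebraMap E L (t y))) :
    Algebra.IsIntegral (GradedReduction E) (GradedReduction L) := by
  classical
  have hmap : ∀ c, algebraMap (GradedReduction E) (GradedReduction L) (GradedReduction.map i hi c) =
      algebraMap (GradedReduction k) (GradedReduction L) c := by
    intro c
    refine (GradedReduction.map_map i hi (algebraMap E L)
      (fun a => (norm_algebraMap' L a).le) c).trans ?_
    show _ = GradedReduction.map (algebraMap k L) (fun a => (norm_algebraMap' L a).le) c
    congr 2
    exact RingHom.ext hiL
  have htL : ∀ y, algebraMap (GradedReduction E) (GradedReduction L) (res E (w y) (t y)) =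
      res L (w y) (algebraMap E L (t y)) := fun y => algebraMap_res (ht y)
  -- A relation between the classes in `Ẽ` would map to one between their images in `L̃`.
  have hinj : Function.Injective (MvPolynomial.eval₂Hom
      (GradedReduction.map i hi : GradedReduction k →+* _) fun y => res E (w y) (t y)) := by
    have hcomm : ∀ p, algebraMap (GradedReduction E) (GradedReduction L)
        (MvPolynomial.eval₂Hom (GradedReduction.map i hi : GradedReduction k →+* _)
          (fun y => res E (w y) (t y)) p) =
        MvPolynomial.aeval (R := GradedReduction k)
          (fun y => res L (w y) (algebraMap E L (t y))) p := by
      refine RingHom.congr_fun (f := (algebraMap (GradedReduction E) (GradedReduction L)).comp _)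
        (g := AlgHom.toRingHom _)
        (MvPolynomial.ringHom_ext (fun c => ?_) fun y => ?_)
      · simpa using hmap c
      · simpa using htL y
    exact fun p q h => hb.1 ((hcomm p).symm.trans ((congrArg _ h).trans (hcomm q)))
  have hom : ∀ {r : Grade} (l : GradedReduction L), l ∈ grading L r →
      IsIntegral (GradedReduction E) l := by
    intro r l hl
    obtain ⟨G, hG0, hG⟩ := IsTranscendenceBasis.exists_relation hb l
    obtain ⟨d, H, hH0, hH, hHl⟩ := exists_homogeneous_polynomial
      (GradedReduction.map (algebraMap k L) fun a => (norm_algebraMap' L a).le)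
      (GradedReduction.map i hi) (⊥ : HomogeneousIdeal (grading L))
      (y := fun y => res L (w y) (algebraMap E L (t y))) (fun y => res_mem _ _) hl hG0
      (by
        rw [HomogeneousIdeal.toIdeal_bot]
        exact hG) (t := fun y => res E (w y) (t y)) (fun y => res_mem _ _) hinj
      (algebraMap (GradedReduction E) (GradedReduction L)) (RingHom.id _) hmap htL
      (fun z hz => hz)
    -- The equation of `l` over `Ẽ` is homogeneous, so its leading coefficient is homogeneous and
    -- nonzero, hence invertible. This turns algebraic into integral.
    obtain ⟨e, he, he'⟩ := GradedReduction.exists_mul_eq_one (hH H.natDegree)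
      (Polynomial.leadingCoeff_ne_zero.2 hH0)
    refine ⟨Polynomial.C e * H, ?_, ?_⟩
    · refine Polynomial.monic_C_mul_of_mul_leadingCoeff_eq_one ?_
      rwa [mul_comm]
    · rw [Polynomial.eval₂_mul]
      exact mul_eq_zero_of_right _ hHl
  refine ⟨fun l => ?_⟩
  rw [← DirectSum.sum_support_decompose (grading L) l]
  exact IsIntegral.sum _ fun r _ => hom _ (SetLike.coe_mem _)

end Transcendence

/-! ### Construction of the intermediate field `E` -/

section Descent

theorem GradedReduction.ringHom_ext {F S : Type*} [NormedField F] [IsUltrametricDist F] [Semiring S]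
    {f g : GradedReduction F →+* S} (h : ∀ r a, ‖a‖ ≤ r.val → f (res F r a) = g (res F r a)) :
    f = g := by
  refine RingHom.ext fun z => ?_
  induction z using DirectSum.Decomposition.inductionOn (grading F) with
  | zero => rw [map_zero, map_zero]
  | homogeneous m =>
    obtain ⟨a, ha, h'⟩ := exists_res m.2
    rw [← h', h _ _ ha]
  | add a b ha hb => rw [map_add, map_add, ha, hb]

theorem GradedReduction.mem_adjoin_homogeneous {F : Type*} [NormedField F] [IsUltrametricDist F]
    (C : Type*) [CommRing C] [Algebra C (GradedReduction F)] (z : GradedReduction F) :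
    z ∈ Algebra.adjoin C {l : GradedReduction F | ∃ r, l ∈ grading F r} := by
  induction z using DirectSum.Decomposition.inductionOn (grading F) with
  | zero => exact zero_mem _
  | homogeneous m => exact Algebra.subset_adjoin ⟨_, m.2⟩
  | add a b ha hb => exact add_mem ha hb

variable {k K L M : Type*} [NormedField k] [NormedField K] [NormedField L] [NormedField M]
variable [NormedAlgebra k K] [NormedAlgebra k L]
variable [IsUltrametricDist k] [IsUltrametricDist K] [IsUltrametricDist L] [IsUltrametricDist M]

/-- The contraction of `P` to the graded field `L̃` is a proper homogeneous ideal, hence zero. -/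
theorem injective_comp_includeRight (P : HomogeneousSpectrum (ReductionTensor.grading k K L))
    {Ω : Type*} [CommRing Ω] (θ : ReductionTensor k K L →+* Ω)
    (hθ : ∀ z, θ z = 0 ↔ z ∈ P.1.toIdeal) :
    Function.Injective (θ.comp (Algebra.TensorProduct.includeRight :
      GradedReduction L →ₐ[GradedReduction k] ReductionTensor k K L).toRingHom) := by
  have hP := P.2
  have h := GradedReduction.homogeneousIdeal_eq_bot
    (P.1.comap (tensorInclRight (GradedReduction k) (grading K) (grading L)))
    (Ideal.comap_ne_top _ hP.ne_top)
  refine (injective_iff_map_eq_zero _).2 fun l hl => ?_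
  rw [← Ideal.mem_bot, ← h]
  exact (hθ _).1 hl

/-- A homogeneous prime ideal of `K̃ ⊗ L̃` that is cut out by a homomorphism `K̃ ⊗ L̃ → Ω` whose
restriction to `K̃` extends to `M̃`, in such a way that the image of `M̃` contains that of `L̃`, is the
reduction of a point. -/
theorem exists_tensorReductionMap_eq_of_lift (j : K →+* M) (hj : ∀ a, ‖j a‖ ≤ ‖a‖)
    (P : HomogeneousSpectrum (ReductionTensor.grading k K L))
    {Ω : Type*} [CommRing Ω] [IsDomain Ω] (φ : GradedReduction M →+* Ω)
    (θ : ReductionTensor k K L →+* Ω) (hθ : ∀ z, θ z = 0 ↔ z ∈ P.1.toIdeal)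
    (hφK : ∀ c, φ (GradedReduction.map j hj c) = θ (c ⊗ₜ 1))
    (hφL : ∀ r, ∀ l ∈ grading L r, ∃ m : M, ‖m‖ ≤ r.val ∧ φ (res M r m) = θ (1 ⊗ₜ l)) :
    ∃ x, tensorReductionMap k K L x = P := by
  let u : GradedReduction L →+* Ω := θ.comp (Algebra.TensorProduct.includeRight :
      GradedReduction L →ₐ[GradedReduction k] ReductionTensor k K L).toRingHom
  have hu : Function.Injective u := injective_comp_includeRight P θ hθ
  have hιL : ∀ a : k, ‖algebraMap k L a‖ ≤ ‖a‖ := fun a => (norm_algebraMap' L a).le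
  let κ : k →+* M := j.comp (algebraMap k K)
  have hκ : ∀ a, ‖κ a‖ ≤ ‖a‖ := fun a => (hj _).trans (norm_algebraMap' K a).le
  have huφ : ∀ c, u (GradedReduction.map (algebraMap k L) hιL c) =
      φ (GradedReduction.map κ hκ c) := by
    intro c
    have h1 : u (GradedReduction.map (algebraMap k L) hιL c) =
        θ (algebraMap (GradedReduction k) (GradedReduction K) c ⊗ₜ 1) :=
      congrArg θ (Algebra.TensorProduct.tmul_one_eq_one_tmul c).symm
    rw [h1, ← hφK]
    exact congrArg φ (GradedReduction.map_map (algebraMap k K)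
      (fun a => (norm_algebraMap' K a).le) j hj c)
  obtain ⟨Y, hY, hb⟩ := exists_isTranscendenceBasis_of_adjoin_eq_top
    (GradedReduction.gradedHom_injective (GradedReduction.map (algebraMap k L) hιL))
    (GradedReduction.mem_adjoin_homogeneous (GradedReduction k) (F := L))
  choose w hw using fun y : Y => hY y.2
  -- Each basis element is lifted twice, to `z y` in `L` and to `m y` in `M`, in such a way that the
  -- two classes have the same image in `Ω`.
  choose z hz hzy using fun y : Y => exists_res (hw y)
  choose m hm hmy using fun y : Y => hφL (w y) y.1 (hw y)
  have hb' : IsTranscendenceBasis (GradedReduction k) fun y : Y => res L (w y) (z y) := by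
    rwa [show (fun y : Y => res L (w y) (z y)) = Subtype.val from funext hzy]
  have hinj : Function.Injective (MvPolynomial.eval₂Hom
      (GradedReduction.map (algebraMap k L) hιL : GradedReduction k →+* _)
      fun y : Y => res L (w y) (z y)) := hb'.1
  have gauss := gauss_transfer hιL hκ hz hm hinj u hu φ huφ
    fun y => by rw [hzy, hmy]; rfl
  have hne : ∀ f : MvPolynomial Y k, f ≠ 0 → f.eval₂ (algebraMap k L) z ≠ 0 :=
    fun f hf => eval₂_ne_zero hιL hz hinj hf
  have hLinj : Function.Injective (MvPolynomial.eval₂Hom (algebraMap k L) z) :=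
    (injective_iff_map_eq_zero _).2 fun f hf => by_contra fun h => hne f h hf
  have hMinj : Function.Injective (MvPolynomial.eval₂Hom κ m) :=
    (injective_iff_map_eq_zero _).2 fun f hf => by_contra fun h => hne f h (by
      rw [← norm_eq_zero, (gauss f).1, norm_eq_zero]
      exact hf)
  -- The rational function field embeds into `L` by `z` and into `M` by `m`, and by `gauss` the two
  -- embeddings induce the same norm. `E` is the image in `L`, and `jE` makes `M` a normed extension
  -- of it.
  let E₀ := FractionRing (MvPolynomial Y k)
  let iL : E₀ →+* L := IsFractionRing.lift hLinj
  let iM : E₀ →+* M := IsFractionRing.lift hMinj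
  have hiL : ∀ f : MvPolynomial Y k, iL (algebraMap _ E₀ f) = f.eval₂ (algebraMap k L) z :=
    fun f => IsFractionRing.lift_algebraMap hLinj f
  have hiM : ∀ f : MvPolynomial Y k, iM (algebraMap _ E₀ f) = f.eval₂ κ m :=
    fun f => IsFractionRing.lift_algebraMap hMinj f
  have hdiv : ∀ e : E₀, ‖iL e‖ = ‖iM e‖ ∧ ∀ d : Grade, ‖iL e‖ ≤ d.val →
      u (res L d (iL e)) = φ (res M d (iM e)) := by
    intro e
    obtain ⟨f, g, hg, rfl⟩ := IsFractionRing.div_surjective (A := MvPolynomial Y k) e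
    rw [map_div₀, map_div₀, hiL, hiL, hiM, hiM]
    exact gauss_transfer_div u hu φ gauss f g (hne g (nonZeroDivisors.ne_zero hg))
  let E : Subfield L := iL.fieldRange
  let e : E₀ ≃+* E := iL.rangeRestrictFieldEquiv
  have he : ∀ a : E, iL (e.symm a) = a := iL.rangeRestrictFieldEquiv_apply_symm_apply
  let jE : E →+* M := iM.comp e.symm.toRingHom
  have hjE : ∀ a : E, ‖jE a‖ = ‖a‖ := fun a =>
    (hdiv (e.symm a)).1.symm.trans (congrArg norm (he a))
  have : IsUltrametricDist E :=
    IsUltrametricDist.isUltrametricDist_of_forall_norm_add_le_max_norm fun a b =>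
      IsUltrametricDist.norm_add_le_max (a : L) b
  let _ : NormedAlgebra E L :=
    { (inferInstance : Algebra E L) with
      norm_smul_le := fun a b => (norm_mul (a : L) b).le }
  let _ : NormedAlgebra E M :=
    { jE.toAlgebra with
      norm_smul_le := fun a b => ((norm_mul (jE a) b).trans (by rw [hjE])).le }
  let i : k →+* E := e.toRingHom.comp ((algebraMap (MvPolynomial Y k) E₀).comp MvPolynomial.C)
  have hiL' : ∀ c, algebraMap E L (i c) = algebraMap k L c := fun c =>
    (hiL (MvPolynomial.C c)).trans (MvPolynomial.eval₂_C _ _ _)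
  have hiM' : ∀ c, algebraMap E M (i c) = j (algebraMap k K c) := fun c =>
    (congrArg iM (e.symm_apply_apply _)).trans
      ((hiM (MvPolynomial.C c)).trans (MvPolynomial.eval₂_C _ _ _))
  let t : Y → E := fun y => e (algebraMap (MvPolynomial Y k) E₀ (MvPolynomial.X y))
  have ht : ∀ y, algebraMap E L (t y) = z y := fun y =>
    (hiL (MvPolynomial.X y)).trans (MvPolynomial.eval₂_X _ _ _)
  have hi : ∀ c, ‖i c‖ ≤ ‖c‖ := fun c => (congrArg norm (hiL' c)).trans_le (hιL c)
  have : Algebra.IsIntegral (GradedReduction E) (GradedReduction L) :=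
    isIntegral_of_isTranscendenceBasis i hi hiL' (t := t) (w := w)
      (fun y => (congrArg norm (ht y)).trans_le (hz y)) (by simpa only [ht] using hb')
  -- What remains is that the two maps `Ẽ → Ω`, through `M̃` and through `L̃`, coincide; this is the
  -- comparison of classes in `hdiv`.
  refine exists_tensorReductionMap_eq i j hiM' hiL' hj P φ θ hθ hφK fun c => ?_
  refine RingHom.congr_fun (f := φ.comp (algebraMap _ _)) (g := u.comp (algebraMap _ _))
    (GradedReduction.ringHom_ext fun r a ha => ?_) c
  rw [RingHom.comp_apply, RingHom.comp_apply, algebraMap_res ha, algebraMap_res ha]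
  have h := (hdiv (e.symm a)).2 r ((congrArg norm (he a)).trans_le ha)
  rw [he] at h
  exact h.symm

end Descent

/-! ### Gluing `M̃` and `(K̃ ⊗ L̃)/P`, and surjectivity -/

section Surjective

variable {k K L M : Type*} [NormedField k] [NormedField K] [NormedField L] [NormedField M]
variable [NormedAlgebra k K] [NormedAlgebra k L]
variable [IsUltrametricDist k] [IsUltrametricDist K] [IsUltrametricDist L] [IsUltrametricDist M]

theorem mem_adjoin_quotient (I : Ideal (ReductionTensor k K L)) (z : ReductionTensor k K L ⧸ I) :
    z ∈ Algebra.adjoin (GradedReduction K) {a : ReductionTensor k K L ⧸ I |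
      ∃ r, ∃ l ∈ grading L r, Ideal.Quotient.mk I (1 ⊗ₜ l) = a} := by
  obtain ⟨z, rfl⟩ := Ideal.Quotient.mk_surjective z
  induction z using TensorProduct.induction_on with
  | zero => rw [map_zero]; exact zero_mem _
  | add a b ha hb => rw [map_add]; exact add_mem ha hb
  | tmul a b =>
    have h1 : a ⊗ₜ[GradedReduction k] b = (a ⊗ₜ 1) * (1 ⊗ₜ b) := by
      rw [Algebra.TensorProduct.tmul_mul_tmul, mul_one, one_mul]
    rw [h1, map_mul]
    clear h1
    refine mul_mem (Subalgebra.algebraMap_mem (Algebra.adjoin (GradedReduction K) _) a) ?_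
    induction b using DirectSum.Decomposition.inductionOn (grading L) with
    | zero => rw [TensorProduct.tmul_zero, map_zero]; exact zero_mem _
    | homogeneous m => exact Algebra.subset_adjoin ⟨_, m.1, m.2, rfl⟩
    | add a b ha hb => rw [TensorProduct.tmul_add, map_add]; exact add_mem ha hb

/-- A homogeneous prime ideal of `K̃ ⊗ L̃` containing the kernel of a graded homomorphism to the
reduction of an algebraically closed extension of `K` is the reduction of a point. -/
theorem exists_tensorReductionMap_eq_of_ker_le [IsAlgClosed M] (j : K →+* M)
    (hj : ∀ a, ‖j a‖ ≤ ‖a‖) (P : HomogeneousSpectrum (ReductionTensor.grading k K L))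
    (ι : ReductionTensor k K L →+* GradedReduction M)
    (hιP : ∀ z, ι z = 0 → z ∈ P.1.toIdeal)
    (hιK : ∀ c, ι (c ⊗ₜ 1) = GradedReduction.map j hj c)
    (hιL : ∀ r, ∀ l ∈ grading L r, ι (1 ⊗ₜ l) ∈ grading M r) :
    ∃ x, tensorReductionMap k K L x = P := by
  have hP := P.2
  let D := ReductionTensor k K L ⧸ P.1.toIdeal
  let q : ReductionTensor k K L →+* D := Ideal.Quotient.mk _
  have hq : ∀ z, q z = 0 ↔ z ∈ P.1.toIdeal := fun z => Ideal.Quotient.eq_zero_iff_mem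
  have hKD : Function.Injective (algebraMap (GradedReduction K) D) :=
    (injective_iff_map_eq_zero _).2 fun c hc => by
      rw [← Ideal.mem_bot, ← comap_inclLeft_eq_bot P]
      exact (hq _).1 hc
  -- The basis is taken among the images of homogeneous elements of `L̃`, which generate the
  -- quotient over `K̃`.
  obtain ⟨Y, hY, hb⟩ := exists_isTranscendenceBasis_of_adjoin_eq_top hKD
    (mem_adjoin_quotient P.1.toIdeal)
  choose w l hl hly using fun y : Y => hY y.2
  let g₁ : MvPolynomial Y (GradedReduction K) →+* GradedReduction M :=
    MvPolynomial.eval₂Hom (GradedReduction.map j hj : GradedReduction K →+* _)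
      fun y => ι (1 ⊗ₜ l y)
  let g₂ : MvPolynomial Y (GradedReduction K) →+* D :=
    (MvPolynomial.aeval (Subtype.val : Y → D)).toRingHom
  have hg₂ : Function.Injective g₂ := hb.1
  let g : MvPolynomial Y (GradedReduction K) →+* ReductionTensor k K L :=
    MvPolynomial.eval₂Hom (algebraMap _ _) fun y => 1 ⊗ₜ l y
  have hg1 : ∀ p, ι (g p) = g₁ p := by
    refine RingHom.congr_fun (f := ι.comp g) (MvPolynomial.ringHom_ext (fun c => ?_) fun y => ?_)
    · simpa [g, g₁] using hιK c
    · simp [g, g₁]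
  have hg2 : ∀ p, q (g p) = g₂ p := by
    refine RingHom.congr_fun (f := q.comp g) (MvPolynomial.ringHom_ext (fun c => ?_) fun y => ?_)
    · simp [g, g₂]
      rfl
    · simpa [g, g₂] using hly y
  -- A relation in `M̃` comes from an element of `ker ι`, which lies in `P`, and so is a relation in
  -- the quotient, where the basis is independent.
  have hg₁ : Function.Injective g₁ := (injective_iff_map_eq_zero _).2 fun p hp => hg₂ (by
    rw [map_zero, ← hg2, hq]
    exact hιP _ ((hg1 p).trans hp))
  obtain ⟨Ω, _, u, v, -, hv, huv⟩ := exists_compositum g₁ g₂ hg₁ hg₂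
  have huv' : ∀ p, u (g₁ p) = v (g₂ p) := RingHom.congr_fun huv
  have huK : ∀ c, u (GradedReduction.map j hj c) = v (q (c ⊗ₜ 1)) := fun c => by
    have h := huv' (MvPolynomial.C c)
    rw [← hg2, ← hg1, show g (MvPolynomial.C c) = c ⊗ₜ 1 from MvPolynomial.eval₂_C _ _ _,
      hιK] at h
    exact h
  have huL : ∀ y, u (ι (1 ⊗ₜ l y)) = v (q (1 ⊗ₜ l y)) := fun y => by
    have h := huv' (MvPolynomial.X y)
    rwa [← hg2, ← hg1, show g (MvPolynomial.X y) = 1 ⊗ₜ l y from MvPolynomial.eval₂_X _ _ _] at h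
  refine exists_tensorReductionMap_eq_of_lift j hj P u (v.comp q)
    (fun z => (map_eq_zero_iff v hv).trans (hq z)) huK fun r a ha => ?_
  -- In `Ω` the image of `a` is algebraic over the basis, hence the root of a homogeneous polynomial
  -- over `M̃`; as `M` is algebraically closed, it comes from an element of `M`.
  obtain ⟨G, hG0, hG⟩ := IsTranscendenceBasis.exists_relation hb (q (1 ⊗ₜ a))
  obtain ⟨d, H, hH0, hH, hHa⟩ := exists_homogeneous_polynomial
    (tensorInclLeft (GradedReduction k) (grading K) (grading L)) (GradedReduction.map j hj) P.1
    (y := fun y => 1 ⊗ₜ l y) (w := w)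
    (fun y => (tensorInclRight (GradedReduction k) (grading K) (grading L)).map_mem (hl y))
    (l := 1 ⊗ₜ a) (r := r)
    ((tensorInclRight (GradedReduction k) (grading K) (grading L)).map_mem ha) hG0
    (by
      rw [← hq]
      refine Eq.trans ?_ hG
      refine RingHom.congr_fun (f := q.comp (MvPolynomial.eval₂Hom _ _))
        (g := AlgHom.toRingHom _) (MvPolynomial.ringHom_ext (fun c => ?_) ?_) G
      · simp
        rfl
      · rintro (_ | y)
        · simp
        · simpa using hly y)
    (t := fun y => ι (1 ⊗ₜ l y)) (fun y => hιL _ _ (hl y)) hg₁ u (v.comp q) huK huL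
    (fun z hz => by rw [RingHom.comp_apply, (hq z).2 hz, map_zero])
  exact exists_res_of_eval₂_eq_zero u _ r hH0 hH hHa

/-- The reduction map of a completed tensor product of fields is surjective. -/
theorem tensorReductionMap_surjective : Function.Surjective (tensorReductionMap k K L) := by
  intro P
  obtain ⟨x, hx⟩ := exists_tensorReductionMap_le P
  -- Since the reduction of `ℋ(x)` injects into that of `M`, the kernel of `K̃ ⊗ L̃ → M̃` is the
  -- reduction of `x`, which is contained in `P`.
  obtain ⟨M, _, _, _, j, hj⟩ := exists_isAlgClosed_extension x.CompletedResidueField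
  let χ : GradedReduction (CompletedTensor k K L) →+* GradedReduction x.CompletedResidueField :=
    GradedReduction.map x.character x.norm_character_le
  let μ : GradedReduction x.CompletedResidueField →+* GradedReduction M :=
    GradedReduction.map j fun a => (hj a).le
  have hμ : Function.Injective μ := GradedReduction.gradedHom_injective _
  refine exists_tensorReductionMap_eq_of_ker_le
    ((j.comp x.character).comp (CompletedTensor.inclLeft k K L)) (fun a => ?_) P
    ((μ.comp χ).comp (reductionTensorRingHom k K L)) (fun z hz => ?_) (fun c => ?_)
    (fun r l hl => ?_)
  · exact (hj _).trans_le ((x.norm_character_le _).trans (CompletedTensor.norm_inclLeft_le k K L a))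
  · exact hx ((map_eq_zero_iff μ hμ).1 hz)
  · have h1 : reductionTensorRingHom k K L (c ⊗ₜ 1) = GradedReduction.map
        (CompletedTensor.inclLeft k K L) (CompletedTensor.norm_inclLeft_le k K L) c :=
      (reductionTensorRingHom_tmul k K L c 1).trans
        ((congrArg (_ * ·) (map_one _)).trans (mul_one _))
    refine (congrArg (fun z => μ (χ z)) h1).trans ((congrArg μ (GradedReduction.map_map
      (CompletedTensor.inclLeft k K L) (CompletedTensor.norm_inclLeft_le k K L) x.character
      x.norm_character_le c)).trans (GradedReduction.map_map _ _ j (fun a => (hj a).le) c))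
  · exact (GradedReduction.map j fun a => (hj a).le).map_mem
      ((GradedReduction.map x.character x.norm_character_le).map_mem
      ((reductionTensorHom k K L).map_mem
        ((tensorInclRight (GradedReduction k) (grading K) (grading L)).map_mem hl)))

end Surjective

end BerkovichReduction

end

theorem mainTheorem4 {k K L : Type*}
    [NormedField k] [CompleteSpace k] [IsUltrametricDist k]
    [NormedField K] [CompleteSpace K] [IsUltrametricDist K] [NormedAlgebra k K]
    [NormedField L] [CompleteSpace L] [IsUltrametricDist L] [NormedAlgebra k L] :
    Function.Surjective (BerkovichReduction.tensorReductionMap k K L) :=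
  BerkovichReduction.tensorReductionMap_surjective
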